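/- **Notions.** An instance of *Set Cover* consists of a ground set of $n$ elements and a collection of $m$ subsets whose union is the ground set; the task is to output a smallest sub-collection whose union is the ground set (an *optimal solution*). In *$\Delta$-Set Cover*, where $\Delta=\Delta(n)$, all given sets have size at most $\Delta(n)$. An instance of *Directed nTree* consists of a directed graph $G$ (anti-parallel edges are allowed) and an oriented tree $T$ (an arbitrary orientation of an undirected tree), both on $\tilde n$ nodes; the task is to decide whether $G$ has a (not necessarily induced) subgraph isomorphic to $T$. $O^*(\cdot)$ hides factors polynomial in the instance size. A problem restricted to a class of instances is solved by an algorithm that meets its time bound and is correct on the instances of that class; nothing is asked of it on other inputs. Time is measured by the number of executed operations of WHILE programs over binary trees (operations nil, cons, hd, tl, tests for nil, loops, and coin tosses), a model that agrees with random access machines up to factors polylogarithmic in the running time. A randomized algorithm must meet its time bound for all outcomes of its coin tosses and give a correct output with probability at least $2/3$. **Theorem 1.** There are absolute constants $C,K>0$ such that for every $\varepsilon>0$ there is $\delta=\delta(\varepsilon)>0$ with the following property. Suppose that $\Delta$-Set Cover with $\Delta(n)=\frac{C}{\varepsilon}\log n$, restricted to the instances in which every optimal solution has size at most $K\,\varepsilon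 n/\log n$ and consists of pairwise disjoint sets, can be solved in time $O^*(2^{(1-\varepsilon)n})$. Then Directed nTree on $\tilde n$ nodes can be solved in time $O^*(2^{(1-\delta)\tilde n})$. This holds for deterministic algorithms (in hypothesis and conclusion) and likewise for randomized algorithms (in hypothesis and conclusion). In particular, if for some $\varepsilon>0$ and every $\Delta=O(\frac1\varepsilon\log n)$, $\Delta$-Set Cover can be solved in time $O^*(2^{(1-\varepsilon)n})$, then Directed nTree can be solved in time $O^*(2^{(1-\delta)\tilde n})$ for some $\delta=\delta(\varepsilon)>0$. -/

import Mathlib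

namespace LogSetCover

/-! ### The machine model

Programs of the WHILE language over binary trees: finitely many variables, each of which holds (a
pointer to) a binary tree, the operations `nil`, `cons`, `hd`, `tl`, branching and looping on
whether a tree is `nil`, and fair coin tosses; every executed operation takes one step.

A random access machine with logarithmic cost runs on this model, and this model runs on a random
access machine with words of `O(log T)` bits, with an overhead per step that is polynomial in
`log T`, `T` being the running time (memory is a persistent binary trie in one direction, and a
heap of cons cells in the other).  For running times `T` of the form `O*(2 ^ (a n))` that overhead
is polynomial in the instance size, so such bounds mean the same in both models. -/

/-- Binary trees, the values that programs work on. -/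
inductive Data : Type
  | nil : Data
  | cons : Data → Data → Data

namespace Data

/-- The left part of a pair (`nil` for `nil`). -/
def hd : Data → Data
  | nil => nil
  | cons a _ => a

/-- The right part of a pair (`nil` for `nil`). -/
def tl : Data → Data
  | nil => nil
  | cons _ b => b

/-- The number of nodes of a tree. -/
def size : Data → ℕ
  | nil => 1
  | cons a b => a.size + b.size + 1

/-- Truth values as trees. -/
def ofBool : Bool → Data
  | false => nil
  | true => cons nil nil

/-- Lists of trees as trees. -/
def ofList : List Data → Data
  | [] => nil
  | a :: l => cons a (ofList l)

/-- Bit strings as trees. -/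
def ofBits (l : List Bool) : Data := ofList (l.map ofBool)

/-- Natural numbers in unary. -/
def ofNat (n : ℕ) : Data := ofList (List.replicate n nil)

end Data

/-- The contents of the variables. -/
abbrev State : Type := ℕ → Data

/-- Expressions. -/
inductive Expr : Type
  | var : ℕ → Expr
  | nil : Expr
  | cons : Expr → Expr → Expr
  | hd : Expr → Expr
  | tl : Expr → Expr

namespace Expr

/-- The value of an expression. -/
def eval (s : State) : Expr → Data
  | var v => s v
  | nil => Data.nil
  | cons e f => Data.cons (e.eval s) (f.eval s)
  | hd e => (e.eval s).hd
  | tl e => (e.eval s).tl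

/-- The number of operations in the evaluation of an expression. -/
def cost : Expr → ℕ
  | var _ => 1
  | nil => 1
  | cons e f => e.cost + f.cost + 1
  | hd e => e.cost + 1
  | tl e => e.cost + 1

end Expr

/-- Programs. -/
inductive Prog : Type
  /-- assignment of the value of an expression to a variable -/
  | assign : ℕ → Expr → Prog
  /-- assignment of a fresh fair random bit to a variable -/
  | flip : ℕ → Prog
  /-- sequential composition -/
  | seq : Prog → Prog → Prog
  /-- `ite e p q` runs `p` if the value of `e` is not `nil`, and `q` otherwise -/
  | ite : Expr → Prog → Prog → Prog
  /-- `loop e p` repeats `p` as long as the value of `e` is not `nil` -/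
  | loop : Expr → Prog → Prog

/-- A program without coin tosses. -/
def Prog.Deterministic : Prog → Prop
  | .assign _ _ => True
  | .flip _ => False
  | .seq p q => p.Deterministic ∧ q.Deterministic
  | .ite _ p q => p.Deterministic ∧ q.Deterministic
  | .loop _ p => p.Deterministic

/-- `Exec p s c s' t`: the program `p`, started with contents `s` of the variables, halts after
exactly `t` steps with contents `s'`, and the coins tossed meanwhile showed exactly `c`. -/
inductive Exec : Prog → State → List Bool → State → ℕ → Prop
  | assign (v : ℕ) (e : Expr) (s : State) :
      Exec (.assign v e) s [] (Function.update s v (e.eval s)) (e.cost + 1)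
  | flip (v : ℕ) (b : Bool) (s : State) :
      Exec (.flip v) s [b] (Function.update s v (Data.ofBool b)) 1
  | seq {p q : Prog} {s s' s'' : State} {c c' : List Bool} {t t' : ℕ} :
      Exec p s c s' t → Exec q s' c' s'' t' → Exec (.seq p q) s (c ++ c') s'' (t + t')
  | ite_true {e : Expr} {p q : Prog} {s s' : State} {c : List Bool} {t : ℕ} :
      e.eval s ≠ Data.nil → Exec p s c s' t → Exec (.ite e p q) s c s' (e.cost + 1 + t)
  | ite_false {e : Expr} {p q : Prog} {s s' : State} {c : List Bool} {t : ℕ} :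
      e.eval s = Data.nil → Exec q s c s' t → Exec (.ite e p q) s c s' (e.cost + 1 + t)
  | loop_false {e : Expr} {p : Prog} {s : State} :
      e.eval s = Data.nil → Exec (.loop e p) s [] s (e.cost + 1)
  | loop_true {e : Expr} {p : Prog} {s s' s'' : State} {c c' : List Bool} {t t' : ℕ} :
      e.eval s ≠ Data.nil → Exec p s c s' t → Exec (.loop e p) s' c' s'' t' →
        Exec (.loop e p) s (c ++ c') s'' (e.cost + 1 + t + t')

/-- The initial contents of the variables: the input is in variable `0`, the others hold `nil`. -/
def start (x : Data) : State := Function.update (fun _ => Data.nil) 0 x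

/-- On input `x`, whatever the coins show, `p` halts within `T` steps. -/
def HaltsWithin (p : Prog) (x : Data) (T : ℝ) : Prop :=
  ∀ ω : ℕ → Bool, ∃ (k : ℕ) (s' : State) (t : ℕ),
    Exec p (start x) ((List.range k).map ω) s' t ∧ (t : ℝ) ≤ T

open Classical in
/-- The probability that `p` halts on input `x` with an output (the final content of variable `0`)
in `Q`: a run that tosses its coins with outcome `c` has probability `2 ^ (-|c|)`. -/
noncomputable def outputProb (p : Prog) (x : Data) (Q : Data → Prop) : ENNReal :=
  ∑' c : List Bool,
    if ∃ (s' : State) (t : ℕ), Exec p (start x) c s' t ∧ Q (s' 0) then (2 : ENNReal)⁻¹ ^ c.length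
    else 0

/-! ### Problems and running times -/

/-- A computational problem with a parameter (in both problems below, the number that running times
are measured in). -/
structure Problem where
  /-- the instances -/
  Inst : Type
  /-- the input given to a program -/
  encode : Inst → Data
  /-- the parameter of an instance -/
  param : Inst → ℕ
  /-- the correct outputs -/
  IsAnswer : Inst → Data → Prop

/-- The problem `P` restricted to the instances with the property `φ`; nothing is asked of an
algorithm on other inputs. -/
def Problem.restrict (P : Problem) (φ : P.Inst → Prop) : Problem where
  Inst := {x : P.Inst // φ x}
  encode x := P.encode x.1
  param x := P.param x.1
  IsAnswer x := P.IsAnswer x.1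

/-- The bound `A * |x| ^ k * 2 ^ (a * n)` on the number of steps on an instance `x` with parameter
`n`, where `|x|` is the size of the instance. -/
noncomputable def Problem.timeBound (P : Problem) (a : ℝ) (A k : ℕ) (x : P.Inst) : ℝ :=
  (A : ℝ) * ((P.encode x).size : ℝ) ^ k * (2 : ℝ) ^ (a * (P.param x : ℝ))

/-- `P` can be solved by a deterministic algorithm in time `O*(2 ^ (a * n))`, where `n` is the
parameter, and `O*` hides factors polynomial in the instance size. -/
def Problem.SolvableInTime (P : Problem) (a : ℝ) : Prop :=
  ∃ p : Prog, p.Deterministic ∧ ∃ A k : ℕ, ∀ x : P.Inst, ∃ (s' : State) (t : ℕ),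
    Exec p (start (P.encode x)) [] s' t ∧ (t : ℝ) ≤ P.timeBound a A k x ∧ P.IsAnswer x (s' 0)

/-- `P` can be solved by a randomized algorithm in time `O*(2 ^ (a * n))`: the time bound holds for
all outcomes of the coin tosses, and the output is correct with probability at least `2 / 3`. -/
def Problem.RandSolvableInTime (P : Problem) (a : ℝ) : Prop :=
  ∃ p : Prog, ∃ A k : ℕ, ∀ x : P.Inst,
    HaltsWithin p (P.encode x) (P.timeBound a A k x) ∧
      2 / 3 ≤ outputProb p (P.encode x) (P.IsAnswer x)

/-! ### Set Cover -/

/-- An instance of Set Cover: `m` subsets of a ground set of `n` elements, whose union is the whole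
ground set. -/
structure SetCoverInstance where
  /-- the number of elements -/
  n : ℕ
  /-- the number of sets -/
  m : ℕ
  /-- the sets -/
  sets : Fin m → Finset (Fin n)
  covers : ∀ j, ∃ i, j ∈ sets i

namespace SetCoverInstance

/-- The union of the sub-collection `I` is the ground set. -/
def IsCover (x : SetCoverInstance) (I : Finset (Fin x.m)) : Prop :=
  ∀ j, ∃ i ∈ I, j ∈ x.sets i

/-- `I` is a smallest sub-collection whose union is the ground set. -/
def IsOptimal (x : SetCoverInstance) (I : Finset (Fin x.m)) : Prop :=
  x.IsCover I ∧ ∀ J, x.IsCover J → I.card ≤ J.card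

/-- The sets in the sub-collection `I` are pairwise disjoint. -/
def IsDisjoint (x : SetCoverInstance) (I : Finset (Fin x.m)) : Prop :=
  ∀ i ∈ I, ∀ j ∈ I, i ≠ j → Disjoint (x.sets i) (x.sets j)

/-- The instance as a tree: `n` in unary, and the list of the characteristic vectors of the sets. -/
def encode (x : SetCoverInstance) : Data :=
  Data.cons (Data.ofNat x.n)
    (Data.ofList (List.ofFn fun i : Fin x.m =>
      Data.ofBits (List.ofFn fun j : Fin x.n => decide (j ∈ x.sets i))))

end SetCoverInstance

/-- Set Cover: find a smallest sub-collection whose union is the ground set (to be output as its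
characteristic vector), with the number of elements as the parameter. -/
def setCover : Problem where
  Inst := SetCoverInstance
  encode x := x.encode
  param x := x.n
  IsAnswer x y := ∃ I : Finset (Fin x.m), x.IsOptimal I ∧
    y = Data.ofBits (List.ofFn fun i : Fin x.m => decide (i ∈ I))

/-- `Δ`-Set Cover, for a bound `Δ = Δ(n)` on the sizes of the sets that may depend on the number of
elements, restricted to the instances in which every optimal solution consists of disjoint sets and
has size at most `σ * n / log n` (written without division). -/
def deltaSetCover (Δ : ℕ → ℝ) (σ : ℝ) : Problem :=
  setCover.restrict fun x : SetCoverInstance =>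
    (∀ i, ((x.sets i).card : ℝ) ≤ Δ x.n) ∧
      ∀ I, x.IsOptimal I → (I.card : ℝ) * Real.log x.n ≤ σ * x.n ∧ x.IsDisjoint I

/-! ### Directed nTree -/

/-- An instance of Directed nTree: a directed graph `G` and an oriented tree `T`, both on `n`
nodes.  Anti-parallel edges are allowed in `G`, and the orientation of `T` is arbitrary. -/
structure TreeInstance where
  /-- the number of nodes of `G`, and of `T` -/
  n : ℕ
  /-- the host graph -/
  G : Digraph (Fin n)
  /-- the pattern tree -/
  T : Digraph (Fin n)
  oriented : ∀ u v, T.Adj u v → ¬ T.Adj v u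
  isTree : (SimpleGraph.fromRel T.Adj).IsTree

open Classical in
/-- The adjacency matrix of a directed graph, as a tree. -/
noncomputable def encodeDigraph {n : ℕ} (G : Digraph (Fin n)) : Data :=
  Data.ofList (List.ofFn fun u : Fin n =>
    Data.ofBits (List.ofFn fun v : Fin n => decide (G.Adj u v)))

namespace TreeInstance

/-- `G` has a subgraph (not necessarily induced) that is isomorphic to `T`. -/
def IsYes (x : TreeInstance) : Prop :=
  ∃ φ : Fin x.n ↪ Fin x.n, ∀ u v, x.T.Adj u v → x.G.Adj (φ u) (φ v)

/-- The instance as a tree: `n` in unary, and the two adjacency matrices. -/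
noncomputable def encode (x : TreeInstance) : Data :=
  Data.cons (Data.ofNat x.n) (Data.cons (encodeDigraph x.G) (encodeDigraph x.T))

end TreeInstance

open Classical in
/-- Directed nTree: decide whether the host graph contains the pattern tree, with the number of
nodes as the parameter. -/
noncomputable def directedNTree : Problem where
  Inst := TreeInstance
  encode x := x.encode
  param x := x.n
  IsAnswer x y := y = Data.ofBool (decide x.IsYes)

end LogSetCover

namespace LogSetCover

/-! Let `n` be the number of nodes and `s = q * log n`, with `q` of order `1/ε`. A tree on `n` nodes
has a set of at most `n / (s + 1)` nodes whose removal leaves components of size at most `s`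
(`exists_separator`). The reduction runs through all lists of about `n / s` pairs (node of `T`, node
of `G`). There are `2 ^ O(n / q)` of them, and if `T` embeds in `G`, one of them describes an
embedding on a separator. The components outside the guessed nodes are grouped greedily into pieces
with at most `2 s` nodes, all but one of them with at least `s` (`pieces_fold`), so the number `k`
of pieces is at most `n / s + 1`.

A guess yields a Set Cover instance. The ground set consists of the `n` nodes of `G` and one marker
for each piece. For each piece and each map from it to `G` that is compatible with the edges and
with the guess, there is a set consisting of the image and the marker. The sets have size at most `2
s + 1`, and there are only quasipolynomially many. An exact cover picks one map for each marker.
These maps fit together to an edge-preserving map, since an edge between two pieces has a guessed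
end, and this map is surjective, hence an embedding (`isYes_of_exactCover`). Conversely, an
embedding that extends the guess gives a cover by `k` sets. Every cover needs a set for each marker,
so an optimal one has exactly one set per marker. Its sets have total size at most `n + k`, so they
are disjoint (`exists_guess`). Hence the instance for a correct guess satisfies the promise.

Wrong guesses may lead to instances outside the promise, on which the Set Cover algorithm can do
anything. It is therefore run under a clock (`exists_halts_clocked`, `Exec.clocked`), and its output
is accepted only if it is seen to be an exact cover. So there are no false positives, and one good
guess suffices for success probability `2/3` (`Components.prob_loop`). The clock is set to `2 ^ (n -
n / Q)` with `Q` about `2/ε`, which exceeds `2 ^ ((1 - ε) (n + k))` times quasipolynomial factors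
(`exists_forall_timeBound_le`). The cost of enumerating the guesses is `2 ^ O(κ n / q)`, where `κ`
is the exponent in the running time of the enumeration. The choice `q = 8 κ Q` makes it small enough
for the total to be at most `2 ^ ((1 - 1/(2Q)) n)` (`exists_forall_total_le`). Small `n` are handled
by guessing the whole embedding.

Deterministic algorithms are treated as randomized ones without coins. For `ε > 1` the hypothesis is
contradictory: its time bound falls below one step on large instances (`not_solvedBy_of_one_lt`). -/

/-! ### Uniqueness and length of runs -/

theorem Exec.coins_eq_nil {p : Prog} {s s' : State} {c : List Bool} {t : ℕ}
    (h : Exec p s c s' t) (hp : p.Deterministic) : c = [] := by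
  induction h with
  | assign => rfl
  | flip => exact hp.elim
  | seq _ _ ih1 ih2 => rw [ih1 hp.1, ih2 hp.2]; rfl
  | ite_true _ _ ih => exact ih hp.1
  | ite_false _ _ ih => exact ih hp.2
  | loop_false => rfl
  | loop_true _ _ _ ih1 ih2 => rw [ih1 hp, ih2 hp]; rfl

/-- A run reads its coins one after the other, so two halting runs whose coin strings have a common
extension make the same choices throughout. In particular, the coin strings of halting runs form a
prefix-free set; this is what `weight_mul_le` needs. -/
theorem Exec.unique {p : Prog} {s s₁ : State} {c : List Bool} {t₁ : ℕ} (h : Exec p s c s₁ t₁) :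
    ∀ {d x y : List Bool} {s₂ : State} {t₂ : ℕ}, Exec p s d s₂ t₂ → c ++ x = d ++ y →
      c = d ∧ s₁ = s₂ ∧ t₁ = t₂ := by
  induction h with
  | assign => intro d x y s₂ t₂ h2 _; cases h2; simp
  | flip =>
    intro d x y s₂ t₂ h2 e; cases h2
    simp only [List.cons_append, List.nil_append, List.cons.injEq] at e
    simp [e.1]
  | seq _ _ ih1 ih2 =>
    intro d x y s₂ t₂ h2 e; cases h2 with
    | seq a b =>
      rw [List.append_assoc, List.append_assoc] at e
      obtain ⟨rfl, rfl, rfl⟩ := ih1 a e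
      obtain ⟨rfl, rfl, rfl⟩ := ih2 b (List.append_cancel_left e)
      simp
  | ite_true he _ ih =>
    intro d x y s₂ t₂ h2 e; cases h2 with
    | ite_true _ b => obtain ⟨rfl, rfl, rfl⟩ := ih b e; simp
    | ite_false he' b => exact absurd he' he
  | ite_false he _ ih =>
    intro d x y s₂ t₂ h2 e; cases h2 with
    | ite_false _ b => obtain ⟨rfl, rfl, rfl⟩ := ih b e; simp
    | ite_true he' b => exact absurd he he'
  | loop_false he =>
    intro d x y s₂ t₂ h2 e; cases h2 with
    | loop_false => simp
    | loop_true he' => exact absurd he he'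
  | loop_true he _ _ ih1 ih2 =>
    intro d x y s₂ t₂ h2 e; cases h2 with
    | loop_false he' => exact absurd he' he
    | loop_true _ a b =>
      rw [List.append_assoc, List.append_assoc] at e
      obtain ⟨rfl, rfl, rfl⟩ := ih1 a e
      obtain ⟨rfl, rfl, rfl⟩ := ih2 b (List.append_cancel_left e)
      simp

theorem Expr.one_le_cost (e : Expr) : 1 ≤ e.cost := by cases e <;> simp [Expr.cost]

/-- The first bound turns time bounds into bounds on the number of coins. The second makes a time
bound below one contradictory, which settles the case `ε > 1`. -/
theorem Exec.length_add_one_le {p : Prog} {s s' : State} {c : List Bool} {t : ℕ}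
    (h : Exec p s c s' t) : c.length ≤ t ∧ 1 ≤ t := by
  induction h with
  | assign => simp
  | flip => simp
  | seq => simp only [List.length_append]; omega
  | ite_true => omega
  | ite_false => omega
  | loop_false => simp
  | loop_true => simp only [List.length_append]; omega

/-! ### Typed computations -/

/-- Types whose elements are represented by trees. -/
class Enc (α : Type) where
  enc : α → Data

open Enc (enc)

instance : Enc Data := ⟨id⟩
instance : Enc Unit := ⟨fun _ => Data.nil⟩
instance : Enc Bool := ⟨Data.ofBool⟩
instance : Enc ℕ := ⟨Data.ofNat⟩
instance {α β : Type} [Enc α] [Enc β] : Enc (α × β) := ⟨fun x => Data.cons (enc x.1) (enc x.2)⟩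
instance {α : Type} [Enc α] : Enc (List α) := ⟨fun l => Data.ofList (l.map enc)⟩

/-- `f` is computed within `T a` steps, from any variable to any other, with scratch space in the
variables from a given index on. -/
def Computes {α β : Type} [Enc α] [Enc β] (f : α → β) (T : α → ℕ) : Prop :=
  ∀ i o b : ℕ, i < b → o < b → ∃ p : Prog, p.Deterministic ∧ ∀ (s : State) (a : α), s i = enc a →
    ∃ (s' : State) (t : ℕ), Exec p s [] s' t ∧ t ≤ T a ∧ s' o = enc (f a) ∧
      ∀ v < b, v ≠ o → s' v = s v

theorem Exec.seq_nil {p q : Prog} {s s' s'' : State} {t t' : ℕ}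
    (h : Exec p s [] s' t) (h' : Exec q s' [] s'' t') : Exec (.seq p q) s [] s'' (t + t') := by
  simpa using Exec.seq h h'

theorem Exec.loop_nil {e : Expr} {p : Prog} {s s' s'' : State} {t t' : ℕ} (he : e.eval s ≠ Data.nil)
    (h : Exec p s [] s' t) (h' : Exec (.loop e p) s' [] s'' t') :
    Exec (.loop e p) s [] s'' (e.cost + 1 + t + t') := by
  simpa using Exec.loop_true he h h'

/-! ### Combinators for programs with explicit time bounds -/

section

variable {α β γ δ : Type} [Enc α] [Enc β] [Enc γ] [Enc δ]

theorem Computes.mono {f : α → β} {T T' : α → ℕ} (h : Computes f T) (hT : ∀ a, T a ≤ T' a) :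
    Computes f T' := by
  intro i o b hi ho
  obtain ⟨p, hp, H⟩ := h i o b hi ho
  refine ⟨p, hp, fun s a hs => ?_⟩
  obtain ⟨s', t, h1, h2, h3⟩ := H s a hs
  exact ⟨s', t, h1, h2.trans (hT a), h3⟩

theorem Computes.of_expr {f : α → β} (e : ℕ → Expr) (c : ℕ) (hc : ∀ i, (e i).cost ≤ c)
    (he : ∀ s i a, s i = enc a → (e i).eval s = enc (f a)) : Computes f fun _ => c + 1 := by
  intro i o b hi ho
  refine ⟨.assign o (e i), trivial, fun s a hs => ⟨_, _, .assign _ _ _, ?_, ?_, ?_⟩⟩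
  · have := hc i; dsimp only; omega
  · simp [he s i a hs]
  · intro v _ hv; simp [hv]

theorem Computes.comp {f : α → β} {g : β → γ} {T : α → ℕ} {U : β → ℕ} (hg : Computes g U)
    (hf : Computes f T) : Computes (fun a => g (f a)) fun a => T a + U (f a) := by
  intro i o b hi ho
  obtain ⟨p, hp, P⟩ := hf i b (b + 1) (by omega) (by omega)
  obtain ⟨q, hq, Q⟩ := hg b o (b + 1) (by omega) (by omega)
  refine ⟨.seq p q, ⟨hp, hq⟩, fun s a hs => ?_⟩
  obtain ⟨s₁, t₁, h1, h2, h3, h4⟩ := P s a hs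
  obtain ⟨s₂, t₂, k1, k2, k3, k4⟩ := Q s₁ (f a) h3
  refine ⟨s₂, _, h1.seq_nil k1, by dsimp only; omega, k3, fun v hv hvo => ?_⟩
  rw [k4 v (by omega) hvo, h4 v (by omega) (by omega)]

theorem Computes.pair {f : α → β} {g : α → γ} {T U : α → ℕ} (hf : Computes f T)
    (hg : Computes g U) : Computes (fun a => (f a, g a)) fun a => T a + U a + 4 := by
  intro i o b hi ho
  obtain ⟨p, hp, P⟩ := hf i b (b + 1) (by omega) (by omega)
  obtain ⟨q, hq, Q⟩ := hg i (b + 1) (b + 2) (by omega) (by omega)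
  refine ⟨.seq p (.seq q (.assign o (.cons (.var b) (.var (b + 1))))), ⟨hp, hq, trivial⟩,
    fun s a hs => ?_⟩
  obtain ⟨s₁, t₁, h1, h2, h3, h4⟩ := P s a hs
  obtain ⟨s₂, t₂, k1, k2, k3, k4⟩ := Q s₁ a (by rw [h4 i (by omega) (by omega), hs])
  refine ⟨_, _, h1.seq_nil (k1.seq_nil (.assign _ _ _)), ?_, ?_, fun v hv hvo => ?_⟩
  · simp only [Expr.cost]; omega
  · have hb : s₂ b = enc (f a) := by rw [k4 b (by omega) (by omega), h3]
    simp only [Function.update_self, Expr.eval, hb, k3]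
    rfl
  · rw [Function.update_of_ne hvo, k4 v (by omega) (by omega), h4 v (by omega) (by omega)]

theorem enc_false : enc false = Data.nil := rfl
theorem enc_true : enc true = Data.cons Data.nil Data.nil := rfl
theorem enc_nil : enc ([] : List α) = Data.nil := rfl
theorem enc_cons (a : α) (l : List α) : enc (a :: l) = Data.cons (enc a) (enc l) := rfl
theorem enc_pair (a : α) (b : β) : enc (a, b) = Data.cons (enc a) (enc b) := rfl
theorem enc_zero : enc (0 : ℕ) = Data.nil := rfl
theorem enc_succ (n : ℕ) : enc (n + 1) = Data.cons Data.nil (enc n) := rfl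

theorem Computes.ite {c : α → Bool} {f g : α → β} {V T U : α → ℕ} (hc : Computes c V)
    (hf : Computes f T) (hg : Computes g U) :
    Computes (fun a => if c a then f a else g a) fun a => V a + T a + U a + 2 := by
  intro i o b hi ho
  obtain ⟨r, hr, R⟩ := hc i b (b + 1) (by omega) (by omega)
  obtain ⟨p, hp, P⟩ := hf i o (b + 1) (by omega) (by omega)
  obtain ⟨q, hq, Q⟩ := hg i o (b + 1) (by omega) (by omega)
  refine ⟨.seq r (.ite (.var b) p q), ⟨hr, hp, hq⟩, fun s a hs => ?_⟩
  obtain ⟨s₁, t₁, h1, h2, h3, h4⟩ := R s a hs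
  have hi1 : s₁ i = enc a := by rw [h4 i (by omega) (by omega), hs]
  cases hca : c a with
  | true =>
    obtain ⟨s₂, t₂, k1, k2, k3, k4⟩ := P s₁ a hi1
    refine ⟨s₂, _, h1.seq_nil (.ite_true ?_ k1), ?_, ?_, fun v hv hvo => ?_⟩
    · simp [Expr.eval, h3, hca, enc_true]
    · simp only [Expr.cost]; omega
    · simpa [hca] using k3
    · rw [k4 v (by omega) hvo, h4 v (by omega) (by omega)]
  | false =>
    obtain ⟨s₂, t₂, k1, k2, k3, k4⟩ := Q s₁ a hi1
    refine ⟨s₂, _, h1.seq_nil (.ite_false ?_ k1), ?_, ?_, fun v hv hvo => ?_⟩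
    · simp [Expr.eval, h3, hca, enc_false]
    · simp only [Expr.cost]; omega
    · simpa [hca] using k3
    · rw [k4 v (by omega) hvo, h4 v (by omega) (by omega)]

/-- The time of a step needs to be bounded by `N` only at accumulators that occur in the fold. This
matters for accumulators of exponential size, where no bound in terms of arbitrary accumulators
would help. -/
theorem Computes.foldl {l : γ → List α} {init : γ → β} {f : γ × β × α → β} {T U N : γ → ℕ}
    {V : γ × β × α → ℕ} (hl : Computes l T) (hi : Computes init U) (hf : Computes f V)
    (hN : ∀ c l₁ a l₂, l c = l₁ ++ a :: l₂ →
      V (c, l₁.foldl (fun b a => f (c, b, a)) (init c), a) ≤ N c) :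
    Computes (fun c => (l c).foldl (fun b a => f (c, b, a)) (init c))
      fun c => T c + U c + (N c + 14) * ((l c).length + 1) := by
  intro i o b hi' ho
  obtain ⟨p, hp, P⟩ := hl i b (b + 1) (by omega) (by omega)
  obtain ⟨q, hq, Q⟩ := hi i (b + 1) (b + 2) (by omega) (by omega)
  obtain ⟨r, hr, R⟩ := hf (b + 2) (b + 1) (b + 3) (by omega) (by omega)
  -- Variable `b` holds the unread part of the list, `b + 1` the accumulator, and `b + 2` the
  -- argument of the step.
  let body : Prog := .seq (.assign (b + 2) (.cons (.var i) (.cons (.var (b + 1)) (.hd (.var b)))))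
    (.seq (.assign b (.tl (.var b))) r)
  refine ⟨.seq p (.seq q (.seq (.loop (.var b) body) (.assign o (.var (b + 1))))),
    ⟨hp, hq, ⟨trivial, trivial, hr⟩, trivial⟩, fun s c hs => ?_⟩
  obtain ⟨s₁, t₁, h1, h2, h3, h4⟩ := P s c hs
  obtain ⟨s₂, t₂, k1, k2, k3, k4⟩ := Q s₁ c (by rw [h4 i (by omega) (by omega), hs])
  -- Loop invariant: `l₁` has been folded and `l₂` is left. A round costs at most `12` steps besides
  -- the call of `r`.
  have key : ∀ (l₂ l₁ : List α), l c = l₁ ++ l₂ → ∀ s : State, s i = enc c → s b = enc l₂ →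
      s (b + 1) = enc (l₁.foldl (fun b a => f (c, b, a)) (init c)) →
      ∃ s' t, Exec (.loop (.var b) body) s [] s' t ∧ t ≤ (N c + 14) * l₂.length + 2 ∧
        s' (b + 1) = enc ((l c).foldl (fun b a => f (c, b, a)) (init c)) ∧
        ∀ v < b, s' v = s v := by
    intro l₂
    induction l₂ with
    | nil =>
      intro l₁ hl s _ hb hb1
      refine ⟨s, _, .loop_false hb, by simp [Expr.cost], ?_, fun v _ => rfl⟩
      rw [hb1, hl]; simp
    | cons a l₂ ih =>
      intro l₁ hl s hi hb hb1
      set s₃ := Function.update s (b + 2)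
        (enc (c, l₁.foldl (fun b a => f (c, b, a)) (init c), a)) with hs3
      set s₄ := Function.update s₃ b (enc l₂) with hs4
      obtain ⟨s₅, t₅, m1, m2, m3, m4⟩ := R s₄ (c, l₁.foldl (fun b a => f (c, b, a)) (init c), a)
        (by simp [hs4, hs3])
      have e1 : Exec (.assign (b + 2) (.cons (.var i) (.cons (.var (b + 1)) (.hd (.var b))))) s []
          s₃ 7 := by
        have := Exec.assign (b + 2) (.cons (.var i) (.cons (.var (b + 1)) (.hd (.var b)))) s
        simpa [Expr.eval, Expr.cost, hi, hb, hb1, enc_cons, Data.hd, hs3, enc_pair] using this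
      have e2 : Exec (.assign b (.tl (.var b))) s₃ [] s₄ 3 := by
        have := Exec.assign b (.tl (.var b)) s₃
        have hb' : s₃ b = enc (a :: l₂) := by simp [hs3, hb]
        simpa [Expr.eval, Expr.cost, hb', enc_cons, Data.tl, hs4] using this
      obtain ⟨s', t', n1, n2, n3, n4⟩ := ih (l₁ ++ [a]) (by simp [hl]) s₅
        (by rw [m4 i (by omega) (by omega)]
            simp [hs4, hs3, show i ≠ b by omega, show i ≠ b + 2 by omega, hi])
        (by rw [m4 b (by omega) (by omega)]; simp [hs4])
        (by rw [m3]; simp)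
      refine ⟨s', _, .loop_nil ?_ (e1.seq_nil (e2.seq_nil m1)) n1, ?_, n3, fun v hv => ?_⟩
      · simp [Expr.eval, hb, enc_cons]
      · have := hN c l₁ a l₂ hl
        simp only [Expr.cost, List.length_cons]
        rw [mul_add]
        omega
      · rw [n4 v hv, m4 v (by omega) (by omega)]
        simp [hs4, hs3, show v ≠ b by omega, show v ≠ b + 2 by omega]
  obtain ⟨s₃, t₃, m1, m2, m3, m4⟩ := key (l c) [] rfl s₂
    (by rw [k4 i (by omega) (by omega), h4 i (by omega) (by omega), hs])
    (by rw [k4 b (by omega) (by omega), h3]) k3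
  refine ⟨_, _, h1.seq_nil (k1.seq_nil (m1.seq_nil (.assign _ _ _))), ?_, ?_, fun v hv hvo => ?_⟩
  · simp only [Expr.cost]; rw [mul_add]; omega
  · simpa [Expr.eval] using m3
  · rw [Function.update_of_ne hvo, m4 v hv, k4 v (by omega) (by omega),
      h4 v (by omega) (by omega)]

end

/-! ### Polynomial-time computability -/

/-- The size of the representation of `a`. -/
def sz {α : Type} [Enc α] (a : α) : ℕ := (enc a).size

/-- `g` is bounded by a polynomial in the size of its argument. -/
def PolyBdd {α : Type} [Enc α] (g : α → ℕ) : Prop := ∃ k, ∀ a, g a ≤ (sz a + 2) ^ k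

/-- `f` is computable in polynomial time, with results of polynomial size. -/
@[fun_prop]
def PT {α β : Type} [Enc α] [Enc β] (f : α → β) : Prop :=
  PolyBdd (fun a => sz (f a)) ∧ ∃ T, PolyBdd T ∧ Computes f T

section

variable {α β γ δ : Type} [Enc α] [Enc β] [Enc γ] [Enc δ]

theorem PolyBdd.mono {g h : α → ℕ} (hg : PolyBdd g) (H : ∀ a, h a ≤ g a) : PolyBdd h := by
  obtain ⟨k, hk⟩ := hg
  exact ⟨k, fun a => (H a).trans (hk a)⟩

theorem PolyBdd.const (c : ℕ) : PolyBdd fun _ : α => c :=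
  ⟨c, fun a => (Nat.lt_two_pow_self).le.trans (Nat.pow_le_pow_left (by omega) c)⟩

theorem PolyBdd.id : PolyBdd fun a : α => sz a := ⟨1, fun a => by simp⟩

theorem PolyBdd.mul {g h : α → ℕ} (hg : PolyBdd g) (hh : PolyBdd h) :
    PolyBdd fun a => g a * h a := by
  obtain ⟨k, hk⟩ := hg
  obtain ⟨l, hl⟩ := hh
  exact ⟨k + l, fun a => by rw [pow_add]; exact Nat.mul_le_mul (hk a) (hl a)⟩

theorem PolyBdd.add {g h : α → ℕ} (hg : PolyBdd g) (hh : PolyBdd h) :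
    PolyBdd fun a => g a + h a := by
  obtain ⟨k, hk⟩ := hg
  obtain ⟨l, hl⟩ := hh
  refine ⟨k + l + 1, fun a => ?_⟩
  have h1 : (sz a + 2) ^ k ≤ (sz a + 2) ^ (k + l) := Nat.pow_le_pow_right (by omega) (by omega)
  have h2 : (sz a + 2) ^ l ≤ (sz a + 2) ^ (k + l) := Nat.pow_le_pow_right (by omega) (by omega)
  calc g a + h a ≤ (sz a + 2) ^ (k + l) * 2 := by linarith [hk a, hl a]
    _ ≤ (sz a + 2) ^ (k + l + 1) := by
      rw [pow_succ]; exact Nat.mul_le_mul_left _ (by omega)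

theorem PolyBdd.pow {g : α → ℕ} (hg : PolyBdd g) (n : ℕ) : PolyBdd fun a => g a ^ n := by
  induction n with
  | zero => simpa using PolyBdd.const 1
  | succ n ih => simpa [pow_succ] using ih.mul hg

theorem PolyBdd.comp {g : β → ℕ} {f : α → β} (hg : PolyBdd g) (hf : PolyBdd fun a => sz (f a)) :
    PolyBdd fun a => g (f a) := by
  obtain ⟨k, hk⟩ := hg
  exact ((hf.add (PolyBdd.const 2)).pow k).mono fun a => hk _

theorem Data.one_le_size (d : Data) : 1 ≤ d.size := by cases d <;> simp [Data.size]

theorem one_le_sz (a : α) : 1 ≤ sz a := Data.one_le_size _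

theorem sz_nil : sz ([] : List α) = 1 := rfl
theorem sz_cons (a : α) (l : List α) : sz (a :: l) = sz a + sz l + 1 := rfl
theorem sz_pair (a : α) (b : β) : sz (a, b) = sz a + sz b + 1 := rfl
theorem sz_bool (b : Bool) : sz b ≤ 3 := by
  cases b <;> simp [sz, enc_false, enc_true, Data.size]
theorem sz_succ (n : ℕ) : sz (n + 1) = sz n + 2 := by
  simp only [sz, enc_succ, Data.size]; omega
theorem sz_nat (n : ℕ) : sz n = 2 * n + 1 := by
  induction n with
  | zero => rfl
  | succ n ih => rw [sz_succ, ih]; ring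

theorem sz_append (l l' : List α) : sz (l ++ l') + 1 = sz l + sz l' := by
  induction l with
  | nil => simp [sz_nil]; omega
  | cons a l ih => simp only [List.cons_append, sz_cons]; omega

theorem length_le_sz (l : List α) : l.length + 1 ≤ sz l := by
  induction l with
  | nil => simp [sz_nil]
  | cons a l ih => simp only [List.length_cons, sz_cons]; omega

theorem sz_le_of_mem {a : α} {l : List α} (h : a ∈ l) : sz a + 2 ≤ sz l := by
  obtain ⟨l₁, l₂, rfl⟩ := List.append_of_mem h
  have := sz_append l₁ (a :: l₂)
  have := one_le_sz l₁
  have := one_le_sz l₂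
  rw [sz_cons] at *
  omega

theorem sz_le_of_forall {l : List α} {B : ℕ} (h : ∀ a ∈ l, sz a ≤ B) :
    sz l ≤ l.length * (B + 1) + 1 := by
  induction l with
  | nil => simp [sz_nil]
  | cons a l ih =>
    have h1 := h a (by simp)
    have h2 := ih fun x hx => h x (by simp [hx])
    rw [sz_cons, List.length_cons, add_mul]
    omega

theorem sz_le_of_sublist {l l' : List α} (h : l.Sublist l') : sz l ≤ sz l' := by
  induction h with
  | slnil => exact le_rfl
  | cons a _ ih => rw [sz_cons]; omega
  | cons_cons a _ ih => simp only [sz_cons]; omega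

theorem PT.polyBdd {f : α → β} (hf : PT f) : PolyBdd fun a => sz (f a) := hf.1

@[fun_prop]
theorem PT.id : PT fun a : α => a :=
  ⟨PolyBdd.id, _, PolyBdd.const 2, .of_expr .var 1 (fun _ => le_rfl) fun _ _ _ h => h⟩

@[fun_prop]
theorem PT.comp {g : β → γ} {f : α → β} (hg : PT g) (hf : PT f) : PT fun a => g (f a) := by
  obtain ⟨h1, T, hT, cf⟩ := hf
  obtain ⟨h2, U, hU, cg⟩ := hg
  exact ⟨h2.comp h1, _, hT.add (hU.comp h1), cg.comp cf⟩

theorem exists_expr_eval (d : Data) : ∃ e : Expr, ∀ s, e.eval s = d := by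
  induction d with
  | nil => exact ⟨.nil, fun _ => rfl⟩
  | cons a b ha hb =>
    obtain ⟨e, he⟩ := ha
    obtain ⟨f, hf⟩ := hb
    exact ⟨.cons e f, fun s => by simp [Expr.eval, he, hf]⟩

@[fun_prop]
theorem PT.const (b : β) : PT fun _ : α => b := by
  obtain ⟨e, he⟩ := exists_expr_eval (enc b)
  exact ⟨PolyBdd.const _, _, PolyBdd.const _,
    .of_expr (fun _ => e) e.cost (fun _ => le_rfl) fun _ _ _ _ => he _⟩

@[fun_prop]
theorem PT.pair {f : α → β} {g : α → γ} (hf : PT f) (hg : PT g) : PT fun a => (f a, g a) := by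
  obtain ⟨h1, T, hT, cf⟩ := hf
  obtain ⟨h2, U, hU, cg⟩ := hg
  exact ⟨(h1.add h2).add (.const 1), _, (hT.add hU).add (.const 4), cf.pair cg⟩

theorem PT.of_expr {f : α → β} (e : ℕ → Expr) (c : ℕ) (hc : ∀ i, (e i).cost ≤ c)
    (he : ∀ s i a, s i = enc a → (e i).eval s = enc (f a)) (hs : PolyBdd fun a => sz (f a)) :
    PT f :=
  ⟨hs, _, .const _, .of_expr e c hc he⟩

@[fun_prop]
theorem PT.fst {f : α → β × γ} (hf : PT f) : PT fun a => (f a).1 :=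
  PT.comp (g := Prod.fst) (.of_expr (fun i => .hd (.var i)) 2 (fun _ => le_rfl)
    (fun s i a h => by rcases a with ⟨a, b⟩; simp [Expr.eval, h, enc_pair, Data.hd])
    (PolyBdd.id.mono fun a => by rcases a with ⟨a, b⟩; simp only [sz_pair]; omega)) hf

@[fun_prop]
theorem PT.snd {f : α → β × γ} (hf : PT f) : PT fun a => (f a).2 :=
  PT.comp (g := Prod.snd) (.of_expr (fun i => .tl (.var i)) 2 (fun _ => le_rfl)
    (fun s i a h => by rcases a with ⟨a, b⟩; simp [Expr.eval, h, enc_pair, Data.tl])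
    (PolyBdd.id.mono fun a => by rcases a with ⟨a, b⟩; simp only [sz_pair]; omega)) hf

-- A pair `(b, l)` and the list `b :: l` have the same representation, so the program only copies a
-- variable.
@[fun_prop]
theorem PT.cons {f : α → β} {g : α → List β} (hf : PT f) (hg : PT g) :
    PT fun a => f a :: g a :=
  PT.comp (g := fun x : β × List β => x.1 :: x.2) (.of_expr (fun i => .var i) 1 (fun _ => le_rfl)
    (fun _ _ _ h => h) PolyBdd.id) (hf.pair hg)

@[fun_prop]
theorem PT.tail {f : α → List β} (hf : PT f) : PT fun a => (f a).tail :=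
  PT.comp (g := List.tail) (.of_expr (fun i => .tl (.var i)) 2 (fun _ => le_rfl)
    (fun s i a h => by cases a <;> simp [Expr.eval, h, enc_cons, enc_nil, Data.tl])
    (PolyBdd.id.mono fun a => sz_le_of_sublist a.tail_sublist)) hf

@[fun_prop]
theorem PT.succ {f : α → ℕ} (hf : PT f) : PT fun a => f a + 1 :=
  PT.comp (g := fun n => n + 1) (.of_expr (fun i => .cons .nil (.var i)) 3 (fun _ => le_rfl)
    (fun s i a h => by simp [Expr.eval, h, enc_succ])
    ((PolyBdd.id.add (.const 2)).mono fun a => by rw [sz_succ])) hf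

@[fun_prop]
theorem PT.pred {f : α → ℕ} (hf : PT f) : PT fun a => f a - 1 :=
  PT.comp (g := fun n => n - 1) (.of_expr (fun i => .tl (.var i)) 2 (fun _ => le_rfl)
    (fun s i a h => by cases a <;> simp [Expr.eval, h, enc_succ, enc_zero, Data.tl])
    (PolyBdd.id.mono fun a => by simp only [sz_nat]; omega)) hf

@[fun_prop]
theorem PT.cond {c : α → Bool} {f g : α → β} (hc : PT c) (hf : PT f) (hg : PT g) :
    PT fun a => if c a then f a else g a := by
  obtain ⟨_, V, hV, cc⟩ := hc
  obtain ⟨h1, T, hT, cf⟩ := hf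
  obtain ⟨h2, U, hU, cg⟩ := hg
  refine ⟨(h1.add h2).mono fun a => ?_, _, ((hV.add hT).add hU).add (.const 2), cc.ite cf cg⟩
  dsimp only; split <;> omega

/-- The fold of a polynomial-time step over a list, if the step increases the size of the
accumulator by at most a polynomial in the size of the context. -/
theorem PT.foldl {l : γ → List α} {init : γ → β} {f : γ → β → α → β} (hl : PT l) (hi : PT init)
    (hf : PT fun x : γ × β × α => f x.1 x.2.1 x.2.2)
    (hg : ∃ P : γ → ℕ, PolyBdd P ∧ ∀ c b, ∀ a ∈ l c, sz (f c b a) ≤ sz b + P c) :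
    PT fun c => (l c).foldl (f c) (init c) := by
  obtain ⟨P, hP, hg⟩ := hg
  obtain ⟨h1, T, hT, cl⟩ := hl
  obtain ⟨h2, U, hU, ci⟩ := hi
  obtain ⟨h3, V, ⟨k, hV⟩, cf⟩ := hf
  have size : ∀ c, ∀ l₁ : List α, (∀ a ∈ l₁, a ∈ l c) →
      sz (l₁.foldl (f c) (init c)) ≤ sz (init c) + l₁.length * P c := by
    intro c l₁
    induction l₁ using List.reverseRecOn with
    | nil => simp
    | append_singleton l₁ a ih =>
      intro h
      have h1 := ih fun a ha => h a (by simp [ha])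
      have h2 := hg c (l₁.foldl (f c) (init c)) a (h a (by simp))
      simp only [List.foldl_append, List.foldl_cons, List.foldl_nil, List.length_append,
        List.length_cons, List.length_nil, zero_add, add_mul, one_mul]
      omega
  -- Every intermediate accumulator has polynomial size: there are at most `sz (l c)` steps, and
  -- each adds at most `P c`.
  have size' : ∀ c, ∀ l₁ l₂, l c = l₁ ++ l₂ →
      sz (l₁.foldl (f c) (init c)) ≤ sz (init c) + sz (l c) * P c := by
    intro c l₁ l₂ h
    refine (size c l₁ fun a ha => by simp [h, ha]).trans (Nat.add_le_add_left (Nat.mul_le_mul_right _ ?_) _)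
    have := length_le_sz (l c)
    rw [h, List.length_append] at this
    rw [h]; omega
  refine ⟨(h2.add (h1.mul hP)).mono fun c => size' c (l c) [] (by simp), _, ?_, cl.foldl ci cf
    (N := fun c => (sz c + (sz (init c) + sz (l c) * P c) + sz (l c) + 4) ^ k) ?_⟩
  · have hlen : PolyBdd fun c => (l c).length + 1 := h1.mono fun c => length_le_sz _
    exact (hT.add hU).add (((((PolyBdd.id.add (h2.add (h1.mul hP))).add h1).add (.const 4)).pow k
      |>.add (.const 14)).mul hlen)
  · intro c l₁ a l₂ h
    refine (hV _).trans (Nat.pow_le_pow_left ?_ k)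
    have h4 : sz (l₁.foldl (fun b a => f c b a) (init c)) ≤ _ := size' c l₁ (a :: l₂) h
    have h5 := sz_le_of_mem (show a ∈ l c by simp [h])
    simp only [sz_pair]
    omega

end

/-! ### Polynomial-time operations on truth values, lists and numbers -/

section

variable {α β γ δ : Type} [Enc α] [Enc β] [Enc γ] [Enc δ]

@[fun_prop]
theorem PT.and {f g : α → Bool} (hf : PT f) (hg : PT g) : PT fun a => f a && g a := by
  have : PT fun a => if f a then g a else false := by fun_prop
  convert this using 2 with a
  cases f a <;> simp

@[fun_prop]
theorem PT.or {f g : α → Bool} (hf : PT f) (hg : PT g) : PT fun a => f a || g a := by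
  have : PT fun a => if f a then true else g a := by fun_prop
  convert this using 2 with a
  cases f a <;> simp

@[fun_prop]
theorem PT.not {f : α → Bool} (hf : PT f) : PT fun a => !f a := by
  have : PT fun a => if f a then false else true := by fun_prop
  convert this using 2 with a
  cases f a <;> simp

@[fun_prop]
theorem PT.reverse {l : α → List β} (hl : PT l) : PT fun a => (l a).reverse := by
  have := PT.foldl (f := fun _ b a => a :: b) hl (PT.const []) (by fun_prop)
    ⟨fun c => sz (l c) + 1, hl.polyBdd.add (.const 1), fun c b a ha => by
      have := sz_le_of_mem ha; simp only [sz_cons]; omega⟩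
  convert this using 2 with a
  simp

@[fun_prop]
theorem PT.map {l : γ → List α} {f : γ → α → β} (hf : PT fun x : γ × α => f x.1 x.2)
    (hl : PT l) : PT fun c => (l c).map (f c) := by
  obtain ⟨k, hk⟩ := hf.polyBdd
  have := PT.foldl (f := fun c b a => f c a :: b) hl (PT.const [])
    (.cons (hf.comp (f := fun x : γ × List β × α => (x.1, x.2.2)) (by fun_prop)) (by fun_prop))
    ⟨fun c => (sz c + sz (l c) + 3) ^ k + 1,
      (((PolyBdd.id.add hl.polyBdd).add (.const 3)).pow k).add (.const 1), fun c b a ha => by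
      have h1 := sz_le_of_mem ha
      have h2 := hk (c, a)
      have h3 : (sz (c, a) + 2) ^ k ≤ (sz c + sz (l c) + 3) ^ k :=
        Nat.pow_le_pow_left (by rw [sz_pair]; omega) k
      simp only [sz_cons] at *; omega⟩
  convert this.reverse using 2 with a
  simp

@[fun_prop]
theorem PT.append {f g : α → List β} (hf : PT f) (hg : PT g) : PT fun a => f a ++ g a := by
  have := PT.foldl (f := fun _ b a => a :: b) hf.reverse hg (by fun_prop)
    ⟨fun c => sz (f c) + 1, hf.polyBdd.add (.const 1), fun c b a ha => by
      have := sz_le_of_mem (List.mem_reverse.1 ha); simp only [sz_cons]; omega⟩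
  convert this using 2 with a
  simp [List.foldl_reverse]

@[fun_prop]
theorem PT.flatten {f : α → List (List β)} (hf : PT f) : PT fun a => (f a).flatten := by
  have := PT.foldl (f := fun _ b a => b ++ a) hf (PT.const []) (by fun_prop)
    ⟨fun c => sz (f c), hf.polyBdd, fun c b a ha => by
      have := sz_le_of_mem ha; have := sz_append b a; dsimp only; omega⟩
  convert this using 2 with a
  have : ∀ (m : List (List β)) (b : List β), m.foldl (fun b x => b ++ x) b = b ++ m.flatten := by
    intro m
    induction m with
    | nil => simp
    | cons x m ih => intro b; simp [ih]
  simp [this]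

@[fun_prop]
theorem PT.flatMap {l : γ → List α} {f : γ → α → List β} (hf : PT fun x : γ × α => f x.1 x.2)
    (hl : PT l) : PT fun c => (l c).flatMap (f c) := by
  simp only [List.flatMap]
  fun_prop

@[fun_prop]
theorem PT.any {l : γ → List α} {f : γ → α → Bool} (hf : PT fun x : γ × α => f x.1 x.2)
    (hl : PT l) : PT fun c => (l c).any (f c) := by
  have := PT.foldl (f := fun c b a => b || f c a) hl (PT.const false)
    (.or (by fun_prop) (hf.comp (f := fun x : γ × Bool × α => (x.1, x.2.2)) (by fun_prop)))
    ⟨fun c => 3, .const 3, fun c b a ha => by have := sz_bool (b || f c a); dsimp only; omega⟩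
  convert this using 2 with a
  have : ∀ (m : List α) (b : Bool), m.foldl (fun b x => b || f a x) b = (b || m.any (f a)) := by
    intro m
    induction m with
    | nil => simp
    | cons x m ih => intro b; simp [ih, Bool.or_assoc]
  simp [this]

@[fun_prop]
theorem PT.all {l : γ → List α} {f : γ → α → Bool} (hf : PT fun x : γ × α => f x.1 x.2)
    (hl : PT l) : PT fun c => (l c).all (f c) := by
  have : PT fun c => !(l c).any fun a => !f c a := by fun_prop
  convert this using 2 with a
  simp [List.all_eq_not_any_not]

@[fun_prop]
theorem PT.filter {l : γ → List α} {f : γ → α → Bool} (hf : PT fun x : γ × α => f x.1 x.2)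
    (hl : PT l) : PT fun c => (l c).filter (f c) := by
  have : PT fun c => (l c).flatMap fun a => if f c a then [a] else [] := by fun_prop
  convert this using 2 with c
  induction l c with
  | nil => rfl
  | cons a m ih => rw [List.filter_cons, List.flatMap_cons, ih]; split <;> simp

-- Unary numbers are represented like lists of units, so no work is needed. This turns folds over
-- lists into loops with a counter.
@[fun_prop]
theorem PT.replicate {f : α → ℕ} (hf : PT f) : PT fun a => List.replicate (f a) () := by
  have e : ∀ n : ℕ, enc (List.replicate n ()) = enc n := fun n => by
    induction n with
    | zero => rfl
    | succ n ih => rw [List.replicate_succ, enc_cons, ih, enc_succ]; rfl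
  exact PT.comp (g := fun n : ℕ => List.replicate n ()) (.of_expr (fun i => .var i) 1
    (fun _ => le_rfl) (fun s i a h => by rw [e]; exact h)
    (PolyBdd.id.mono fun a => by simp [sz, e])) hf

@[fun_prop]
theorem PT.length {f : α → List β} (hf : PT f) : PT fun a => (f a).length := by
  have := PT.foldl (f := fun _ b a => b + 1) hf (PT.const 0) (by fun_prop)
    ⟨fun c => 2, .const 2, fun c b a ha => by rw [sz_succ]⟩
  convert this using 2 with a
  simp

/-- Iteration of a polynomial-time function, if the size increases by at most a polynomial in the
size of the context each time. -/
theorem PT.iterate {n : γ → ℕ} {init : γ → β} {f : γ → β → β} (hn : PT n) (hi : PT init)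
    (hf : PT fun x : γ × β => f x.1 x.2)
    (hg : ∃ P : γ → ℕ, PolyBdd P ∧ ∀ c b, sz (f c b) ≤ sz b + P c) :
    PT fun c => (f c)^[n c] (init c) := by
  obtain ⟨P, hP, hg⟩ := hg
  have := PT.foldl (f := fun c b (_ : Unit) => f c b) hn.replicate hi
    (hf.comp (f := fun x : γ × β × Unit => (x.1, x.2.1)) (by fun_prop))
    ⟨P, hP, fun c b _ _ => hg c b⟩
  convert this using 2 with c
  generalize init c = b
  generalize n c = m
  induction m generalizing b with
  | zero => rfl
  | succ m ih => rw [List.replicate_succ, List.foldl_cons, ← ih, Function.iterate_succ_apply]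

@[fun_prop]
theorem PT.drop {n : α → ℕ} {l : α → List β} (hn : PT n) (hl : PT l) :
    PT fun a => (l a).drop (n a) := by
  have := PT.iterate (f := fun _ b => b.tail) hn hl (by fun_prop)
    ⟨fun _ => 0, .const 0, fun c b => sz_le_of_sublist b.tail_sublist⟩
  convert this using 2 with c
  generalize l c = b
  generalize n c = m
  induction m generalizing b with
  | zero => rfl
  | succ m ih => rw [Function.iterate_succ_apply, ← ih, List.drop_tail]

-- The default value `[]` is represented by `nil`, which is also what `hd` returns on `nil`; the
-- same holds for `false` in `PT.getD_false`.
@[fun_prop]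
theorem PT.getD_nil {n : α → ℕ} {l : α → List (List β)} (hn : PT n) (hl : PT l) :
    PT fun a => (l a).getD (n a) [] := by
  have h : PT fun x : List (List β) => x.headD [] :=
    .of_expr (fun i => .hd (.var i)) 2 (fun _ => le_rfl)
      (fun s i a h => by cases a <;> simp [Expr.eval, h, enc_cons, enc_nil, Data.hd])
      (PolyBdd.id.mono fun a => by cases a <;> simp [sz_nil, sz_cons]; omega)
  convert h.comp (hn.drop hl) using 2 with a
  rw [List.headD_eq_head?_getD, List.head?_drop, List.getD_eq_getElem?_getD]

@[fun_prop]
theorem PT.getD_false {n : α → ℕ} {l : α → List Bool} (hn : PT n) (hl : PT l) :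
    PT fun a => (l a).getD (n a) false := by
  have h : PT fun x : List Bool => x.headD false :=
    .of_expr (fun i => .hd (.var i)) 2 (fun _ => le_rfl)
      (fun s i a h => by cases a <;> simp [Expr.eval, h, enc_cons, enc_nil, Data.hd, enc_false])
      ((PolyBdd.const 3).mono fun a => sz_bool _)
  convert h.comp (hn.drop hl) using 2 with a
  rw [List.headD_eq_head?_getD, List.head?_drop, List.getD_eq_getElem?_getD]

@[fun_prop]
theorem PT.add {f g : α → ℕ} (hf : PT f) (hg : PT g) : PT fun a => f a + g a := by
  have := PT.iterate (f := fun _ b => b + 1) hg hf (by fun_prop)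
    ⟨fun _ => 2, .const 2, fun c b => by rw [sz_succ]⟩
  simpa using this

@[fun_prop]
theorem PT.sub {f g : α → ℕ} (hf : PT f) (hg : PT g) : PT fun a => f a - g a := by
  have := PT.iterate (f := fun _ b => b - 1) hg hf (by fun_prop)
    ⟨fun _ => 0, .const 0, fun c b => by simp only [sz_nat]; omega⟩
  convert this using 2 with a
  generalize f a = b
  induction g a generalizing b with
  | zero => rfl
  | succ m ih => rw [Function.iterate_succ_apply, ← ih]; omega

@[fun_prop]
theorem PT.mul {f g : α → ℕ} (hf : PT f) (hg : PT g) : PT fun a => f a * g a := by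
  have := PT.iterate (f := fun c b => b + f c) hg (PT.const 0) (by fun_prop)
    ⟨fun c => sz (f c), hf.polyBdd, fun c b => by simp only [sz_nat]; omega⟩
  convert this using 2 with a
  induction g a with
  | zero => simp
  | succ m ih => rw [Function.iterate_succ_apply', ← ih, mul_add, mul_one]

@[fun_prop]
theorem PT.le {f g : α → ℕ} (hf : PT f) (hg : PT g) : PT fun a => decide (f a ≤ g a) := by
  have h : PT fun n : ℕ => decide (n = 0) := by
    have : PT fun n : ℕ => !((List.replicate n ()).any fun _ => true) := by fun_prop
    convert this using 2 with n
    cases n <;> simp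
  convert h.comp (hf.sub hg) using 2 with a
  simp [Nat.sub_eq_zero_iff_le]

@[fun_prop]
theorem PT.lt {f g : α → ℕ} (hf : PT f) (hg : PT g) : PT fun a => decide (f a < g a) := by
  simp only [Nat.lt_iff_add_one_le]; fun_prop

@[fun_prop]
theorem PT.eq {f g : α → ℕ} (hf : PT f) (hg : PT g) : PT fun a => decide (f a = g a) := by
  have : PT fun a => decide (f a ≤ g a) && decide (g a ≤ f a) := by fun_prop
  convert this using 2 with a
  rw [← Bool.decide_and, decide_eq_decide]
  omega

@[fun_prop]
theorem PT.range {f : α → ℕ} (hf : PT f) : PT fun a => List.range (f a) := by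
  -- The length of the accumulator serves as the counter. The test never fails in the actual run; it
  -- is there to bound the growth for arbitrary accumulators, as `PT.foldl` demands.
  have := (PT.foldl (β := List ℕ)
    (f := fun c b (_ : Unit) => if decide (b.length ≤ f c) then b.length :: b else b) hf.replicate
    (PT.const []) (by fun_prop) ⟨fun c => sz (f c) + 1, hf.polyBdd.add (.const 1), fun c b _ _ => by
      by_cases h : b.length ≤ f c
      · simp only [h, decide_true, if_true, sz_cons, sz_nat]; omega
      · simp [h]⟩).reverse
  convert this using 2 with c
  have : ∀ m ≤ f c, (List.replicate m ()).foldl (fun (b : List ℕ) (_ : Unit) =>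
      if decide (b.length ≤ f c) then b.length :: b else b) [] = (List.range m).reverse := by
    intro m
    induction m with
    | zero => simp
    | succ m ih =>
      intro hm
      rw [List.replicate_succ', List.foldl_append, ih (by omega)]
      simp [List.range_succ, show m ≤ f c by omega]
  rw [this _ le_rfl, List.reverse_reverse]

@[fun_prop]
theorem PT.take_one {f : α → List β} (hf : PT f) : PT fun a => (f a).take 1 := by
  have := PT.foldl (β := List β)
    (f := fun _ b a => if decide (b.length ≤ 0) then [a] else b) hf (PT.const []) (by fun_prop)
    ⟨fun c => sz (f c), hf.polyBdd, fun c b a ha => by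
      have := sz_le_of_mem ha
      have := one_le_sz b
      split <;> simp only [sz_cons, sz_nil] <;> omega⟩
  convert this using 2 with c
  have h : ∀ (m : List β) (x : β), m.foldl
      (fun (b : List β) a => if decide (b.length ≤ 0) then [a] else b) [x] = [x] := by
    intro m x
    induction m with
    | nil => rfl
    | cons a m ih => simpa using ih
  cases f c with
  | nil => rfl
  | cons x m => simpa using (h m x).symm

@[fun_prop]
theorem PT.zip {f : α → List β} {g : α → List γ} (hf : PT f) (hg : PT g) :
    PT fun a => (f a).zip (g a) := by
  -- The accumulator holds the reversed result and the unused part of the second list. An entry of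
  -- that list only moves from one part to the other, so the growth is bounded by the entry of the
  -- first list.
  have := (PT.foldl (β := List (β × γ) × List γ)
    (f := fun _ b a => ((b.2.take 1).map (fun r => (a, r)) ++ b.1, b.2.tail)) hf
    ((PT.const []).pair hg) (by fun_prop) ⟨fun c => sz (f c), hf.polyBdd, fun c b a ha => by
      have := sz_le_of_mem ha
      rcases b with ⟨b, _ | ⟨r, l⟩⟩ <;> simp [sz_pair, sz_cons]; omega⟩).fst.reverse
  convert this using 2 with c
  have : ∀ (m : List β) (l : List γ) (b : List (β × γ)), (m.foldl (fun b a =>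
      ((b.2.take 1).map (fun r => (a, r)) ++ b.1, b.2.tail)) (b, l)).1.reverse =
        b.reverse ++ m.zip l := by
    intro m
    induction m with
    | nil => simp
    | cons a m ih =>
      intro l b
      cases l with
      | nil => rw [List.foldl_cons, ih]; simp
      | cons r l => rw [List.foldl_cons, ih]; simp
  rw [this]; rfl

end

/-! ### The reduction as functions on lists -/

/-- Boolean matrices as lists of rows. -/
abbrev Mat : Type := List (List Bool)

/-- The entry of a matrix. -/
def entry (M : Mat) (u v : ℕ) : Bool := (M.getD u []).getD v false

/-- Membership in a list of numbers. -/
def mem (u : ℕ) (l : List ℕ) : Bool := l.any fun v => decide (v = u)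

/-- The nodes in `cur` and those joined to them by an edge of `T` that avoids `D`. -/
def grow (n : ℕ) (T : Mat) (D cur : List ℕ) : List ℕ :=
  (List.range n).filter fun u => mem u cur ||
    (!mem u D && cur.any fun w => !mem w D && (entry T u w || entry T w u))

/-- The connected component of `v` after the deletion of the edges that touch `D`. -/
def component (n : ℕ) (T : Mat) (D : List ℕ) (v : ℕ) : List ℕ := (grow n T D)^[n] [v]

/-- Adds the component of `v` to the current piece (unless `v` is in some piece already), and closes
the current piece once it has `s` nodes. -/
def piecesStep (s n : ℕ) (T : Mat) (D : List ℕ) (st : List ℕ × List (List ℕ)) (v : ℕ) :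
    List ℕ × List (List ℕ) :=
  if mem v st.1 || st.2.any (fun P => mem v P) then st
  else if decide (s ≤ (st.1 ++ component n T D v).length) then
    ([], (st.1 ++ component n T D v) :: st.2)
  else (st.1 ++ component n T D v, st.2)

/-- The nodes, grouped greedily into pieces that are unions of components. -/
def pieces (s n : ℕ) (T : Mat) (D : List ℕ) : List (List ℕ) :=
  let st := (List.range n).foldl (piecesStep s n T D) ([], [])
  st.1 :: st.2

/-- The pairs `(u, x)` in `A` form a partial map from `T` to `G` that respects the edges. -/
def valid (G T : Mat) (A : List (ℕ × ℕ)) : Bool :=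
  A.all fun p => A.all fun q => (!decide (p.1 = q.1) || decide (p.2 = q.2)) &&
    (!entry T p.1 q.1 || entry G p.2 q.2)

/-- The characteristic vector of the nodes in `im` together with the `i`-th of `k` further
elements. -/
def charVec (n k : ℕ) (im : List ℕ) (i : ℕ) : List Bool :=
  (List.range n).map (fun j => mem j im) ++ (List.range k).map fun j => decide (j = i)

/-- Input of Directed nTree. -/
abbrev Input : Type := ℕ × Mat × Mat

/-- The pairs of a node of a piece and its image. -/
def extend (P : List ℕ) (f : List ℕ) (g : List (ℕ × ℕ)) : List (ℕ × ℕ) := P.zip f ++ g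

/-- The sets for the piece `P` with number `i`. -/
def pieceSets (x : Input) (k : ℕ) (maps : List (List ℕ)) (g : List (ℕ × ℕ)) (P : List ℕ) (i : ℕ) :
    List (List Bool) :=
  maps.flatMap fun f =>
    if decide (P.length ≤ f.length) && valid x.2.1 x.2.2 (extend P f g) then
      [charVec x.1 k ((P.zip f).map fun p => p.2) i]
    else []

/-- The pieces that belong to a guess. -/
def guessPieces (s : ℕ) (x : Input) (g : List (ℕ × ℕ)) : List (List ℕ) :=
  pieces s x.1 x.2.2 (g.map fun p => p.1)

/-- The Set Cover instance for a guess. -/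
def coverInstance (s : ℕ) (x : Input) (maps : List (List ℕ)) (g : List (ℕ × ℕ)) :
    ℕ × List (List Bool) :=
  (x.1 + (guessPieces s x g).length,
    ((guessPieces s x g).zip (List.range (guessPieces s x g).length)).flatMap fun p =>
      pieceSets x (guessPieces s x g).length maps g p.1 p.2)

/-- The selected sets form an exact cover. -/
def exactCover (I : ℕ × List (List Bool)) (sel : List Bool) : Bool :=
  (List.range I.1).all fun j =>
    decide (((I.2.zip sel).filter fun p => p.2 && p.1.getD j false).length = 1)

/-- The guess is an embedding of the whole tree. -/
def isEmbedding (x : Input) (g : List (ℕ × ℕ)) : Bool :=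
  valid x.2.1 x.2.2 g && (List.range x.1).all fun u =>
    mem u (g.map fun p => p.1) && mem u (g.map fun p => p.2)

/-- The length of the binary representation of `n`. -/
def bitLen (n : ℕ) : ℕ :=
  ((List.range n).foldl (fun (st : ℕ × ℕ) _ =>
    if decide (st.1 ≤ n) then (st.1 + st.1, st.2 + 1) else st) (1, 0)).2

/-- The quotient `n / s`. -/
def quot (n s : ℕ) : ℕ := ((List.range n).filter fun i => decide ((i + 1) * s ≤ n)).length

/-- All pairs of numbers less than `n`. -/
def pairs (n : ℕ) : List (ℕ × ℕ) := (List.range n).flatMap fun u => (List.range n).map fun x => (u, x)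

/-- All lists of entries of `L` that extend a list in `acc` by one entry. -/
def prolong {α : Type} (L : List α) (acc : List (List α)) : List (List α) :=
  acc.flatMap fun t => L.map fun a => a :: t

/-! ### Polynomial-time computability of the reduction -/

section

variable {α β γ : Type} [Enc α] [Enc β] [Enc γ]

@[fun_prop]
theorem PT.entry {M : α → Mat} {u v : α → ℕ} (hM : PT M) (hu : PT u) (hv : PT v) :
    PT fun a => entry (M a) (u a) (v a) := by
  unfold LogSetCover.entry; fun_prop

@[fun_prop]
theorem PT.mem {u : α → ℕ} {l : α → List ℕ} (hu : PT u) (hl : PT l) :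
    PT fun a => mem (u a) (l a) := by
  unfold LogSetCover.mem; fun_prop

@[fun_prop]
theorem PT.grow {n : α → ℕ} {T : α → Mat} {D l : α → List ℕ} (hn : PT n) (hT : PT T) (hD : PT D)
    (hl : PT l) : PT fun a => grow (n a) (T a) (D a) (l a) := by
  unfold LogSetCover.grow; fun_prop

/-- The bound does not involve the size of `l`, so iterating `grow` does not accumulate size. -/
theorem sz_grow_le (n : ℕ) (T : Mat) (D l : List ℕ) : sz (grow n T D l) ≤ sz (List.range n) :=
  sz_le_of_sublist List.filter_sublist

@[fun_prop]
theorem PT.component {n : α → ℕ} {T : α → Mat} {D : α → List ℕ} {v : α → ℕ} (hn : PT n) (hT : PT T)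
    (hD : PT D) (hv : PT v) : PT fun a => component (n a) (T a) (D a) (v a) := by
  unfold LogSetCover.component
  refine PT.iterate hn (by fun_prop) (by fun_prop)
    ⟨fun a => sz (List.range (n a)), hn.range.polyBdd, fun c b => ?_⟩
  have := sz_grow_le (n c) (T c) (D c) b
  dsimp only; omega

@[fun_prop]
theorem PT.piecesStep {s n : α → ℕ} {T : α → Mat} {D : α → List ℕ} {v : α → ℕ}
    {st : α → List ℕ × List (List ℕ)} (hs : PT s) (hn : PT n) (hT : PT T)
    (hD : PT D) (hst : PT st) (hv : PT v) :
    PT fun a => piecesStep (s a) (n a) (T a) (D a) (st a) (v a) := by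
  unfold LogSetCover.piecesStep; fun_prop

theorem sz_component_le (n : ℕ) (T : Mat) (D : List ℕ) (v : ℕ) :
    sz (component n T D v) ≤ sz (List.range n) + sz [v] := by
  unfold component
  cases n with
  | zero => simp
  | succ n =>
    rw [Function.iterate_succ_apply']
    exact (sz_grow_le _ _ _ _).trans (by omega)

@[fun_prop]
theorem PT.pieces {s n : α → ℕ} {T : α → Mat} {D : α → List ℕ} (hs : PT s) (hn : PT n) (hT : PT T)
    (hD : PT D) : PT fun a => pieces (s a) (n a) (T a) (D a) := by
  have : PT fun a => (List.range (n a)).foldl (LogSetCover.piecesStep (s a) (n a) (T a) (D a))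
      ([], []) := by
    refine PT.foldl hn.range (PT.const _) (by fun_prop)
      ⟨fun a => 2 * sz (List.range (n a)) + 3, ((PolyBdd.const 2).mul hn.range.polyBdd).add (.const 3),
        fun c b v hv => ?_⟩
    have h1 := sz_component_le (n c) (T c) (D c) v
    have h2 := sz_append b.1 (LogSetCover.component (n c) (T c) (D c) v)
    have h3 := sz_le_of_mem hv
    obtain ⟨b1, b2⟩ := b
    simp only [sz_cons, sz_nil] at h1
    unfold LogSetCover.piecesStep
    split
    · omega
    · split <;> simp only [sz_pair, sz_cons, sz_nil] at * <;> omega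
  unfold LogSetCover.pieces
  fun_prop

@[fun_prop]
theorem PT.valid {G T : α → Mat} {A : α → List (ℕ × ℕ)} (hG : PT G) (hT : PT T) (hA : PT A) :
    PT fun a => valid (G a) (T a) (A a) := by
  unfold LogSetCover.valid; fun_prop

@[fun_prop]
theorem PT.charVec {n k i : α → ℕ} {im : α → List ℕ} (hn : PT n) (hk : PT k) (him : PT im)
    (hi : PT i) : PT fun a => charVec (n a) (k a) (im a) (i a) := by
  unfold LogSetCover.charVec; fun_prop

@[fun_prop]
theorem PT.extend {P f : α → List ℕ} {g : α → List (ℕ × ℕ)} (hP : PT P) (hf : PT f) (hg : PT g) :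
    PT fun a => extend (P a) (f a) (g a) := by
  unfold LogSetCover.extend; fun_prop

@[fun_prop]
theorem PT.pieceSets {x : α → Input} {k i : α → ℕ} {maps : α → List (List ℕ)}
    {g : α → List (ℕ × ℕ)} {P : α → List ℕ} (hx : PT x) (hk : PT k) (hm : PT maps) (hg : PT g)
    (hP : PT P) (hi : PT i) :
    PT fun a => pieceSets (x a) (k a) (maps a) (g a) (P a) (i a) := by
  unfold LogSetCover.pieceSets; fun_prop

@[fun_prop]
theorem PT.guessPieces {x : α → Input} {s : α → ℕ} {g : α → List (ℕ × ℕ)} (hs : PT s) (hx : PT x)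
    (hg : PT g) : PT fun a => guessPieces (s a) (x a) (g a) := by
  unfold LogSetCover.guessPieces; fun_prop

@[fun_prop]
theorem PT.coverInstance {x : α → Input} {s : α → ℕ} {maps : α → List (List ℕ)}
    {g : α → List (ℕ × ℕ)} (hs : PT s) (hx : PT x) (hm : PT maps) (hg : PT g) :
    PT fun a => coverInstance (s a) (x a) (maps a) (g a) := by
  unfold LogSetCover.coverInstance; fun_prop

@[fun_prop]
theorem PT.exactCover {I : α → ℕ × List (List Bool)} {sel : α → List Bool} (hI : PT I)
    (hs : PT sel) : PT fun a => exactCover (I a) (sel a) := by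
  unfold LogSetCover.exactCover; fun_prop

@[fun_prop]
theorem PT.isEmbedding {x : α → Input} {g : α → List (ℕ × ℕ)} (hx : PT x)
    (hg : PT g) : PT fun a => isEmbedding (x a) (g a) := by
  unfold LogSetCover.isEmbedding; fun_prop

@[fun_prop]
theorem PT.bitLen {n : α → ℕ} (hn : PT n) : PT fun a => bitLen (n a) := by
  have : PT fun a => (List.range (n a)).foldl (fun (st : ℕ × ℕ) _ =>
      if decide (st.1 ≤ n a) then (st.1 + st.1, st.2 + 1) else st) (1, 0) := by
    refine PT.foldl hn.range (PT.const _) (by fun_prop)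
      ⟨fun a => sz (n a) + 2, hn.polyBdd.add (.const 2), fun c b _ _ => ?_⟩
    obtain ⟨b1, b2⟩ := b
    by_cases h : b1 ≤ n c
    · simp only [h, decide_true, if_true, sz_pair, sz_nat]; omega
    · simp [h]
  unfold LogSetCover.bitLen
  fun_prop

@[fun_prop]
theorem PT.quot {n s : α → ℕ} (hn : PT n) (hs : PT s) : PT fun a => quot (n a) (s a) := by
  unfold LogSetCover.quot; fun_prop

@[fun_prop]
theorem PT.pairs {n : α → ℕ} (hn : PT n) : PT fun a => pairs (n a) := by
  unfold LogSetCover.pairs; fun_prop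

@[fun_prop]
theorem PT.prolong {L : α → List β} {acc : α → List (List β)} (hL : PT L) (ha : PT acc) :
    PT fun a => prolong (L a) (acc a) := by
  unfold LogSetCover.prolong; fun_prop

end

/-! ### Binary length, division, and enumeration of tuples -/

/-- The fold keeps a pair `(2 ^ l, l)` and doubles until `2 ^ l` exceeds `n`. It has `n` rounds,
which is enough because `n < 2 ^ n`. -/
theorem bitLen_spec (n : ℕ) : n < 2 ^ bitLen n ∧ (bitLen n = 0 ∨ 2 ^ (bitLen n - 1) ≤ n) := by
  have : ∀ m, ∃ l, (List.range m).foldl (fun (st : ℕ × ℕ) _ =>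
      if decide (st.1 ≤ n) then (st.1 + st.1, st.2 + 1) else st) (1, 0) = (2 ^ l, l) ∧
      (m ≤ l ∨ n < 2 ^ l) ∧ (l = 0 ∨ 2 ^ (l - 1) ≤ n) := by
    intro m
    induction m with
    | zero => exact ⟨0, by simp⟩
    | succ m ih =>
      obtain ⟨l, h1, h2, h3⟩ := ih
      rw [List.range_succ, List.foldl_append, h1]
      by_cases h : 2 ^ l ≤ n
      · refine ⟨l + 1, ?_, Or.inl (by omega), Or.inr (by simpa using h)⟩
        simp [h, pow_succ]; ring
      · exact ⟨l, by simp [h], Or.inr (by omega), h3⟩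
  obtain ⟨l, h1, h2, h3⟩ := this n
  have e : bitLen n = l := by unfold bitLen; rw [h1]
  rw [e]
  exact ⟨h2.elim (fun h => h.trans_lt Nat.lt_two_pow_self) id, h3⟩

theorem quot_eq {n s : ℕ} (hs : 0 < s) : quot n s = n / s := by
  have : ∀ m, ((List.range m).filter fun i => decide ((i + 1) * s ≤ n)).length = min m (n / s) := by
    intro m
    induction m with
    | zero => simp
    | succ m ih =>
      rw [List.range_succ, List.filter_append, List.length_append, ih]
      have := Nat.le_div_iff_mul_le hs (x := m + 1) (y := n)
      by_cases h : (m + 1) * s ≤ n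
      · simp [h]; omega
      · simp [h]; omega
  rw [quot, this, min_eq_right (Nat.div_le_self n s)]

/-- All lists of length `k` with entries in `L`. -/
def tuples {α : Type} (L : List α) (k : ℕ) : List (List α) := (prolong L)^[k] [[]]

theorem tuples_succ {α : Type} (L : List α) (k : ℕ) : tuples L (k + 1) = prolong L (tuples L k) := by
  rw [tuples, Function.iterate_succ_apply']; rfl

theorem mem_tuples {α : Type} {L : List α} {k : ℕ} {l : List α} :
    l ∈ tuples L k ↔ l.length = k ∧ ∀ a ∈ l, a ∈ L := by
  induction k generalizing l with
  | zero =>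
    simp only [tuples, Function.iterate_zero, id, List.mem_singleton, List.length_eq_zero_iff]
    constructor
    · rintro rfl; simp
    · exact fun h => h.1
  | succ k ih =>
    rw [tuples_succ]
    simp only [prolong, List.mem_flatMap, List.mem_map, ih]
    constructor
    · rintro ⟨t, ⟨h1, h2⟩, a, ha, rfl⟩
      simpa [h1, ha] using h2
    · rintro ⟨h1, h2⟩
      cases l with
      | nil => simp at h1
      | cons a l => exact ⟨l, ⟨by simpa using h1, fun b hb => h2 b (by simp [hb])⟩, a,
          h2 a (by simp), rfl⟩

theorem length_tuples {α : Type} (L : List α) (k : ℕ) : (tuples L k).length = L.length ^ k := by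
  induction k with
  | zero => rfl
  | succ k ih =>
    rw [tuples_succ, prolong, List.length_flatMap]
    simp [ih, pow_succ]

section

variable {α β γ : Type} [Enc α] [Enc β] [Enc γ]

theorem sz_tuples_le (L : List α) (k : ℕ) :
    sz (tuples L k) ≤ L.length ^ k * (k * (sz L + 1) + 2) + 1 := by
  rw [← length_tuples]
  refine sz_le_of_forall fun t ht => ?_
  obtain ⟨h1, h2⟩ := mem_tuples.1 ht
  subst h1
  exact sz_le_of_forall fun a ha => by have := sz_le_of_mem (h2 a ha); omega

/-- An upper bound on the size of the list of all `k`-tuples. -/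
def tuplesBound (L : List α) (k : ℕ) : ℕ := (max L.length 1) ^ k * (k * (sz L + 1) + 2) + 1

/-- Taking the maximum with `1` makes the bound monotone in the exponent even for the empty list, so
that one bound covers all intermediate stages of the enumeration. -/
theorem sz_tuples_le_of_le (L : List α) {j k : ℕ} (h : j ≤ k) :
    sz (tuples L j) ≤ tuplesBound L k := by
  refine (sz_tuples_le L j).trans (Nat.add_le_add_right (Nat.mul_le_mul ?_ ?_) 1)
  · exact (Nat.pow_le_pow_left (le_max_left _ 1) j).trans
      (Nat.pow_le_pow_right (Nat.lt_of_lt_of_le one_pos (le_max_right _ _)) h)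
  · exact Nat.add_le_add_right (Nat.mul_le_mul_right _ h) 2

theorem foldl_replicate_unit {ι : Type} (f : ι → ι) (k : ℕ) (b : ι) :
    (List.replicate k ()).foldl (fun b _ => f b) b = f^[k] b := by
  induction k generalizing b with
  | zero => rfl
  | succ m ih => rw [List.replicate_succ, List.foldl_cons, ih, Function.iterate_succ_apply]

/-- The output is too long for `PT`, so the time is bounded polynomially in a bound on the output
instead; the accumulators are the lists of shorter tuples. The exponent does not depend on the list
or on the length of the tuples. For tuples of pairs it later enters the size of the pieces, and
through it the constant `C`. -/
theorem exists_computes_tuples : ∃ κ, Computes (fun c : List α × ℕ => tuples c.1 c.2)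
    fun c => (sz c + tuplesBound c.1 c.2 + 2) ^ κ := by
  obtain ⟨-, T, ⟨k1, hT⟩, hl⟩ := show PT fun c : List α × ℕ => List.replicate c.2 () by fun_prop
  obtain ⟨-, U, ⟨k2, hU⟩, hi⟩ := show PT fun c : List α × ℕ => [([] : List α)] by fun_prop
  obtain ⟨-, V, ⟨k3, hV⟩, hf⟩ := show PT fun x : (List α × ℕ) × List (List α) × Unit =>
    prolong x.1.1 x.2.1 by fun_prop
  have := hl.foldl hi hf (N := fun c => (sz c + tuplesBound c.1 c.2 + 5) ^ k3) (by
    intro c l₁ a l₂ h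
    refine (hV _).trans (Nat.pow_le_pow_left ?_ _)
    have e : l₁ = List.replicate l₁.length () := List.eq_replicate_of_mem (by simp)
    have hle : l₁.length ≤ c.2 := by
      have := congrArg List.length h
      simp at this; omega
    have e2 : l₁.foldl (fun b _ => prolong c.1 b) [[]] = tuples c.1 l₁.length := by
      conv_lhs => rw [e]
      exact foldl_replicate_unit _ _ _
    have h2 : sz (l₁.foldl (fun b _ => prolong c.1 b) [[]]) ≤ _ :=
      e2 ▸ sz_tuples_le_of_le c.1 hle
    have h3 : sz a = 1 := rfl
    simp only [sz_pair] at *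
    omega)
  refine ⟨k1 + k2 + (3 * k3 + 4) + 4, Computes.mono
    (T := fun c => T c + U c + ((sz c + tuplesBound c.1 c.2 + 5) ^ k3 + 14) * (c.2 + 1)) ?_ ?_⟩
  · convert this using 2 with c
    · exact (foldl_replicate_unit _ _ _).symm
    · simp
  · intro c
    set X := sz c + tuplesBound c.1 c.2 + 2 with hX
    have h1 := (hT c).trans (Nat.pow_le_pow_left (show sz c + 2 ≤ X by omega) k1)
    have h2 := (hU c).trans (Nat.pow_le_pow_left (show sz c + 2 ≤ X by omega) k2)
    have hX2 : 2 ≤ X := by omega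
    have h3 : (sz c + tuplesBound c.1 c.2 + 5) ^ k3 ≤ X ^ (3 * k3) := by
      rw [pow_mul]
      refine Nat.pow_le_pow_left ?_ _
      nlinarith [hX2, mul_self_nonneg X, Nat.mul_le_mul hX2 hX2, Nat.mul_le_mul (Nat.mul_le_mul hX2 hX2) (le_refl X)]
    have h4 : c.2 + 1 ≤ X := by
      have : sz c = sz c.1 + sz c.2 + 1 := rfl
      have := sz_nat c.2
      omega
    have p1 : X ^ k1 ≤ X ^ (k1 + k2 + (3 * k3 + 4)) := Nat.pow_le_pow_right (by omega) (by omega)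
    have p2 : X ^ k2 ≤ X ^ (k1 + k2 + (3 * k3 + 4)) := Nat.pow_le_pow_right (by omega) (by omega)
    have p3 : X ^ (3 * k3) ≤ X ^ (3 * k3 + 3) := Nat.pow_le_pow_right (by omega) (by omega)
    have p5 : 14 ≤ 7 * X := by omega
    have p6 : (X ^ (3 * k3) + 14) * (c.2 + 1) ≤ X ^ (3 * k3) * X ^ 4 * X := by
      refine Nat.mul_le_mul ?_ h4
      have : 1 ≤ X ^ (3 * k3) := Nat.one_le_pow _ _ (by omega)
      have : 16 ≤ X ^ 4 := Nat.pow_le_pow_left hX2 4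
      nlinarith
    have p7 : X ^ (3 * k3) * X ^ 4 * X ≤ X ^ (k1 + k2 + (3 * k3 + 4)) * X := by
      rw [← pow_add]
      exact Nat.mul_le_mul_right _ (Nat.pow_le_pow_right (by omega) (by omega))
    have p8 : ((sz c + tuplesBound c.1 c.2 + 5) ^ k3 + 14) * (c.2 + 1) ≤
      (X ^ (3 * k3) + 14) * (c.2 + 1) := Nat.mul_le_mul_right _ (by omega)
    have p9 : X ^ (k1 + k2 + (3 * k3 + 4) + 4) = X ^ (k1 + k2 + (3 * k3 + 4)) * X ^ 4 :=
      pow_add _ _ _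
    have p10 : X + 2 ≤ X ^ 4 := by
      have : X ^ 4 = X * X * X * X := by ring
      nlinarith [Nat.mul_le_mul hX2 hX2, Nat.mul_le_mul (Nat.mul_le_mul hX2 hX2) (le_refl (X*X))]
    have p11 := Nat.mul_le_mul_left (X ^ (k1 + k2 + (3 * k3 + 4))) p10
    rw [p9]
    rw [mul_add] at p11
    omega

/-! ### Powers of two, and reading off bits -/

/-- A unary power of two, computed in nearly linear time. -/
theorem exists_computes_two_pow : ∃ κ, Computes (fun n : ℕ => 2 ^ n)
    fun n => (n + 2) ^ κ * 2 ^ n := by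
  obtain ⟨-, T, ⟨k1, hT⟩, hl⟩ := show PT fun n : ℕ => List.replicate n () by fun_prop
  obtain ⟨-, U, ⟨k2, hU⟩, hi⟩ := show PT fun n : ℕ => 1 by fun_prop
  -- Doubling has to take linear time: with a merely polynomial bound, `2 ^ n` would turn into a
  -- power of it.
  have hdouble : Computes (fun m : ℕ => m + m) fun m => 30 * (m + 1) := by
    have h1 : Computes (fun m : ℕ => List.replicate m ()) fun _ => 2 :=
      .of_expr .var 1 (fun _ => le_rfl) fun s i a h => by
        rw [Expr.eval, h]
        clear h
        induction a with
        | zero => rfl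
        | succ n ih => rw [List.replicate_succ, enc_cons, ← ih, enc_succ]; rfl
    have h2 : Computes (fun m : ℕ => m) fun _ => 2 := .of_expr .var 1 (fun _ => le_rfl)
      fun s i a h => h
    have h3 : Computes (fun x : ℕ × ℕ × Unit => x.2.1 + 1) fun _ => 6 :=
      .of_expr (fun i => .cons .nil (.hd (.tl (.var i)))) 5 (fun _ => le_rfl) fun s i a h => by
        obtain ⟨a, b, c⟩ := a
        simp [Expr.eval, h, enc_pair, Data.hd, Data.tl, enc_succ]
    have := h1.foldl h2 h3 (N := fun _ => 6) (fun _ _ _ _ _ => le_rfl)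
    refine Computes.mono (T := fun m => 2 + 2 + (6 + 14) * (m + 1)) ?_ (fun m => by omega)
    convert this using 2 with m
    · exact ((foldl_replicate_unit (fun b => b + 1) m m).trans (by simp)).symm
    · simp
  have hf : Computes (fun x : ℕ × ℕ × Unit => x.2.1 + x.2.1) fun x => 4 + 30 * (x.2.1 + 1) :=
    hdouble.comp (f := fun x : ℕ × ℕ × Unit => x.2.1) (T := fun _ => 4)
      (.of_expr (fun i => .hd (.tl (.var i))) 3 (fun _ => le_rfl) fun s i a h => by
        obtain ⟨a, b, c⟩ := a
        simp [Expr.eval, h, enc_pair, Data.hd, Data.tl])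
  have e2 : ∀ k, (fun b : ℕ => b + b)^[k] 1 = 2 ^ k := fun k => by
    induction k with
    | zero => rfl
    | succ k ih => rw [Function.iterate_succ_apply', ih, pow_succ]; ring
  have := hl.foldl hi hf (N := fun n => 64 * 2 ^ n) (by
    intro n l₁ a l₂ h
    have e : l₁ = List.replicate l₁.length () := List.eq_replicate_of_mem (by simp)
    have hle : l₁.length ≤ n := by
      have := congrArg List.length h
      simp at this; omega
    have e3 : l₁.foldl (fun b _ => b + b) 1 = 2 ^ l₁.length := by
      conv_lhs => rw [e]
      exact (foldl_replicate_unit (fun b : ℕ => b + b) _ _).trans (e2 _)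
    have : 2 ^ l₁.length ≤ 2 ^ n := Nat.pow_le_pow_right (by omega) hle
    have := Nat.one_le_two_pow (n := n)
    simp only [e3]
    omega)
  refine ⟨2 * (k1 + k2) + 12, Computes.mono
    (T := fun n => T n + U n + (64 * 2 ^ n + 14) * (n + 1)) ?_ ?_⟩
  · convert this using 2 with n
    · exact ((foldl_replicate_unit (fun b : ℕ => b + b) _ _).trans (e2 _)).symm
    · simp
  · intro n
    have h1 := hT n
    have h2 := hU n
    rw [sz_nat] at h1 h2
    have b1 : 2 * n + 1 + 2 ≤ (n + 2) ^ 2 := by nlinarith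
    have h1' := h1.trans (Nat.pow_le_pow_left b1 k1)
    have h2' := h2.trans (Nat.pow_le_pow_left b1 k2)
    rw [← pow_mul] at h1' h2'
    have q1 : (n + 2) ^ (2 * k1) ≤ (n + 2) ^ (2 * (k1 + k2)) :=
      Nat.pow_le_pow_right (by omega) (by omega)
    have q2 : (n + 2) ^ (2 * k2) ≤ (n + 2) ^ (2 * (k1 + k2)) :=
      Nat.pow_le_pow_right (by omega) (by omega)
    set Y := (n + 2) ^ (2 * (k1 + k2))
    have hY : 1 ≤ Y := Nat.one_le_pow _ _ (by omega)
    have hP := Nat.one_le_two_pow (n := n)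
    set P := 2 ^ n
    have q3 : (64 * P + 14) * (n + 1) ≤ 78 * P * (n + 2) :=
      Nat.mul_le_mul (by omega) (by omega)
    have q4 : Y ≤ Y * P := Nat.le_mul_of_pos_right _ hP
    have q5 : 78 * P * (n + 2) ≤ 78 * (n + 2) * (Y * P) := by
      rw [mul_right_comm]; exact Nat.mul_le_mul_left _ (Nat.le_mul_of_pos_left _ hY)
    have q6 : (n + 2) ^ 12 = (n + 2) * (n + 2) ^ 11 := by ring
    have q7 : 2 ^ 11 ≤ (n + 2) ^ 11 := Nat.pow_le_pow_left (by omega) 11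
    have q8 : 2 + 78 * (n + 2) ≤ (n + 2) ^ 12 := by rw [q6]; nlinarith
    rw [pow_add]
    calc _ ≤ (2 + 78 * (n + 2)) * (Y * P) := by rw [add_mul 2]; omega
      _ ≤ (n + 2) ^ 12 * (Y * P) := Nat.mul_le_mul_right _ q8
      _ = _ := by ring

/-- Whether a tree is different from `nil`. -/
def toBool : Data → Bool
  | .nil => false
  | .cons _ _ => true

/-- The first entries of a tree, read as bits, as many as there are entries in `S`. -/
def readBits {ι : Type} (S : List ι) (y : Data) : List Bool :=
  (S.foldl (fun (b : Data × List Bool) _ => (b.1.tl, toBool b.1.hd :: b.2)) (y, [])).2.reverse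

theorem readBits_ofBits {ι : Type} (S : List ι) (l : List Bool) (h : S.length = l.length) :
    readBits S (Data.ofBits l) = l := by
  have : ∀ (S : List ι) (l b : List Bool), S.length = l.length →
      (S.foldl (fun (b : Data × List Bool) _ => (b.1.tl, toBool b.1.hd :: b.2))
        (Data.ofBits l, b)).2.reverse = b.reverse ++ l := by
    intro S
    induction S with
    | nil => intro l b h; cases l <;> simp at *
    | cons a S ih =>
      intro l b h
      cases l with
      | nil => simp at h
      | cons x l =>
        rw [List.foldl_cons]
        have e1 : (Data.ofBits (x :: l)).tl = Data.ofBits l := rfl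
        have e2 : toBool (Data.ofBits (x :: l)).hd = x := by cases x <;> rfl
        simp only [e1, e2]
        rw [ih l (x :: b) (by simpa using h)]
        simp
  exact (this S l [] h).trans (by simp)

theorem length_readBits {ι : Type} (S : List ι) (y : Data) : (readBits S y).length = S.length := by
  have : ∀ (S : List ι) (b : Data × List Bool), (S.foldl (fun (b : Data × List Bool) _ =>
      (b.1.tl, toBool b.1.hd :: b.2)) b).2.length = b.2.length + S.length := by
    intro S
    induction S with
    | nil => simp
    | cons a S ih => intro b; rw [List.foldl_cons, ih]; simp; omega
  rw [readBits, List.length_reverse, this]; simp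

/-- The tree `c.2` will be whatever a clocked program leaves behind, possibly malformed and of
exponential size. It is accessed only by `hd`, `tl` and tests for `nil`, so its size does not enter
the time bound. -/
theorem exists_computes_readBits : ∃ κ, Computes (fun c : List α × Data => readBits c.1 c.2)
    fun c => (sz c.1 + 2) ^ κ := by
  have hb : Computes toBool fun _ => 6 := by
    intro i o b hi ho
    refine ⟨.ite (.var i) (.assign o (.cons .nil .nil)) (.assign o .nil), ⟨trivial, trivial⟩,
      fun s a hs => ?_⟩
    cases a with
    | nil =>
      refine ⟨_, _, .ite_false hs (.assign _ _ _), by simp [Expr.cost], ?_, fun v hv hvo => ?_⟩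
      · simp [Expr.eval, toBool, enc_false]
      · simp [hvo]
    | cons a b =>
      refine ⟨_, _, .ite_true (by simp [Expr.eval, hs, enc]) (.assign _ _ _), by simp [Expr.cost],
        ?_, fun v hv hvo => ?_⟩
      · simp [Expr.eval, toBool, enc_true]
      · simp [hvo]
  have hl : Computes (fun c : List α × Data => c.1) fun _ => 3 :=
    .of_expr (fun i => .hd (.var i)) 2 (fun _ => le_rfl) fun s i a h => by
      obtain ⟨a, b⟩ := a
      simp [Expr.eval, h, enc_pair, Data.hd]
  have hi : Computes (fun c : List α × Data => (c.2, ([] : List Bool))) fun _ => 5 :=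
    .of_expr (fun i => .cons (.tl (.var i)) .nil) 4 (fun _ => le_rfl) fun s i a h => by
      obtain ⟨a, b⟩ := a
      simp [Expr.eval, h, enc_pair, Data.tl, enc_nil]
  have f1 : Computes (fun x : (List α × Data) × (Data × List Bool) × α => x.2.1.1.tl) fun _ => 6 :=
    .of_expr (fun i => .tl (.hd (.hd (.tl (.var i))))) 5 (fun _ => le_rfl) fun s i a h => by
      obtain ⟨⟨a, b⟩, ⟨c, d⟩, e⟩ := a
      simp [Expr.eval, h, enc_pair, Data.tl, Data.hd]; rfl
  have f2 : Computes (fun x : (List α × Data) × (Data × List Bool) × α => x.2.1.1.hd) fun _ => 6 :=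
    .of_expr (fun i => .hd (.hd (.hd (.tl (.var i))))) 5 (fun _ => le_rfl) fun s i a h => by
      obtain ⟨⟨a, b⟩, ⟨c, d⟩, e⟩ := a
      simp [Expr.eval, h, enc_pair, Data.tl, Data.hd]; rfl
  have f3 : Computes (fun x : (List α × Data) × (Data × List Bool) × α => x.2.1.2) fun _ => 5 :=
    .of_expr (fun i => .tl (.hd (.tl (.var i)))) 4 (fun _ => le_rfl) fun s i a h => by
      obtain ⟨⟨a, b⟩, ⟨c, d⟩, e⟩ := a
      simp [Expr.eval, h, enc_pair, Data.tl, Data.hd]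
  have f4 : Computes (fun x : Bool × List Bool => x.1 :: x.2) fun _ => 2 :=
    .of_expr (fun i => .var i) 1 (fun _ => le_rfl) fun _ _ _ h => h
  have hfold := hl.foldl hi (f1.pair (f4.comp ((hb.comp f2).pair f3))) (N := fun _ => 33)
    (fun _ _ _ _ _ => by norm_num)
  have f5 : Computes (fun x : Data × List Bool => x.2) fun _ => 3 :=
    .of_expr (fun i => .tl (.var i)) 2 (fun _ => le_rfl) fun s i a h => by
      obtain ⟨a, b⟩ := a
      simp [Expr.eval, h, enc_pair, Data.tl]
  obtain ⟨-, R, ⟨k, hR⟩, hrev⟩ := show PT fun l : List Bool => l.reverse by fun_prop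
  refine ⟨3 * k + 8, (hrev.comp (f5.comp hfold)).mono fun c => ?_⟩
  have h1 := hR (c.1.foldl (fun (b : Data × List Bool) _ => (b.1.tl, toBool b.1.hd :: b.2))
    (c.2, [])).2
  have h2 : sz (c.1.foldl (fun (b : Data × List Bool) _ => (b.1.tl, toBool b.1.hd :: b.2))
      (c.2, [])).2 ≤ 4 * c.1.length + 1 := by
    have := sz_le_of_forall (l := (c.1.foldl (fun (b : Data × List Bool) _ =>
      (b.1.tl, toBool b.1.hd :: b.2)) (c.2, [])).2) (B := 3) fun b _ => sz_bool b
    have h3 := length_readBits c.1 c.2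
    rw [readBits, List.length_reverse] at h3
    rw [h3] at this
    omega
  have h3 := length_le_sz c.1
  set X := sz c.1 + 2 with hX
  have hX3 : 3 ≤ X := by omega
  have h4 := h1.trans (Nat.pow_le_pow_left
    (show _ ≤ X ^ 3 by
      have : X ^ 3 = X * X * X := by ring
      nlinarith [Nat.mul_le_mul hX3 hX3]) k)
  rw [← pow_mul] at h4
  have h5 : 1 ≤ X ^ (3 * k) := Nat.one_le_pow _ _ (by omega)
  have h6 : X ^ 8 = X ^ 7 * X := by ring
  have h7 : 3 ^ 7 ≤ X ^ 7 := Nat.pow_le_pow_left hX3 7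
  have h8 : 60 * X + 1 ≤ X ^ 8 := by rw [h6]; nlinarith
  have h9 := Nat.mul_le_mul_left (X ^ (3 * k)) h8
  rw [pow_add]
  have h10 : 60 * X ≤ X ^ (3 * k) * (60 * X) := Nat.le_mul_of_pos_left _ h5
  rw [mul_add] at h9
  have h11 : (33 + 14) * (c.1.length + 1) + 3 + 5 + 3 ≤ 60 * X := by omega
  dsimp only
  omega

end

/-! ### Runs with coin tosses -/

/-- Whatever the coins show, `p` halts with a state and a number of steps that satisfy `R`. -/
def Halts (p : Prog) (s : State) (R : State → ℕ → Prop) : Prop :=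
  ∀ ω : ℕ → Bool, ∃ (k : ℕ) (s' : State) (t : ℕ),
    Exec p s ((List.range k).map ω) s' t ∧ R s' t

theorem map_range_add (ω : ℕ → Bool) (k l : ℕ) : (List.range (k + l)).map ω =
    (List.range k).map ω ++ (List.range l).map fun i => ω (k + i) := by
  rw [List.range_add, List.map_append, List.map_map]; rfl

theorem Halts.of_exec {p : Prog} {s s' : State} {t : ℕ} {R : State → ℕ → Prop}
    (h : Exec p s [] s' t) (hR : R s' t) : Halts p s R := fun _ => ⟨0, s', t, h, hR⟩

theorem Halts.mono {p : Prog} {s : State} {R R' : State → ℕ → Prop} (h : Halts p s R)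
    (hR : ∀ s' t, R s' t → R' s' t) : Halts p s R' := fun ω => by
  obtain ⟨k, s', t, h1, h2⟩ := h ω
  exact ⟨k, s', t, h1, hR _ _ h2⟩

theorem Halts.seq {p q : Prog} {s : State} {R R' : State → ℕ → Prop} (hp : Halts p s R)
    (hq : ∀ s' t, R s' t → Halts q s' fun s'' t' => R' s'' (t + t')) : Halts (.seq p q) s R' := by
  intro ω
  obtain ⟨k, s', t, h1, h2⟩ := hp ω
  obtain ⟨l, s'', t', h3, h4⟩ := hq s' t h2 fun i => ω (k + i)
  refine ⟨k + l, s'', t + t', ?_, h4⟩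
  rw [map_range_add]
  exact h1.seq h3

theorem Halts.loop {e : Expr} {p : Prog} {s : State} {R R' : State → ℕ → Prop}
    (he : e.eval s ≠ Data.nil) (hp : Halts p s R)
    (hq : ∀ s' t, R s' t → Halts (.loop e p) s' fun s'' t' => R' s'' (e.cost + 1 + t + t')) :
    Halts (.loop e p) s R' := by
  intro ω
  obtain ⟨k, s', t, h1, h2⟩ := hp ω
  obtain ⟨l, s'', t', h3, h4⟩ := hq s' t h2 fun i => ω (k + i)
  refine ⟨k + l, s'', _, ?_, h4⟩
  rw [map_range_add]
  exact .loop_true he h1 h3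

theorem Halts.ite {e : Expr} {p q : Prog} {s : State} {R : State → ℕ → Prop}
    (hp : e.eval s ≠ Data.nil → Halts p s fun s' t => R s' (e.cost + 1 + t))
    (hq : e.eval s = Data.nil → Halts q s fun s' t => R s' (e.cost + 1 + t)) :
    Halts (.ite e p q) s R := by
  intro ω
  by_cases he : e.eval s = Data.nil
  · obtain ⟨k, s', t, h1, h2⟩ := hq he ω
    exact ⟨k, s', _, .ite_false he h1, h2⟩
  · obtain ⟨k, s', t, h1, h2⟩ := hp he ω
    exact ⟨k, s', _, .ite_true he h1, h2⟩

/-- The total probability of a set of coin sequences. -/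
noncomputable def weight (S : Set (List Bool)) : ENNReal := ∑' c : S, (2 : ENNReal)⁻¹ ^ c.1.length

theorem weight_mono {S S' : Set (List Bool)} (h : S ⊆ S') : weight S ≤ weight S' :=
  ENNReal.tsum_mono_subtype (fun c : List Bool => (2 : ENNReal)⁻¹ ^ c.length) h

/-- By prefix-freeness of `A`, the concatenation `c ++ d` determines `c`, and hence `d`. So
concatenation embeds the pairs into `C`, and the weight of `c ++ d` is the product of the weights.
-/
theorem weight_mul_le {A C : Set (List Bool)} {B : List Bool → Set (List Bool)} {β : ENNReal}
    (hA : ∀ c ∈ A, ∀ c' ∈ A, ∀ d d', c ++ d = c' ++ d' → c = c')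
    (hC : ∀ c ∈ A, ∀ d ∈ B c, c ++ d ∈ C) (hB : ∀ c ∈ A, β ≤ weight (B c)) :
    weight A * β ≤ weight C := by
  let φ : (Σ c : A, B c) → C := fun x => ⟨x.1.1 ++ x.2.1, hC _ x.1.2 _ x.2.2⟩
  have hφ : Function.Injective φ := by
    rintro ⟨⟨c, hc⟩, ⟨d, hd⟩⟩ ⟨⟨c', hc'⟩, ⟨d', hd'⟩⟩ h
    have h' : c ++ d = c' ++ d' := congrArg Subtype.val h
    obtain rfl := hA c hc c' hc' d d' h'
    obtain rfl := List.append_cancel_left h'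
    rfl
  calc weight A * β = ∑' c : A, (2 : ENNReal)⁻¹ ^ c.1.length * β := by
        rw [weight, ENNReal.tsum_mul_right]
    _ ≤ ∑' c : A, ∑' d : B c, (2 : ENNReal)⁻¹ ^ (c.1 ++ d.1).length := by
        refine ENNReal.tsum_le_tsum fun c => (mul_le_mul_right (hB c.1 c.2) _).trans ?_
        rw [weight, ← ENNReal.tsum_mul_left]
        exact ENNReal.tsum_le_tsum fun d => by rw [List.length_append, pow_add]
    _ = ∑' x : Σ c : A, B c, (2 : ENNReal)⁻¹ ^ (φ x).1.length :=
        (ENNReal.tsum_sigma' fun x : Σ c : A, B c => (2 : ENNReal)⁻¹ ^ (φ x).1.length).symm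
    _ ≤ weight C := ENNReal.tsum_comp_le_tsum_of_injective hφ
        (fun c : C => (2 : ENNReal)⁻¹ ^ c.1.length)

/-- Induction on `T` by conditioning on the first coin: unless the empty string lies in `S`, the
continuations after either value of the coin satisfy the hypothesis for `T - 1`, and both values
have weight `1/2`. -/
theorem one_le_weight {T : ℕ} {S : Set (List Bool)}
    (h : ∀ ω : ℕ → Bool, ∃ k ≤ T, (List.range k).map ω ∈ S) : 1 ≤ weight S := by
  induction T generalizing S with
  | zero =>
    obtain ⟨k, hk, hS⟩ := h fun _ => true
    obtain rfl : k = 0 := by omega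
    refine le_trans ?_ (ENNReal.le_tsum (⟨[], by simpa using hS⟩ : S))
    simp
  | succ T ih =>
    by_cases h0 : [] ∈ S
    · refine le_trans ?_ (ENNReal.le_tsum (⟨[], h0⟩ : S))
      simp
    · have hA : (1 : ENNReal) ≤ weight {[true], [false]} := by
        rw [weight]
        have := ENNReal.sum_le_tsum (f := fun c : ({[true], [false]} : Set (List Bool)) =>
          (2 : ENNReal)⁻¹ ^ c.1.length) {⟨[true], by simp⟩, ⟨[false], by simp⟩}
        refine le_trans ?_ this
        rw [Finset.sum_pair (by simp)]
        simp [ENNReal.inv_two_add_inv_two]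
      refine hA.trans ?_
      rw [← mul_one (weight _)]
      refine weight_mul_le (B := fun c => {d | c ++ d ∈ S}) ?_ (fun _ _ _ h => h) ?_
      · rintro c (rfl | rfl) c' (rfl | rfl) d d' h <;> simp at h ⊢
      · intro c hc
        obtain ⟨b, rfl⟩ : ∃ b, c = [b] := by rcases hc with rfl | rfl <;> exact ⟨_, rfl⟩
        refine ih fun ω => ?_
        obtain ⟨k, hk, hS⟩ := h fun i => if i = 0 then b else ω (i - 1)
        cases k with
        | zero => exact absurd hS h0
        | succ k =>
          refine ⟨k, by omega, ?_⟩
          rw [add_comm, map_range_add] at hS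
          simpa using hS

/-- The coin sequences for which `p` halts with a state in `Q`. -/
def haltingCoins (p : Prog) (s : State) (Q : State → Prop) : Set (List Bool) :=
  {c | ∃ (s' : State) (t : ℕ), Exec p s c s' t ∧ Q s'}

/-- The probability that `p` halts with a state in `Q`. -/
noncomputable def prob (p : Prog) (s : State) (Q : State → Prop) : ENNReal :=
  weight (haltingCoins p s Q)

theorem outputProb_eq_prob (p : Prog) (x : Data) (Q : Data → Prop) :
    outputProb p x Q = prob p (start x) fun s => Q (s 0) := by
  classical
  rw [outputProb, prob, weight, tsum_subtype (haltingCoins p (start x) fun s => Q (s 0))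
    fun c => (2 : ENNReal)⁻¹ ^ c.length]
  refine tsum_congr fun c => ?_
  rw [Set.indicator_apply]
  congr

theorem Halts.one_le_prob {p : Prog} {s : State} {T : ℕ} {R : State → ℕ → Prop}
    {Q : State → Prop} (h : Halts p s R) (hR : ∀ s' t, R s' t → t ≤ T ∧ Q s') :
    1 ≤ prob p s Q := by
  refine one_le_weight (T := T) fun ω => ?_
  obtain ⟨k, s', t, h1, h2⟩ := h ω
  have := h1.length_add_one_le.1
  rw [List.length_map, List.length_range] at this
  exact ⟨k, this.trans (hR _ _ h2).1, s', t, h1, (hR _ _ h2).2⟩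

/-- The runs of `p` that end in `R` form the prefix-free set `A` of `weight_mul_le`; the state after
`p` is determined by the coins. -/
theorem prob_mul_le_seq {p q : Prog} {s : State} {R Q : State → Prop} {β : ENNReal}
    (h : ∀ s', R s' → β ≤ prob q s' Q) : prob p s R * β ≤ prob (.seq p q) s Q := by
  refine weight_mul_le (B := fun c => {d | ∃ s' t, Exec p s c s' t ∧ R s' ∧
    d ∈ haltingCoins q s' Q}) ?_ ?_ ?_
  · rintro c ⟨s₁, t₁, h1, -⟩ c' ⟨s₂, t₂, h2, -⟩ d d' e
    exact (h1.unique h2 e).1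
  · rintro c _ d ⟨s', t, h1, -, s'', t', h2, h3⟩
    exact ⟨s'', _, h1.seq h2, h3⟩
  · rintro c ⟨s', t, h1, h2⟩
    exact (h s' h2).trans (weight_mono fun d hd => ⟨s', t, h1, h2, hd⟩)

theorem prob_mul_le_loop {e : Expr} {p : Prog} {s : State} {R Q : State → Prop} {β : ENNReal}
    (he : e.eval s ≠ Data.nil) (h : ∀ s', R s' → β ≤ prob (.loop e p) s' Q) :
    prob p s R * β ≤ prob (.loop e p) s Q := by
  refine (prob_mul_le_seq h).trans (weight_mono ?_)
  rintro c ⟨s', t, h1, h2⟩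
  cases h1 with
  | seq a b => exact ⟨s', _, .loop_true he a b, h2⟩

/-! ### Clocked programs -/

/-- Renames the variables. -/
def Expr.shift (M : ℕ) : Expr → Expr
  | .var v => .var (v + M)
  | .nil => .nil
  | .cons e f => .cons (e.shift M) (f.shift M)
  | .hd e => .hd (e.shift M)
  | .tl e => .tl (e.shift M)

/-- All variables have numbers less than `V`. -/
def Expr.Below (V : ℕ) : Expr → Prop
  | .var v => v < V
  | .nil => True
  | .cons e f => e.Below V ∧ f.Below V
  | .hd e => e.Below V
  | .tl e => e.Below V

/-- All variables have numbers less than `V`. -/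
def Prog.Below (V : ℕ) : Prog → Prop
  | .assign v e => v < V ∧ e.Below V
  | .flip v => v < V
  | .seq p q => p.Below V ∧ q.Below V
  | .ite e p q => e.Below V ∧ p.Below V ∧ q.Below V
  | .loop e p => e.Below V ∧ p.Below V

theorem Expr.Below.mono {V W : ℕ} (h : V ≤ W) : ∀ {e : Expr}, e.Below V → e.Below W
  | .var _, he => lt_of_lt_of_le he h
  | .nil, _ => trivial
  | .cons _ _, he => ⟨he.1.mono h, he.2.mono h⟩
  | .hd e, he => Expr.Below.mono (e := e) h he
  | .tl e, he => Expr.Below.mono (e := e) h he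

theorem Prog.Below.mono {V W : ℕ} (h : V ≤ W) : ∀ {p : Prog}, p.Below V → p.Below W
  | .assign _ _, hp => ⟨lt_of_lt_of_le hp.1 h, hp.2.mono h⟩
  | .flip _, hp => lt_of_lt_of_le hp h
  | .seq _ _, hp => ⟨hp.1.mono h, hp.2.mono h⟩
  | .ite _ _ _, hp => ⟨hp.1.mono h, hp.2.1.mono h, hp.2.2.mono h⟩
  | .loop _ _, hp => ⟨hp.1.mono h, hp.2.mono h⟩

theorem Expr.exists_below (e : Expr) : ∃ V, e.Below V := by
  induction e with
  | var v => exact ⟨v + 1, Nat.lt_succ_self v⟩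
  | nil => exact ⟨0, trivial⟩
  | cons e f he hf =>
    obtain ⟨V, hV⟩ := he
    obtain ⟨W, hW⟩ := hf
    exact ⟨max V W, hV.mono (le_max_left _ _), hW.mono (le_max_right _ _)⟩
  | hd e he => exact he
  | tl e he => exact he

theorem Prog.exists_below (p : Prog) : ∃ V, p.Below V := by
  induction p with
  | assign v e =>
    obtain ⟨V, hV⟩ := e.exists_below
    exact ⟨max (v + 1) V, lt_of_lt_of_le (Nat.lt_succ_self v) (le_max_left _ _),
      hV.mono (le_max_right _ _)⟩
  | flip v => exact ⟨v + 1, Nat.lt_succ_self v⟩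
  | seq p q hp hq =>
    obtain ⟨V, hV⟩ := hp
    obtain ⟨W, hW⟩ := hq
    exact ⟨max V W, hV.mono (le_max_left _ _), hW.mono (le_max_right _ _)⟩
  | ite e p q hp hq =>
    obtain ⟨U, hU⟩ := e.exists_below
    obtain ⟨V, hV⟩ := hp
    obtain ⟨W, hW⟩ := hq
    exact ⟨max U (max V W), hU.mono (le_max_left _ _),
      hV.mono ((le_max_left _ _).trans (le_max_right _ _)),
      hW.mono ((le_max_right _ _).trans (le_max_right _ _))⟩
  | loop e p hp =>
    obtain ⟨V, hV⟩ := e.exists_below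
    obtain ⟨W, hW⟩ := hp
    exact ⟨max V W, hV.mono (le_max_left _ _), hW.mono (le_max_right _ _)⟩

theorem Expr.eval_shift {M V : ℕ} {s σ : State} (h : ∀ v < V, σ (v + M) = s v) :
    ∀ {e : Expr}, e.Below V → (e.shift M).eval σ = e.eval s
  | .var v, he => h v he
  | .nil, _ => rfl
  | .cons _ _, he => by
    simp only [Expr.shift, Expr.eval, Expr.eval_shift h he.1, Expr.eval_shift h he.2]
  | .hd e, he => by simp only [Expr.shift, Expr.eval, Expr.eval_shift (e := e) h he]
  | .tl e, he => by simp only [Expr.shift, Expr.eval, Expr.eval_shift (e := e) h he]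

theorem Expr.cost_shift (M : ℕ) (e : Expr) : (e.shift M).cost = e.cost := by
  induction e <;> simp_all [Expr.shift, Expr.cost]

/-- Sets the flag `F` to a value different from `nil` if `e` is not `nil` and the clock `K` has not
run out. -/
def clockTest (K F : ℕ) (e : Expr) : Prog := .ite e (.assign F (.var K)) (.assign F .nil)

/-- The program `p` on the variables from `M` on, with a clock in the variable `K` that is
decremented in every iteration of a loop, and stops all loops when it has run out. -/
def clocked (M K F : ℕ) : Prog → Prog
  | .assign v e => .assign (v + M) (e.shift M)
  | .flip v => .flip (v + M)
  | .seq p q => .seq (clocked M K F p) (clocked M K F q)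
  | .ite e p q => .ite (e.shift M) (clocked M K F p) (clocked M K F q)
  | .loop e p => .seq (clockTest K F (e.shift M)) (.loop (.var F)
      (.seq (.assign K (.tl (.var K))) (.seq (clocked M K F p) (clockTest K F (e.shift M)))))

theorem clocked_deterministic {M K F : ℕ} : ∀ {p : Prog}, p.Deterministic →
    (clocked M K F p).Deterministic
  | .assign _ _, _ => trivial
  | .seq _ _, h => ⟨clocked_deterministic h.1, clocked_deterministic h.2⟩
  | .ite _ _ _, h => ⟨clocked_deterministic h.1, clocked_deterministic h.2⟩
  | .loop _ p, h => ⟨⟨trivial, trivial⟩, trivial, clocked_deterministic (p := p) h, trivial, trivial⟩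

/-- The tree `x` if `d` is not `nil`, and `nil` otherwise. -/
def guarded : Data → Data → Data
  | .nil, _ => .nil
  | .cons _ _, x => x

theorem guarded_of_ne {d : Data} (h : d ≠ Data.nil) (x : Data) : guarded d x = x := by
  cases d with
  | nil => exact absurd rfl h
  | cons => rfl

theorem ne_nil_of_guarded {d x : Data} (h : guarded d x ≠ Data.nil) : x ≠ Data.nil := by
  cases d with
  | nil => exact absurd rfl h
  | cons => exact h

theorem exec_clockTest (K F : ℕ) (e : Expr) (σ : State) :
    Exec (clockTest K F e) σ [] (Function.update σ F (guarded (e.eval σ) (σ K)))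
      (e.cost + 3) := by
  by_cases h : e.eval σ = Data.nil
  · rw [h]
    exact Exec.ite_false (p := .assign F (.var K)) h (.assign F .nil σ)
  · rw [guarded_of_ne h]
    exact Exec.ite_true (q := .assign F .nil) h (.assign F (.var K) σ)

theorem enc_nat_ne_nil {L : ℕ} (h : 0 < L) : enc L ≠ Data.nil := by
  cases L with
  | zero => omega
  | succ L => simp [enc_succ]

theorem pos_of_enc_ne_nil {L : ℕ} (h : enc L ≠ Data.nil) : 0 < L := by
  rcases Nat.eq_zero_or_pos L with rfl | h'
  · exact absurd rfl h
  · exact h'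

theorem tl_enc_nat (L : ℕ) : (enc L).tl = enc (L - 1) := by
  cases L with
  | zero => rfl
  | succ L => rfl

/-- The clocked program halts, after a number of steps that is linear in the time on the clock. -/
theorem exists_halts_clocked (M K F : ℕ) (hK : K < M) (hKF : K ≠ F) (p : Prog) :
    ∃ κ, ∀ (σ : State) (L : ℕ), σ K = enc L → Halts (clocked M K F p) σ fun σ' t =>
      ∃ L' ≤ L, σ' K = enc L' ∧ t + κ * L' ≤ κ * (L + 1) ∧
        ∀ v < M, v ≠ K → v ≠ F → σ' v = σ v := by
  induction p with
  | assign v e =>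
    refine ⟨e.cost + 1, fun σ L hL => .of_exec (.assign _ _ _) ⟨L, le_rfl, ?_, ?_, ?_⟩⟩
    · rw [Function.update_of_ne (by omega), hL]
    · rw [Expr.cost_shift, mul_add]; omega
    · exact fun w hw _ _ => Function.update_of_ne (by omega) _ _
  | flip v =>
    refine ⟨1, fun σ L hL ω => ⟨1, _, _, Exec.flip _ (ω 0) _, L, le_rfl, ?_, by omega, ?_⟩⟩
    · rw [Function.update_of_ne (by omega), hL]
    · exact fun w hw _ _ => Function.update_of_ne (by omega) _ _
  | seq p q hp hq =>
    obtain ⟨κ, hκ⟩ := hp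
    obtain ⟨μ, hμ⟩ := hq
    refine ⟨κ + μ, fun σ L hL => (hκ σ L hL).seq ?_⟩
    rintro σ₁ t ⟨L₁, h1, h2, h3, h4⟩
    refine (hμ σ₁ L₁ h2).mono ?_
    rintro σ₂ t' ⟨L₂, k1, k2, k3, k4⟩
    refine ⟨L₂, k1.trans h1, k2, ?_, fun v hv a b => by rw [k4 v hv a b, h4 v hv a b]⟩
    have a1 := Nat.mul_le_mul_left κ k1
    have a2 := Nat.mul_le_mul_left μ h1
    simp only [add_mul, mul_add, mul_one] at *
    omega
  | ite e p q hp hq =>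
    obtain ⟨κ, hκ⟩ := hp
    obtain ⟨μ, hμ⟩ := hq
    refine ⟨κ + μ + e.cost + 1, fun σ L hL => .ite (fun _ => (hκ σ L hL).mono ?_)
      fun _ => (hμ σ L hL).mono ?_⟩
    all_goals
      rintro σ' t ⟨L', h1, h2, h3, h4⟩
      refine ⟨L', h1, h2, ?_, h4⟩
      have a1 := Nat.mul_le_mul_left κ h1
      have a2 := Nat.mul_le_mul_left μ h1
      have a3 := Nat.mul_le_mul_left e.cost h1
      simp only [add_mul, mul_add, mul_one, one_mul, Expr.cost_shift] at *
      omega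
  | loop e p hp =>
    obtain ⟨κ, hκ⟩ := hp
    set body : Prog := .seq (.assign K (.tl (.var K))) (.seq (clocked M K F p)
      (clockTest K F (e.shift M))) with hbody
    set μ := κ + e.cost + 20 with hμ
    -- An amortized estimate with potential `μ` times the time on the clock. Every round ticks at
    -- least once, so strong induction on that time applies; the flag can be set only while the
    -- clock is positive.
    have key : ∀ (L : ℕ) (σ : State), σ K = enc L → (σ F ≠ Data.nil → 0 < L) →
        Halts (.loop (.var F) body) σ fun σ' t => ∃ L' ≤ L, σ' K = enc L' ∧
          t + μ * L' ≤ μ * L + 2 ∧ ∀ v < M, v ≠ K → v ≠ F → σ' v = σ v := by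
      intro L
      induction L using Nat.strong_induction_on with
      | _ L ih =>
        intro σ hL hFL
        by_cases hf : σ F = Data.nil
        · exact .of_exec (.loop_false hf) ⟨L, le_rfl, hL, by simp [Expr.cost]; omega,
            fun v _ _ _ => rfl⟩
        · have hL0 := hFL hf
          refine Halts.loop (R := fun σ' t => ∃ L' ≤ L - 1, σ' K = enc L' ∧
            t + κ * L' ≤ κ * L + e.cost + 6 ∧ (σ' F ≠ Data.nil → 0 < L') ∧
            ∀ v < M, v ≠ K → v ≠ F → σ' v = σ v) hf ?_ ?_
          · refine Halts.seq (R := fun σ' t => σ' = Function.update σ K (enc (L - 1)) ∧ t = 3)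
              (.of_exec (.assign _ _ _) ⟨?_, rfl⟩) ?_
            · simp only [Expr.eval, hL, tl_enc_nat]
            · rintro _ _ ⟨rfl, rfl⟩
              refine Halts.seq (hκ _ (L - 1) (by simp)) ?_
              rintro σ₁ t ⟨L₁, h1, h2, h3, h4⟩
              refine .of_exec (exec_clockTest _ _ _ _) ⟨L₁, h1, ?_, ?_, ?_, ?_⟩
              · rw [Function.update_of_ne hKF, h2]
              · rw [Expr.cost_shift]
                rw [show L - 1 + 1 = L by omega] at h3
                omega
              · rw [Function.update_self]
                intro hne
                exact pos_of_enc_ne_nil (h2 ▸ ne_nil_of_guarded hne)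
              · intro v hv a b
                rw [Function.update_of_ne b, h4 v hv a b, Function.update_of_ne a]
          · rintro σ₁ t ⟨L₁, h1, h2, h3, h4, h5⟩
            refine (ih L₁ (by omega) σ₁ h2 h4).mono ?_
            rintro σ₂ t' ⟨L₂, k1, k2, k3, k4⟩
            refine ⟨L₂, by omega, k2, ?_, fun v hv a b => by rw [k4 v hv a b, h5 v hv a b]⟩
            obtain ⟨d, rfl⟩ : ∃ d, L = L₁ + 1 + d := ⟨L - L₁ - 1, by omega⟩
            have a3 := Nat.zero_le (e.cost * d)
            simp only [Expr.cost, hμ, add_mul, mul_add, mul_one] at *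
            omega
    refine ⟨2 * μ, fun σ L hL => Halts.seq (R := fun σ' t => σ' = Function.update σ F
      (guarded ((e.shift M).eval σ) (σ K)) ∧ t = e.cost + 3)
      (.of_exec (exec_clockTest _ _ _ _) ⟨rfl, by rw [Expr.cost_shift]⟩) ?_⟩
    rintro _ _ ⟨rfl, rfl⟩
    refine (key L _ ?_ ?_).mono ?_
    · rw [Function.update_of_ne hKF, hL]
    · rw [Function.update_self]
      intro hne
      exact pos_of_enc_ne_nil (hL ▸ ne_nil_of_guarded hne)
    · rintro σ' t ⟨L', h1, h2, h3, h4⟩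
      refine ⟨L', h1, h2, ?_, fun v hv a b => by rw [h4 v hv a b, Function.update_of_ne b]⟩
      have a1 := Nat.mul_le_mul_left μ h1
      simp only [mul_assoc, mul_add, mul_one] at *
      omega

/-- A run of `p` within the time on the clock is reproduced by the clocked program. -/
theorem Exec.clocked {M K F V : ℕ} (hK : K < M) (hF : F < M) (hKF : K ≠ F) {p : Prog}
    {s s' : State} {c : List Bool} {t : ℕ} (h : Exec p s c s' t) (hp : p.Below V) :
    ∀ (σ : State) (L : ℕ), (∀ v < V, σ (v + M) = s v) → σ K = enc L → t ≤ L →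
      ∃ (σ' : State) (t' L' : ℕ), Exec (clocked M K F p) σ c σ' t' ∧
        (∀ v < V, σ' (v + M) = s' v) ∧ σ' K = enc L' ∧ L ≤ L' + t := by
  induction h with
  | assign v e s =>
    intro σ L hσ hL ht
    refine ⟨_, _, L, .assign _ _ _, fun w hw => ?_, ?_, by omega⟩
    · rw [Expr.eval_shift hσ hp.2]
      by_cases hwv : w = v
      · subst hwv; simp
      · rw [Function.update_of_ne (by omega), Function.update_of_ne hwv, hσ w hw]
    · rw [Function.update_of_ne (by omega), hL]
  | flip v b s =>
    intro σ L hσ hL ht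
    refine ⟨_, _, L, .flip _ _ _, fun w hw => ?_, ?_, by omega⟩
    · by_cases hwv : w = v
      · subst hwv; simp
      · rw [Function.update_of_ne (by omega), Function.update_of_ne hwv, hσ w hw]
    · rw [Function.update_of_ne (by omega), hL]
  | seq _ _ ih1 ih2 =>
    intro σ L hσ hL ht
    obtain ⟨σ₁, t₁, L₁, h1, h2, h3, h4⟩ := ih1 hp.1 σ L hσ hL (by omega)
    obtain ⟨σ₂, t₂, L₂, k1, k2, k3, k4⟩ := ih2 hp.2 σ₁ L₁ h2 h3 (by omega)
    exact ⟨σ₂, _, L₂, h1.seq k1, k2, k3, by omega⟩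
  | ite_true he _ ih =>
    intro σ L hσ hL ht
    obtain ⟨σ₁, t₁, L₁, h1, h2, h3, h4⟩ := ih hp.2.1 σ L hσ hL (by omega)
    exact ⟨σ₁, _, L₁, .ite_true (by rwa [Expr.eval_shift hσ hp.1]) h1, h2, h3, by omega⟩
  | ite_false he _ ih =>
    intro σ L hσ hL ht
    obtain ⟨σ₁, t₁, L₁, h1, h2, h3, h4⟩ := ih hp.2.2 σ L hσ hL (by omega)
    exact ⟨σ₁, _, L₁, .ite_false (by rwa [Expr.eval_shift hσ hp.1]) h1, h2, h3, by omega⟩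
  | @loop_false e p s he =>
    intro σ L hσ hL ht
    have h1 := exec_clockTest K F (e.shift M) σ
    rw [Expr.eval_shift hσ hp.1, he] at h1
    refine ⟨_, _, L, h1.seq_nil (.loop_false (by simp [Expr.eval, guarded])), fun w hw => ?_, ?_, by omega⟩
    · rw [Function.update_of_ne (by omega), hσ w hw]
    · rw [Function.update_of_ne hKF, hL]
  | @loop_true e p s s' s'' c c' t t' he _ _ ih1 ih2 =>
    intro σ L hσ hL ht
    have h1 := exec_clockTest K F (e.shift M) σ
    rw [Expr.eval_shift hσ hp.1, guarded_of_ne he] at h1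
    set σ₀ := Function.update σ F (σ K) with hσ₀
    set σ₁ := Function.update σ₀ K (enc (L - 1)) with hσ₁
    have h2 : Exec (.assign K (.tl (.var K))) σ₀ [] σ₁ 3 := by
      have := Exec.assign K (.tl (.var K)) σ₀
      have e1 : σ₀ K = enc L := by rw [hσ₀, Function.update_of_ne hKF, hL]
      simpa [Expr.eval, Expr.cost, e1, tl_enc_nat, hσ₁] using this
    -- The evaluation of the loop condition in the original run pays for the tick, so the clock
    -- still suffices for the body.
    obtain ⟨σ₂, t₂, L₂, k1, k2, k3, k4⟩ := ih1 hp.2 σ₁ (L - 1) (fun v hv => by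
      rw [hσ₁, hσ₀, Function.update_of_ne (by omega), Function.update_of_ne (by omega), hσ v hv])
      (by simp [hσ₁]) (by omega)
    obtain ⟨σ₃, t₃, L₃, m1, m2, m3, m4⟩ := ih2 hp σ₂ L₂ k2 k3 (by omega)
    have e1 := Expr.one_le_cost e
    -- The induction hypothesis provides a run of the whole clocked loop, which starts with a clock
    -- test. That test is the one at the end of the present round, so the run is split there and
    -- reassociated.
    cases m1 with
    | @seq _ _ _ σ₄ _ ca cb ta tb a b =>
      have hne : (Expr.var F).eval σ₀ ≠ Data.nil := by
        rw [Expr.eval, hσ₀, Function.update_self, hL]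
        exact enc_nat_ne_nil (by omega)
      have := h1.seq (Exec.loop_true hne (h2.seq (k1.seq a)) b)
      simp only [List.nil_append, ← List.append_assoc] at this
      rw [← List.append_assoc]
      exact ⟨σ₃, _, L₃, this, m2, m3, by omega⟩

/-! ### Separators of trees -/

/-- Every tree has a function that maps each node to its parent. -/
theorem exists_parent {V : Type} {G : SimpleGraph V} (hG : G.IsTree) (r : V) :
    ∃ (par : V → V) (d : V → ℕ), (∀ v, d v = 0 ↔ v = r) ∧ (∀ v, v ≠ r → d (par v) + 1 = d v) ∧
      ∀ u v, G.Adj u v → (u = par v ∧ d u + 1 = d v) ∨ (v = par u ∧ d v + 1 = d u) := by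
  have hex : ∀ v, v ≠ r → ∃ u, G.Adj u v ∧ G.dist r u + 1 = G.dist r v := by
    intro v hv
    obtain ⟨p, hp⟩ := hG.connected.exists_walk_length_eq_dist v r
    cases p with
    | nil => exact absurd rfl hv
    | @cons _ u _ h q =>
      refine ⟨u, h.symm, ?_⟩
      rw [SimpleGraph.Walk.length_cons, SimpleGraph.dist_comm] at hp
      have h1 : G.dist r u ≤ q.length := by rw [SimpleGraph.dist_comm]; exact SimpleGraph.dist_le q
      rcases hG.dist_eq_dist_add_one_of_adj r h with h2 | h2 <;> omega
  -- The parent is unique: shortest walks to two candidates would extend to two different paths from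
  -- `r` to `v`.
  have huniq : ∀ u u' v, G.Adj u v → G.Adj u' v → G.dist r u + 1 = G.dist r v →
      G.dist r u' + 1 = G.dist r v → u = u' := by
    intro u u' v h h' e e'
    obtain ⟨p, hp⟩ := hG.connected.exists_walk_length_eq_dist r u
    obtain ⟨q, hq⟩ := hG.connected.exists_walk_length_eq_dist r u'
    have h1 : (p.concat h).IsPath := SimpleGraph.Walk.isPath_of_length_eq_dist _
      (by rw [SimpleGraph.Walk.length_concat, hp, e])
    have h2 : (q.concat h').IsPath := SimpleGraph.Walk.isPath_of_length_eq_dist _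
      (by rw [SimpleGraph.Walk.length_concat, hq, e'])
    have h3 := (hG.existsUnique_path r v).unique h1 h2
    exact (SimpleGraph.Walk.concat_inj h3).1
  choose! par hpar using hex
  refine ⟨par, G.dist r, fun v => ?_, fun v hv => (hpar v hv).2, fun u v h => ?_⟩
  · rw [hG.connected.dist_eq_zero_iff, eq_comm]
  · have hne : ∀ a b, G.dist r a + 1 = G.dist r b → b ≠ r := by
      rintro a _ e rfl
      rw [SimpleGraph.dist_self] at e
      omega
    rcases hG.dist_eq_dist_add_one_of_adj r h with e | e
    · exact Or.inr ⟨huniq _ _ u h.symm (hpar u (hne _ _ e.symm)).1 e.symm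
        (hpar u (hne _ _ e.symm)).2, e.symm⟩
    · exact Or.inl ⟨huniq _ _ v h (hpar v (hne _ _ e.symm)).1 e.symm
        (hpar v (hne _ _ e.symm)).2, e.symm⟩

/-- The ancestor of `u` at depth `j`. -/
def ancestor {V : Type} (par : V → V) (d : V → ℕ) (u : V) (j : ℕ) : V := par^[d u - j] u

section

variable {V : Type} {par : V → V} {d : V → ℕ} {r : V}

theorem ancestor_self (u : V) : ancestor par d u (d u) = u := by simp [ancestor]

theorem ancestor_child {u w : V} (h1 : u = par w) (h2 : d u + 1 = d w) {j : ℕ} (hj : j ≤ d u) :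
    ancestor par d w j = ancestor par d u j := by
  rw [ancestor, show d w - j = (d u - j) + 1 by omega, Function.iterate_succ_apply, ← h1, ancestor]

theorem depth_ancestor (hr : ∀ v, d v = 0 ↔ v = r) (hp : ∀ v, v ≠ r → d (par v) + 1 = d v)
    {u : V} {j : ℕ} (hj : j ≤ d u) : d (ancestor par d u j) = j := by
  induction h : d u generalizing u with
  | zero =>
    obtain rfl : j = d u := by omega
    rw [ancestor_self]
  | succ m ih =>
    rcases Nat.lt_or_ge j (d u) with hlt | hge
    · have h1 := hp u fun e => by have := (hr u).2 e; omega
      rw [ancestor_child rfl h1 (by omega)]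
      exact ih (by omega) (by omega)
    · obtain rfl : j = d u := by omega
      rw [ancestor_self]

theorem ancestor_mem (hr : ∀ v, d v = 0 ↔ v = r) (hp : ∀ v, v ≠ r → d (par v) + 1 = d v)
    {U : Finset V} (hU : ∀ u ∈ U, u ≠ r → par u ∈ U) {u : V} (hu : u ∈ U)
    {j : ℕ} (hj : j ≤ d u) : ancestor par d u j ∈ U := by
  induction h : d u generalizing u with
  | zero =>
    obtain rfl : j = d u := by omega
    rwa [ancestor_self]
  | succ m ih =>
    rcases Nat.lt_or_ge j (d u) with hlt | hge
    · have hne : u ≠ r := fun e => by have := (hr u).2 e; omega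
      have h1 := hp u hne
      rw [ancestor_child rfl h1 (by omega)]
      exact ih (hU u hu hne) (by omega) (by omega)
    · obtain rfl : j = d u := by omega
      rwa [ancestor_self]

-- Let `v` be a deepest node with more than `s` descendants in `U`. It is put into the separator and
-- its descendants are removed; these at least `s + 1` nodes pay for `v`. The branches below `v`
-- have at most `s` nodes each by the choice of `v`, and the rest of `U` is still closed under
-- parents. The labels `L` name the parts: a node below `v` is labelled by the root of its branch.
open Classical in
theorem exists_separator_aux (hr : ∀ v, d v = 0 ↔ v = r) (hp : ∀ v, v ≠ r → d (par v) + 1 = d v)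
    (s : ℕ) (U : Finset V) (hU : ∀ u ∈ U, u ≠ r → par u ∈ U) :
    ∃ (B : Finset V) (L : V → V), B.card * (s + 1) ≤ U.card ∧
      (∀ u ∈ U, ∀ w ∈ U, u = par w → d u + 1 = d w → u ∉ B → w ∉ B → L u = L w) ∧
      (∀ u ∈ U, L u ∈ U) ∧ ∀ l, (U.filter fun u => u ∉ B ∧ L u = l).card ≤ s := by
  induction h : U.card using Nat.strong_induction_on generalizing U with
  | _ m ih =>
    subst h
    rcases Nat.lt_or_ge s U.card with hs | hs
    · let D : V → Finset V := fun v => U.filter fun u => d v ≤ d u ∧ ancestor par d u (d v) = v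
      have hDr : D r = U := by
        refine Finset.filter_true_of_mem fun u _ => ?_
        rw [(hr r).2 rfl]
        exact ⟨Nat.zero_le _, (hr _).1 (depth_ancestor hr hp (Nat.zero_le _))⟩
      have hrU : r ∈ U := by
        obtain ⟨u, hu⟩ : U.Nonempty := Finset.card_pos.1 (by omega)
        have := ancestor_mem hr hp hU hu (Nat.zero_le _)
        rwa [(hr _).1 (depth_ancestor hr hp (Nat.zero_le _))] at this
      obtain ⟨v, hv, hmax⟩ := Finset.exists_max_image (U.filter fun v => s < (D v).card) d
        ⟨r, by simp [hrU, hDr, hs]⟩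
      rw [Finset.mem_filter] at hv
      have hchild : ∀ u w, u = par w → d u + 1 = d w → w ∈ U → u ∈ D v → w ∈ D v := by
        intro u w h1 h2 hw hu
        obtain ⟨a1, a2, a3⟩ := Finset.mem_filter.1 hu
        exact Finset.mem_filter.2 ⟨hw, by omega, by rw [ancestor_child h1 h2 a2, a3]⟩
      obtain ⟨B, L, hB, hL, hLU, hc⟩ := ih (U \ D v).card (by
          have := Finset.card_sdiff_add_card_eq_card (show D v ⊆ U from Finset.filter_subset _ _)
          omega) (U \ D v) (by
          intro u hu hne
          rw [Finset.mem_sdiff] at hu ⊢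
          exact ⟨hU u hu.1 hne, fun h => hu.2 (hchild _ u rfl (hp u hne) hu.1 h)⟩) rfl
      -- The ancestor at depth `d v + 1` is the child of `v` above `u`. For `u = v` truncated
      -- subtraction makes it `v` itself, which keeps labels inside `U`.
      refine ⟨insert v B, fun u => if u ∈ D v then ancestor par d u (d v + 1) else L u,
        ?_, ?_, ?_, ?_⟩
      · have := Finset.card_sdiff_add_card_eq_card (show D v ⊆ U from Finset.filter_subset _ _)
        have := Nat.mul_le_mul_right (s + 1) (Finset.card_insert_le v B)
        rw [add_mul, one_mul] at this
        omega
      · intro u hu w hw h1 h2 huB hwB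
        rw [Finset.mem_insert, not_or] at huB hwB
        by_cases huD : u ∈ D v
        · have hwD := hchild u w h1 h2 hw huD
          obtain ⟨a1, a2, a3⟩ := Finset.mem_filter.1 huD
          have : d v ≠ d u := fun e => huB.1 (by rw [← a3, e, ancestor_self])
          simp only [huD, hwD, if_true]
          rw [ancestor_child h1 h2 (by omega)]
        · have hwD : w ∉ D v := by
            intro hwD
            obtain ⟨a1, a2, a3⟩ := Finset.mem_filter.1 hwD
            have : d v ≠ d w := fun e => hwB.1 (by rw [← a3, e, ancestor_self])
            exact huD (Finset.mem_filter.2 ⟨hu, by omega,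
              by rw [← ancestor_child h1 h2 (by omega), a3]⟩)
          simp only [huD, hwD, if_false]
          exact hL u (Finset.mem_sdiff.2 ⟨hu, huD⟩) w (Finset.mem_sdiff.2 ⟨hw, hwD⟩) h1 h2
            huB.2 hwB.2
      · intro u hu
        dsimp only
        split
        · rename_i huD
          obtain ⟨a1, a2, a3⟩ := Finset.mem_filter.1 huD
          rcases Nat.lt_or_ge (d v) (d u) with h | h
          · exact ancestor_mem hr hp hU hu h
          · rw [ancestor, show d u - (d v + 1) = 0 by omega]; exact hu
        · rename_i huD
          exact (Finset.mem_sdiff.1 (hLU u (Finset.mem_sdiff.2 ⟨hu, huD⟩))).1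
      · intro l
        by_cases hl : l ∈ D v
        · by_cases hlv : d v < d l
          · have hlU := (Finset.mem_filter.1 hl).1
            -- The label `l` is a proper descendant of `v`, so by maximality of the depth of `v` it
            -- has at most `s` descendants, and all nodes with this label are among them.
            have hlD : (D l).card ≤ s := by
              by_contra hcon
              have := hmax l (Finset.mem_filter.2 ⟨hlU, by omega⟩)
              omega
            refine (Finset.card_le_card ?_).trans hlD
            intro u hu
            obtain ⟨b1, b2, b3⟩ := Finset.mem_filter.1 hu
            by_cases huD : u ∈ D v
            · simp only [huD, if_true] at b3
              obtain ⟨a1, a2, a3⟩ := Finset.mem_filter.1 huD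
              have : d v ≠ d u := fun e => b2 (by
                rw [Finset.mem_insert]; left; rw [← a3, e, ancestor_self])
              have hd : d l = d v + 1 := by rw [← b3, depth_ancestor hr hp (by omega)]
              exact Finset.mem_filter.2 ⟨b1, by omega, by rw [hd, b3]⟩
            · simp only [huD, if_false] at b3
              exact absurd hl (b3 ▸ (Finset.mem_sdiff.1 (hLU u (Finset.mem_sdiff.2 ⟨b1, huD⟩))).2)
          -- A label in `D v` that is not deeper than `v` belongs to no node outside the separator.
          · rw [Finset.card_eq_zero.2]
            · omega
            rw [Finset.filter_eq_empty_iff]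
            rintro u b1 ⟨b2, b3⟩
            by_cases huD : u ∈ D v
            · simp only [huD, if_true] at b3
              obtain ⟨a1, a2, a3⟩ := Finset.mem_filter.1 huD
              have : d v ≠ d u := fun e => b2 (by
                rw [Finset.mem_insert]; left; rw [← a3, e, ancestor_self])
              have hd : d l = d v + 1 := by rw [← b3, depth_ancestor hr hp (by omega)]
              omega
            · simp only [huD, if_false] at b3
              exact absurd hl (b3 ▸ (Finset.mem_sdiff.1 (hLU u (Finset.mem_sdiff.2 ⟨b1, huD⟩))).2)
        · refine (Finset.card_le_card ?_).trans (hc l)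
          intro u hu
          obtain ⟨b1, b2, b3⟩ := Finset.mem_filter.1 hu
          have huD : u ∉ D v := by
            intro huD
            simp only [huD, if_true] at b3
            obtain ⟨a1, a2, a3⟩ := Finset.mem_filter.1 huD
            have hne : d v ≠ d u := fun e => b2 (by
              rw [Finset.mem_insert]; left; rw [← a3, e, ancestor_self])
            refine hl (Finset.mem_filter.2 ⟨?_, ?_, ?_⟩)
            · rw [← b3]; exact ancestor_mem hr hp hU b1 (by omega)
            · rw [← b3, depth_ancestor hr hp (by omega)]; omega
            · have hd : d l = d v + 1 := by rw [← b3, depth_ancestor hr hp (by omega)]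
              have hlr : l ≠ r := fun e => by have := (hr l).2 e; omega
              have : ancestor par d u (d v) = par l := by
                rw [← b3, ancestor, ancestor, ← Function.iterate_succ_apply' par]
                congr 1; omega
              rw [ancestor, hd, show d v + 1 - d v = 1 by omega, Function.iterate_one, ← this, a3]
          simp only [huD, if_false] at b3
          exact Finset.mem_filter.2 ⟨Finset.mem_sdiff.2 ⟨b1, huD⟩,
            fun h => b2 (Finset.mem_insert_of_mem h), b3⟩
    -- A set of at most `s` nodes needs no separator and forms a single part.
    · exact ⟨∅, fun _ => r, by simp, fun _ _ _ _ _ _ _ _ => rfl, fun u hu => by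
        have := ancestor_mem hr hp hU hu (Nat.zero_le _)
        rwa [(hr _).1 (depth_ancestor hr hp (Nat.zero_le _))] at this,
        fun l => (Finset.card_filter_le _ _).trans hs⟩

/-- A tree on `n` nodes has a set of at most `n / (s + 1)` nodes without which it falls apart into
components of size at most `s`. -/
theorem exists_separator [Fintype V] {G : SimpleGraph V} (hG : G.IsTree) (s : ℕ) :
    ∃ (B : Finset V) (L : V → V), B.card * (s + 1) ≤ Fintype.card V ∧
      (∀ u w, G.Adj u w → u ∉ B → w ∉ B → L u = L w) ∧
      ∀ l, {u : V | u ∉ B ∧ L u = l}.ncard ≤ s := by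
  classical
  obtain ⟨r⟩ := hG.connected.nonempty
  obtain ⟨par, d, hr, hp, hadj⟩ := exists_parent hG r
  obtain ⟨B, L, h1, h2, -, h3⟩ := exists_separator_aux hr hp s Finset.univ (by simp)
  refine ⟨B, L, h1, fun u w h hu hw => ?_, fun l => ?_⟩
  · rcases hadj u w h with ⟨a, b⟩ | ⟨a, b⟩
    · exact h2 u (by simp) w (by simp) a b hu hw
    · exact (h2 w (by simp) u (by simp) a b hw hu).symm
  · convert h3 l
    rw [← Set.ncard_coe_finset]
    congr 1
    ext; simp

end

/-! ### Properties of the pieces -/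

theorem mem_iff {u : ℕ} {l : List ℕ} : mem u l = true ↔ u ∈ l := by simp [mem]

/-- The nodes `u` and `w` are joined by an edge of `T` that avoids `D`. -/
def Linked (n : ℕ) (T : Mat) (D : List ℕ) (u w : ℕ) : Prop :=
  u < n ∧ w < n ∧ u ∉ D ∧ w ∉ D ∧ (entry T u w = true ∨ entry T w u = true)

theorem Linked.symm {n : ℕ} {T : Mat} {D : List ℕ} {u w : ℕ} (h : Linked n T D u w) :
    Linked n T D w u :=
  ⟨h.2.1, h.1, h.2.2.2.1, h.2.2.1, h.2.2.2.2.symm⟩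

/-- A set of nodes that is closed under `Linked`. -/
def LinkClosed (n : ℕ) (T : Mat) (D : List ℕ) (S : ℕ → Prop) : Prop :=
  ∀ u w, Linked n T D u w → S u → S w

theorem LinkClosed.not {n : ℕ} {T : Mat} {D : List ℕ} {S : ℕ → Prop} (h : LinkClosed n T D S) :
    LinkClosed n T D fun u => ¬ S u := fun u w hl hu hw => hu (h w u hl.symm hw)

section

variable {n : ℕ} {T : Mat} {D : List ℕ}

theorem mem_grow {u : ℕ} {cur : List ℕ} (hcur : ∀ w ∈ cur, w < n) : u ∈ grow n T D cur ↔
    u ∈ cur ∨ ∃ w ∈ cur, Linked n T D w u := by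
  simp only [grow, List.mem_filter, List.mem_range, Bool.or_eq_true, mem_iff, Bool.and_eq_true,
    Bool.not_eq_true', List.any_eq_true, Linked]
  have e : ∀ a, mem a D = false ↔ a ∉ D := fun a => by rw [← mem_iff, Bool.not_eq_true]
  simp only [e]
  constructor
  · rintro ⟨h1, h2 | ⟨h2, w, h3, h4, h5⟩⟩
    · exact Or.inl h2
    · exact Or.inr ⟨w, h3, hcur w h3, h1, h4, h2, h5.symm⟩
  · rintro (h | ⟨w, h3, -, h1, h4, h2, h5⟩)
    · exact ⟨hcur u h, Or.inl h⟩
    · exact ⟨h1, Or.inr ⟨h2, w, h3, h4, h5.symm⟩⟩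

theorem lt_of_mem_iterate_grow {v : ℕ} (hv : v < n) (i : ℕ) :
    ∀ u ∈ (grow n T D)^[i] [v], u < n := by
  cases i with
  | zero => simpa using hv
  | succ i =>
    intro u hu
    rw [Function.iterate_succ_apply'] at hu
    exact List.mem_range.1 (List.mem_filter.1 hu).1

theorem nodup_iterate_grow (v i : ℕ) : ((grow n T D)^[i] [v]).Nodup := by
  cases i with
  | zero => simp
  | succ i =>
    rw [Function.iterate_succ_apply']
    exact List.nodup_range.filter _

theorem self_mem_component {v : ℕ} (hv : v < n) : v ∈ component n T D v := by
  unfold component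
  induction n with
  | zero => omega
  | succ m _ =>
    have : ∀ i, v ∈ (grow (m + 1) T D)^[i] [v] := by
      intro i
      induction i with
      | zero => simp
      | succ i ih =>
        rw [Function.iterate_succ_apply', mem_grow (lt_of_mem_iterate_grow hv i)]
        exact Or.inl ih
    exact this _

/-- The component is contained in every closed set that contains `v`. This bounds components and
also shows that a new component avoids all earlier pieces, whose complement is closed. -/
theorem component_subset {v : ℕ} (hv : v < n) {S : ℕ → Prop} (hS : LinkClosed n T D S)
    (hvS : S v) : ∀ u ∈ component n T D v, S u := by
  have : ∀ i, ∀ u ∈ (grow n T D)^[i] [v], S u := by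
    intro i
    induction i with
    | zero => simpa using hvS
    | succ i ih =>
      intro u hu
      rw [Function.iterate_succ_apply', mem_grow (lt_of_mem_iterate_grow hv i)] at hu
      rcases hu with h | ⟨w, h1, h2⟩
      · exact ih u h
      · exact hS w u h2 (ih w h1)
  exact this n

/-- As long as the current set is not closed, each iteration adds a node. A set that is still not
closed after `n` iterations would have more than `n` nodes. -/
theorem linkClosed_component {v : ℕ} (hv : v < n) :
    LinkClosed n T D fun u => u ∈ component n T D v := by
  have hlt := fun i => lt_of_mem_iterate_grow (T := T) (D := D) hv i
  have key : ∀ i, (LinkClosed n T D fun u => u ∈ (grow n T D)^[i] [v]) ∨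
      i < ((grow n T D)^[i] [v]).toFinset.card := by
    intro i
    induction i with
    | zero => right; simp
    | succ i ih =>
      have hsub : ∀ u ∈ (grow n T D)^[i] [v], u ∈ (grow n T D)^[i + 1] [v] := fun u hu => by
        rw [Function.iterate_succ_apply', mem_grow (hlt i)]; exact Or.inl hu
      by_cases h : LinkClosed n T D fun u => u ∈ (grow n T D)^[i] [v]
      · left
        have e : ∀ u, u ∈ (grow n T D)^[i + 1] [v] ↔ u ∈ (grow n T D)^[i] [v] := by
          intro u
          refine ⟨fun hu => ?_, hsub u⟩
          rw [Function.iterate_succ_apply', mem_grow (hlt i)] at hu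
          rcases hu with hu | ⟨w, h1, h2⟩
          · exact hu
          · exact h w u h2 h1
        simpa only [e] using h
      · right
        have h2 := ih.resolve_left h
        simp only [LinkClosed, not_forall] at h
        obtain ⟨u, w, h3, h4, h5⟩ := h
        refine lt_of_le_of_lt (Nat.succ_le_of_lt h2) (Finset.card_lt_card ?_)
        rw [Finset.ssubset_iff_of_subset (fun x hx => by
          rw [List.mem_toFinset] at *; exact hsub x hx)]
        refine ⟨w, ?_, by simpa using h5⟩
        rw [List.mem_toFinset, Function.iterate_succ_apply', mem_grow (hlt i)]
        exact Or.inr ⟨u, h4, h3⟩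
  refine (key n).resolve_right fun h => ?_
  have : ((grow n T D)^[n] [v]).toFinset ⊆ Finset.range n := fun u hu => by
    rw [List.mem_toFinset] at hu
    exact Finset.mem_range.2 (hlt n u hu)
  have := Finset.card_le_card this
  rw [Finset.card_range] at this
  omega

/-- The invariant of the greedy grouping. The structural clauses hold for every `D`, since soundness
must cover wrong guesses; only the size bounds need small components. A piece is closed as soon as
it has `s` nodes: before the last component it had fewer than `s`, and that component adds at most
`s`. -/
theorem pieces_fold (s : ℕ) : ∀ m ≤ n, ∀ st, st = (List.range m).foldl (piecesStep s n T D) ([], []) →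
    (st.1 ++ st.2.flatten).Nodup ∧ (∀ u ∈ st.1 ++ st.2.flatten, u < n) ∧
    (∀ v < m, v ∈ st.1 ++ st.2.flatten) ∧
    (LinkClosed n T D fun u => u ∈ st.1) ∧ (∀ P ∈ st.2, LinkClosed n T D fun u => u ∈ P) ∧
    ((0 < s ∧ ∀ v < n, (component n T D v).length ≤ s) →
      st.1.length < s ∧ ∀ P ∈ st.2, s ≤ P.length ∧ P.length ≤ 2 * s) := by
  intro m
  induction m with
  | zero =>
    rintro - st rfl
    simp only [List.range_zero, List.foldl_nil, List.flatten_nil, List.append_nil]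
    exact ⟨List.nodup_nil, by simp, by simp, fun u w _ h => by simp at h, by simp,
      fun h => ⟨h.1, by simp⟩⟩
  | succ m ih =>
    rintro hm st rfl
    rw [List.range_succ, List.foldl_append, List.foldl_cons, List.foldl_nil]
    generalize hst : (List.range m).foldl (piecesStep s n T D) ([], []) = st
    obtain ⟨h1, h2, h3, h4, h5, h6⟩ := ih (by omega) st hst.symm
    obtain ⟨cur, don⟩ := st
    simp only at h1 h2 h3 h4 h5 h6
    have hm' : m < n := by omega
    by_cases hused : m ∈ cur ++ don.flatten
    · have e : piecesStep s n T D (cur, don) m = (cur, don) := by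
        unfold piecesStep
        rw [if_pos]
        rw [List.mem_append, List.mem_flatten] at hused
        simp only [Bool.or_eq_true, mem_iff, List.any_eq_true]
        exact hused
      rw [e]
      refine ⟨h1, h2, fun v hv => ?_, h4, h5, h6⟩
      rcases Nat.lt_succ_iff_lt_or_eq.1 hv with h | rfl
      · exact h3 v h
      · exact hused
    · set C := component n T D m with hC
      have e : piecesStep s n T D (cur, don) m = if s ≤ (cur ++ C).length then
          ([], (cur ++ C) :: don) else (cur ++ C, don) := by
        unfold piecesStep
        rw [if_neg]
        · simp [hC]
        · simp only [Bool.or_eq_true, mem_iff, List.any_eq_true]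
          rw [List.mem_append, List.mem_flatten] at hused
          exact hused
      have hCcl : LinkClosed n T D fun u => u ∈ C := linkClosed_component hm'
      have hall : LinkClosed n T D fun u => u ∈ cur ++ don.flatten := by
        intro u w hl hu
        rw [List.mem_append, List.mem_flatten] at *
        rcases hu with hu | ⟨P, hP, hu⟩
        · exact Or.inl (h4 u w hl hu)
        · exact Or.inr ⟨P, hP, h5 P hP u w hl hu⟩
      have hdisj : ∀ u ∈ C, u ∉ cur ++ don.flatten := component_subset hm' hall.not hused
      have hCn : ∀ u ∈ C, u < n := lt_of_mem_iterate_grow hm' n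
      have hperm : (cur ++ C ++ don.flatten).Perm (C ++ (cur ++ don.flatten)) := by
        rw [← List.append_assoc]
        exact List.perm_append_comm.append_right _
      have g1 : (cur ++ C ++ don.flatten).Nodup := by
        rw [hperm.nodup_iff, List.nodup_append']
        exact ⟨nodup_iterate_grow m n, h1, hdisj⟩
      have g2 : ∀ u ∈ cur ++ C ++ don.flatten, u < n := fun u hu => by
        rw [hperm.mem_iff, List.mem_append] at hu
        exact hu.elim (hCn u) (h2 u)
      have g3 : ∀ v < m + 1, v ∈ cur ++ C ++ don.flatten := fun v hv => by
        rw [hperm.mem_iff, List.mem_append]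
        rcases Nat.lt_succ_iff_lt_or_eq.1 hv with h | rfl
        · exact Or.inr (h3 v h)
        · exact Or.inl (self_mem_component hm')
      have g4 : LinkClosed n T D fun u => u ∈ cur ++ C := by
        intro u w hl hu
        rw [List.mem_append] at *
        exact hu.imp (h4 u w hl) (hCcl u w hl)
      rw [e]
      split
      · rename_i hs
        simp only [List.nil_append, List.flatten_cons]
        refine ⟨g1, g2, g3, fun u w _ h => by simp at h, ?_, fun h => ⟨h.1, ?_⟩⟩
        · simp only [List.mem_cons, forall_eq_or_imp]
          exact ⟨g4, h5⟩
        · have a := h6 h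
          have b : C.length ≤ s := h.2 m hm'
          simp only [List.mem_cons, forall_eq_or_imp]
          refine ⟨⟨hs, ?_⟩, a.2⟩
          rw [List.length_append]; omega
      · rename_i hs
        exact ⟨g1, g2, g3, g4, h5, fun h => ⟨not_le.1 hs, (h6 h).2⟩⟩

/-- The pieces partition the nodes. -/
theorem pieces_flatten_perm (s n : ℕ) (T : Mat) (D : List ℕ) :
    (pieces s n T D).flatten.Perm (List.range n) := by
  obtain ⟨h1, h2, h3, -⟩ := pieces_fold (T := T) (D := D) s n le_rfl _ rfl
  unfold pieces
  rw [List.flatten_cons, List.perm_ext_iff_of_nodup h1 List.nodup_range]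
  exact fun u => ⟨fun h => List.mem_range.2 (h2 u h), fun h => h3 u (List.mem_range.1 h)⟩

/-- Edges that avoid `D` do not leave a piece. -/
theorem linkClosed_of_mem_pieces {s : ℕ} {P : List ℕ} (hP : P ∈ pieces s n T D) :
    LinkClosed n T D fun u => u ∈ P := by
  obtain ⟨-, -, -, h4, h5, -⟩ := pieces_fold (T := T) (D := D) s n le_rfl _ rfl
  rcases List.mem_cons.1 hP with rfl | h
  · exact h4
  · exact h5 P h

theorem length_le_of_mem_pieces {s : ℕ} (hs : 0 < s)
    (hc : ∀ v < n, (component n T D v).length ≤ s) {P : List ℕ} (hP : P ∈ pieces s n T D) :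
    P.length ≤ 2 * s := by
  obtain ⟨-, -, -, -, -, h6⟩ := pieces_fold (T := T) (D := D) s n le_rfl _ rfl
  obtain ⟨h1, h2⟩ := h6 ⟨hs, hc⟩
  rcases List.mem_cons.1 hP with rfl | h
  · omega
  · exact (h2 P h).2

/-- All pieces except the one that is still open at the end have at least `s` nodes, whence the `-
1`. -/
theorem length_pieces_le {s : ℕ} (hs : 0 < s) (hc : ∀ v < n, (component n T D v).length ≤ s) :
    s * ((pieces s n T D).length - 1) ≤ n := by
  obtain ⟨-, -, -, -, -, h6⟩ := pieces_fold (T := T) (D := D) s n le_rfl _ rfl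
  obtain ⟨h1, h2⟩ := h6 ⟨hs, hc⟩
  have h3 := (pieces_flatten_perm s n T D).length_eq
  rw [List.length_range] at h3
  unfold pieces at *
  rw [List.flatten_cons, List.length_append] at h3
  have : ∀ l : List (List ℕ), (∀ P ∈ l, s ≤ P.length) → s * l.length ≤ l.flatten.length := by
    intro l
    induction l with
    | nil => simp
    | cons P l ih =>
      intro h
      have a := h P (by simp)
      have b := ih fun Q hQ => h Q (by simp [hQ])
      rw [List.flatten_cons, List.length_append, List.length_cons, mul_add]
      omega
  have := this _ fun P hP => (h2 P hP).1
  rw [List.length_cons, Nat.add_sub_cancel]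
  omega

end

/-! ### Soundness -/

open Classical in
/-- The adjacency matrix. -/
noncomputable def matrixOf {n : ℕ} (G : Digraph (Fin n)) : Mat :=
  List.ofFn fun u => List.ofFn fun v => decide (G.Adj u v)

/-- The input of the reduction. -/
noncomputable def inputOf (x : TreeInstance) : Input := (x.n, matrixOf x.G, matrixOf x.T)

theorem enc_ofBits (l : List Bool) : enc l = Data.ofBits l := rfl

theorem enc_matrixOf {n : ℕ} (G : Digraph (Fin n)) : enc (matrixOf G) = encodeDigraph G := by
  simp only [enc, matrixOf, encodeDigraph, List.map_ofFn]
  rfl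

theorem enc_inputOf (x : TreeInstance) : enc (inputOf x) = x.encode := by
  rw [inputOf, enc_pair, enc_pair, enc_matrixOf, enc_matrixOf]
  rfl

theorem entry_matrixOf {n : ℕ} (G : Digraph (Fin n)) (u v : ℕ) :
    entry (matrixOf G) u v = true ↔ ∃ (hu : u < n) (hv : v < n), G.Adj ⟨u, hu⟩ ⟨v, hv⟩ := by
  unfold entry matrixOf
  by_cases hu : u < n
  · by_cases hv : v < n
    · simp [hu, hv]
    · simp [hu, hv]
  · simp [hu]

/-- Embeddings are given by surjective edge-preserving maps on the numbers of the nodes. -/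
theorem isYes_of_surjective (x : TreeInstance) (h : ℕ → ℕ) (hlt : ∀ u < x.n, h u < x.n)
    (hom : ∀ u < x.n, ∀ w < x.n, entry (matrixOf x.T) u w = true →
      entry (matrixOf x.G) (h u) (h w) = true) (hsurj : ∀ y < x.n, ∃ u < x.n, h u = y) :
    x.IsYes := by
  let φ : Fin x.n → Fin x.n := fun u => ⟨h u, hlt u u.2⟩
  have hφ : Function.Surjective φ := fun y => by
    obtain ⟨u, hu, e⟩ := hsurj y y.2
    exact ⟨⟨u, hu⟩, Fin.ext e⟩
  refine ⟨⟨φ, Finite.injective_iff_surjective.2 hφ⟩, fun u v huv => ?_⟩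
  obtain ⟨_, _, h3⟩ := (entry_matrixOf _ _ _).1
    (hom u u.2 v v.2 ((entry_matrixOf _ _ _).2 ⟨u.2, v.2, huv⟩))
  exact h3

theorem valid_iff {G T : Mat} {A : List (ℕ × ℕ)} : valid G T A = true ↔
    ∀ p ∈ A, ∀ q ∈ A, (p.1 = q.1 → p.2 = q.2) ∧
      (entry T p.1 q.1 = true → entry G p.2 q.2 = true) := by
  simp only [valid, List.all_eq_true, Bool.and_eq_true, Bool.or_eq_true, Bool.not_eq_true',
    decide_eq_true_eq, decide_eq_false_iff_not, ← imp_iff_not_or]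
  refine forall₄_congr fun p _ q _ => and_congr_right fun _ => ?_
  rw [← Bool.not_eq_true, ← imp_iff_not_or]

theorem mem_pairs {n : ℕ} {p : ℕ × ℕ} : p ∈ pairs n ↔ p.1 < n ∧ p.2 < n := by
  obtain ⟨u, x⟩ := p
  simp only [pairs, List.mem_flatMap, List.mem_range, List.mem_map, Prod.mk.injEq]
  constructor
  · rintro ⟨a, ha, b, hb, rfl, rfl⟩; exact ⟨ha, hb⟩
  · rintro ⟨ha, hb⟩; exact ⟨u, ha, x, hb, rfl, rfl⟩

theorem isYes_of_isEmbedding (x : TreeInstance) {g : List (ℕ × ℕ)} (hg : ∀ p ∈ g, p ∈ pairs x.n)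
    (h : isEmbedding (inputOf x) g = true) : x.IsYes := by
  simp only [isEmbedding, inputOf, Bool.and_eq_true, valid_iff, List.all_eq_true, List.mem_range,
    mem_iff, List.mem_map] at h
  obtain ⟨h1, h2⟩ := h
  have h3 : ∀ u < x.n, ∃ y, (u, y) ∈ g := fun u hu => by
    obtain ⟨⟨⟨a, y⟩, hp, rfl⟩, -⟩ := h2 u hu
    exact ⟨y, hp⟩
  choose! f hf using h3
  refine isYes_of_surjective x f (fun u hu => (mem_pairs.1 (hg _ (hf u hu))).2)
    (fun u hu w hw he => (h1 _ (hf u hu) _ (hf w hw)).2 he) fun y hy => ?_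
  obtain ⟨-, ⟨u, z⟩, hp, rfl⟩ := h2 y hy
  have hu := (mem_pairs.1 (hg _ hp)).1
  exact ⟨u, hu, (h1 _ (hf u hu) _ hp).1 rfl⟩

theorem mem_zip_range {α : Type} {l : List α} {p : α × ℕ} :
    p ∈ l.zip (List.range l.length) ↔ l[p.2]? = some p.1 := by
  obtain ⟨a, i⟩ := p
  rw [List.range_eq_range', ← List.zipIdx_eq_zip_range', List.mem_zipIdx_iff_getElem?]

theorem mem_coverInstance {s : ℕ} {x : Input} {maps : List (List ℕ)} {g : List (ℕ × ℕ)}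
    {v : List Bool} : v ∈ (coverInstance s x maps g).2 ↔ ∃ (i : ℕ) (P f : List ℕ),
      (guessPieces s x g)[i]? = some P ∧ f ∈ maps ∧ P.length ≤ f.length ∧
      valid x.2.1 x.2.2 (extend P f g) = true ∧
      v = charVec x.1 (guessPieces s x g).length ((P.zip f).map fun p => p.2) i := by
  simp only [coverInstance, List.mem_flatMap, mem_zip_range, pieceSets]
  constructor
  · rintro ⟨⟨P, i⟩, h1, f, h2, h3⟩
    split at h3
    · rename_i h4
      simp only [Bool.and_eq_true, decide_eq_true_eq] at h4
      exact ⟨i, P, f, h1, h2, h4.1, h4.2, by simpa using h3⟩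
    · simp at h3
  · rintro ⟨i, P, f, h1, h2, h3, h4, rfl⟩
    exact ⟨(P, i), h1, f, h2, by simp [h3, h4]⟩

theorem length_charVec (n k : ℕ) (im : List ℕ) (i : ℕ) : (charVec n k im i).length = n + k := by
  simp [charVec]

theorem getD_charVec_left {n k : ℕ} {im : List ℕ} {i j : ℕ} (hj : j < n) :
    (charVec n k im i).getD j false = true ↔ j ∈ im := by
  rw [charVec, List.getD_append _ _ _ _ (by simpa using hj)]
  simp [hj, mem_iff]

theorem getD_charVec_right {n k : ℕ} {im : List ℕ} {i j : ℕ} (hj : j < k) :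
    (charVec n k im i).getD (n + j) false = true ↔ j = i := by
  rw [charVec, List.getD_append_right _ _ _ _ (by simp)]
  simp [hj]

theorem exists_mem_zip_of_mem_left {P f : List ℕ} (h : P.length ≤ f.length) {u : ℕ} (hu : u ∈ P) :
    ∃ y, (u, y) ∈ P.zip f := by
  have : (P.zip f).map Prod.fst = P := List.map_fst_zip h
  rw [← this, List.mem_map] at hu
  obtain ⟨⟨a, y⟩, h1, rfl⟩ := hu
  exact ⟨y, h1⟩

/-- Soundness for an arbitrary guess and an arbitrary selection. The unique selected set with the
marker of piece `i` supplies a map on that piece. The combined map respects the edges by validity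
and is onto because the images cover the nodes of `G`. -/
theorem isYes_of_exactCover (x : TreeInstance) {s : ℕ} {maps : List (List ℕ)} {g : List (ℕ × ℕ)}
    {sel : List Bool} (hmaps : ∀ f ∈ maps, ∀ y ∈ f, y < x.n)
    (h : exactCover (coverInstance s (inputOf x) maps g) sel = true) : x.IsYes := by
  set I := coverInstance s (inputOf x) maps g with hI
  set Ps := guessPieces s (inputOf x) g with hPs
  set D := g.map fun p => p.1 with hD
  have hPs' : Ps = pieces s x.n (matrixOf x.T) D := rfl
  have hI1 : I.1 = x.n + Ps.length := rfl
  have hone : ∀ j < x.n + Ps.length, ∃ v, ((v, true) ∈ I.2.zip sel ∧ v.getD j false = true) ∧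
      ∀ w, (w, true) ∈ I.2.zip sel → w.getD j false = true → w = v := by
    intro j hj
    simp only [exactCover, List.all_eq_true, List.mem_range, decide_eq_true_eq] at h
    obtain ⟨⟨v, b⟩, hv⟩ := List.length_eq_one_iff.1 (h j hj)
    have hmem : ∀ p : List Bool × Bool, (p ∈ I.2.zip sel ∧ (p.2 && p.1.getD j false) = true) ↔
        p = (v, b) := fun p => by
      have := List.mem_filter (x := p) (as := I.2.zip sel)
        (p := fun p : List Bool × Bool => p.2 && p.1.getD j false)
      rw [hv, List.mem_singleton] at this
      exact this.symm
    have h1 := (hmem (v, b)).2 rfl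
    rw [Bool.and_eq_true] at h1
    obtain ⟨h1, h2, h3⟩ := h1
    dsimp only at h2 h3
    subst h2
    exact ⟨v, ⟨h1, h3⟩, fun w h4 h5 => congrArg Prod.fst ((hmem (w, true)).1 ⟨h4, by simpa using h5⟩)⟩
  -- Uniqueness at the marker of piece `i` means that every selected set with this marker is the
  -- image of the same map `f`.
  have hpiece : ∀ i < Ps.length, ∃ f, f ∈ maps ∧ Ps[i]!.length ≤ f.length ∧
      valid (matrixOf x.G) (matrixOf x.T) (extend Ps[i]! f g) = true ∧
      ∀ w, (w, true) ∈ I.2.zip sel → w.getD (x.n + i) false = true →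
        w = charVec x.n Ps.length ((Ps[i]!.zip f).map fun p => p.2) i := by
    intro i hi
    obtain ⟨v, ⟨h1, h2⟩, h3⟩ := hone (x.n + i) (by omega)
    obtain ⟨i', P, f, h4, h5, h6, h7, rfl⟩ := mem_coverInstance.1 (List.of_mem_zip h1).1
    obtain rfl := (getD_charVec_right hi).1 h2
    have e : Ps[i]! = P := by
      rw [List.getElem!_eq_getElem?_getD]
      rw [hPs, h4]; rfl
    rw [e]
    exact ⟨f, h5, h6, h7, h3⟩
  choose! f hf1 hf2 hf3 hf4 using hpiece
  have hidx : ∀ u < x.n, ∃ i < Ps.length, u ∈ Ps[i]! := by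
    intro u hu
    have : u ∈ Ps.flatten := by
      rw [hPs', (pieces_flatten_perm _ _ _ _).mem_iff]; exact List.mem_range.2 hu
    obtain ⟨P, hP, huP⟩ := List.mem_flatten.1 this
    obtain ⟨i, hi, rfl⟩ := List.mem_iff_getElem.1 hP
    exact ⟨i, hi, by rwa [getElem!_pos Ps i hi]⟩
  choose! idx hidx1 hidx2 using hidx
  have hidx_uniq : ∀ u < x.n, ∀ i < Ps.length, u ∈ Ps[i]! → i = idx u := by
    intro u hu i hi hui
    have hnd : Ps.flatten.Nodup := by
      rw [hPs', (pieces_flatten_perm _ _ _ _).nodup_iff]; exact List.nodup_range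
    by_contra hne
    have h2 := List.pairwise_iff_getElem.1 (List.nodup_flatten.1 hnd).2
    have h3 := hidx1 u hu
    have h4 := hidx2 u hu
    rw [getElem!_pos Ps i hi] at hui
    rw [getElem!_pos Ps _ h3] at h4
    rcases Nat.lt_or_gt_of_ne hne with hlt | hlt
    · exact h2 _ _ hi h3 hlt hui h4
    · exact h2 _ _ h3 hi hlt h4 hui
  have hval : ∀ u < x.n, ∃ y, (u, y) ∈ Ps[idx u]!.zip (f (idx u)) := fun u hu =>
    exists_mem_zip_of_mem_left (hf2 _ (hidx1 u hu)) (hidx2 u hu)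
  choose! φ hφ using hval
  have hφe : ∀ u < x.n, (u, φ u) ∈ extend Ps[idx u]! (f (idx u)) g := fun u hu =>
    List.mem_append_left _ (hφ u hu)
  have hv := fun u (hu : u < x.n) => valid_iff.1 (hf3 (idx u) (hidx1 u hu))
  -- Validity makes the extension of the guess single-valued, so the combined map agrees with the
  -- guess on `D`.
  have hguess : ∀ u < x.n, u ∈ D → (u, φ u) ∈ g := by
    intro u hu huD
    obtain ⟨⟨a, y⟩, h1, rfl⟩ := List.mem_map.1 huD
    have := (hv a hu _ (hφe a hu) (a, y) (List.mem_append_right _ h1)).1 rfl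
    simp only at this
    rwa [this]
  refine isYes_of_surjective x φ (fun u hu => hmaps _ (hf1 _ (hidx1 u hu)) _
    (List.of_mem_zip (hφ u hu)).2) (fun u hu w hw he => ?_) fun y hy => ?_
  -- An edge with an end in `D` is checked together with the guess, in the piece of the other end.
  -- Any other edge stays inside a piece.
  · by_cases hwD : w ∈ D
    · exact (hv u hu _ (hφe u hu) _ (List.mem_append_right _ (hguess w hw hwD))).2 he
    · by_cases huD : u ∈ D
      · exact (hv w hw _ (List.mem_append_right _ (hguess u hu huD)) _ (hφe w hw)).2 he
      · have : w ∈ Ps[idx u]! := by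
          have h1 := hidx1 u hu
          have h2 := hidx2 u hu
          rw [getElem!_pos Ps _ h1] at h2 ⊢
          exact linkClosed_of_mem_pieces (s := s) (D := D) (List.getElem_mem (l := Ps) h1) u w
            ⟨hu, hw, huD, hwD, Or.inl he⟩ h2
        have e := hidx_uniq w hw _ (hidx1 u hu) this
        exact (hv u hu _ (hφe u hu) (w, φ w) (by rw [e]; exact hφe w hw)).2 he
  -- The selected set that contains `y` is the one for its marker, so `y` is in the image of the map
  -- chosen for that piece.
  · obtain ⟨v, ⟨h1, h2⟩, -⟩ := hone y (by omega)
    obtain ⟨i, P, f', h4, h5, h6, h7, rfl⟩ := mem_coverInstance.1 (List.of_mem_zip h1).1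
    have hi : i < Ps.length := (List.getElem?_eq_some_iff.1 h4).1
    have e := hf4 i hi _ h1 ((getD_charVec_right hi).2 rfl)
    rw [e, getD_charVec_left hy, List.mem_map] at h2
    obtain ⟨⟨u, z⟩, h8, rfl⟩ := h2
    have hui : u ∈ Ps[i]! := (List.of_mem_zip h8).1
    have hu : u < x.n := by
      have : u ∈ Ps.flatten := List.mem_flatten.2 ⟨_, by
        rw [getElem!_pos Ps i hi]; exact List.getElem_mem hi, hui⟩
      rw [hPs', (pieces_flatten_perm _ _ _ _).mem_iff] at this
      exact List.mem_range.1 this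
    obtain rfl := hidx_uniq u hu i hi hui
    exact ⟨u, hu, (hv u hu _ (hφe u hu) _ (List.mem_append_left _ h8)).1 rfl⟩

/-! ### Completeness -/

/-- Deleting the edges at `D` isolates the nodes of `D`, whose components are singletons. Any other
component lies in one class of the labelling, because labels are constant along edges that avoid
`B`. -/
theorem length_component_le {n : ℕ} {T : Digraph (Fin n)} (hT : ∀ u v, T.Adj u v → ¬ T.Adj v u)
    {B : Finset (Fin n)} {L : Fin n → Fin n} {s : ℕ} (hs : 0 < s)
    (hL : ∀ u w, (SimpleGraph.fromRel T.Adj).Adj u w → u ∉ B → w ∉ B → L u = L w)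
    (hc : ∀ l, {u : Fin n | u ∉ B ∧ L u = l}.ncard ≤ s) {D : List ℕ}
    (hD : ∀ u : Fin n, (u : ℕ) ∈ D ↔ u ∈ B) {v : ℕ} (hv : v < n) :
    (component n (matrixOf T) D v).length ≤ s := by
  classical
  have hnd : (component n (matrixOf T) D v).Nodup := nodup_iterate_grow v n
  rw [← List.toFinset_card_of_nodup hnd]
  by_cases hvD : v ∈ D
  · have h := component_subset (T := matrixOf T) (D := D) hv (S := fun u => u = v)
      (fun u w hl hu => absurd (hu ▸ hvD) hl.2.2.1) rfl
    refine le_trans (Finset.card_le_one_iff.2 ?_) hs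
    intro a b ha hb
    rw [h a (by simpa using ha), h b (by simpa using hb)]
  · have h := component_subset (T := matrixOf T) (D := D) hv
      (S := fun u => ∃ hu : u < n, (⟨u, hu⟩ : Fin n) ∉ B ∧ L ⟨u, hu⟩ = L ⟨v, hv⟩)
      (fun u w hl hu => by
        obtain ⟨h1, h2, h3, h4, h5⟩ := hl
        obtain ⟨_, a, b⟩ := hu
        have hw : (⟨w, h2⟩ : Fin n) ∉ B := fun h => h4 ((hD ⟨w, h2⟩).2 h)
        refine ⟨h2, hw, ?_⟩
        rw [← b]
        refine (hL _ _ ?_ a hw).symm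
        rw [SimpleGraph.fromRel_adj]
        have h6 : T.Adj ⟨u, h1⟩ ⟨w, h2⟩ ∨ T.Adj ⟨w, h2⟩ ⟨u, h1⟩ := by
          rcases h5 with h5 | h5
          · exact Or.inl ((entry_matrixOf _ _ _).1 h5).2.2
          · exact Or.inr ((entry_matrixOf _ _ _).1 h5).2.2
        refine ⟨fun e => ?_, h6⟩
        rw [e] at h6
        rcases h6 with h6 | h6 <;> exact hT _ _ h6 h6)
      ⟨hv, fun hB => hvD ((hD ⟨v, hv⟩).2 hB), rfl⟩
    refine le_trans ?_ (hc (L ⟨v, hv⟩))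
    rw [← Set.ncard_image_of_injective _ Fin.val_injective, ← Set.ncard_coe_finset]
    refine Set.ncard_le_ncard (fun u hu => ?_) (Set.toFinite _)
    obtain ⟨h1, h2, h3⟩ := h u (by simpa using hu)
    exact ⟨⟨u, h1⟩, ⟨h2, h3⟩, rfl⟩

/-- The Set Cover instance given by characteristic vectors. -/
abbrev listInstance (N : ℕ) (S : List (List Bool))
    (h : ∀ j < N, ∃ v ∈ S, v.getD j false = true) : SetCoverInstance where
  n := N
  m := S.length
  sets i := Finset.univ.filter fun j => S[i].getD j false = true
  covers j := by
    obtain ⟨v, hv, hj⟩ := h j j.2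
    obtain ⟨i, hi, rfl⟩ := List.mem_iff_getElem.1 hv
    exact ⟨⟨i, hi⟩, by simpa using hj⟩

theorem mem_sets_listInstance {N : ℕ} {S : List (List Bool)}
    {h : ∀ j < N, ∃ v ∈ S, v.getD j false = true} {i : Fin S.length} {j : Fin N} :
    j ∈ (listInstance N S h).sets i ↔ S[i].getD j false = true := by
  change j ∈ Finset.univ.filter (fun j : Fin N => S[i].getD j false = true) ↔ _
  rw [Finset.mem_filter]
  exact ⟨fun h => h.2, fun h => ⟨Finset.mem_univ _, h⟩⟩

theorem encode_listInstance {N : ℕ} {S : List (List Bool)}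
    (h : ∀ j < N, ∃ v ∈ S, v.getD j false = true) (hS : ∀ v ∈ S, v.length = N) :
    (listInstance N S h).encode = enc (N, S) := by
  rw [enc_pair]
  have e : (List.ofFn fun i : Fin (listInstance N S h).m => Data.ofBits
      (List.ofFn fun j : Fin (listInstance N S h).n => decide (j ∈ (listInstance N S h).sets i))) =
      S.map enc := by
    refine List.ext_getElem (by simp) fun i h1 h2 => ?_
    have h3 : i < S.length := by simpa using h2
    rw [List.getElem_ofFn, List.getElem_map, enc_ofBits]
    congr 1
    have hl := hS _ (List.getElem_mem h3)
    refine List.ext_getElem (by simp [hl]) fun j h4 h5 => ?_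
    rw [List.getElem_ofFn]
    rw [Bool.eq_iff_iff, decide_eq_true_iff]
    refine (mem_sets_listInstance (h := h) (i := ⟨i, h3⟩) (j := ⟨j, hl ▸ h5⟩)).trans ?_
    rw [Fin.getElem_fin, List.getD_eq_getElem _ _ h5]
  simp only [SetCoverInstance.encode]
  exact congrArg (Data.cons _) (congrArg Data.ofList e)

theorem length_filter_finRange {m : ℕ} (q : Fin m → Bool) :
    ((List.finRange m).filter q).length = (Finset.univ.filter fun i => q i = true).card := by
  rw [← List.toFinset_card_of_nodup ((List.nodup_finRange m).filter _)]
  congr 1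
  ext; simp

/-- The algorithm tests exactness by counting selected sets at each element; for a disjoint cover
the count is one. -/
theorem exactCover_of_isCover {N : ℕ} {S : List (List Bool)}
    {h : ∀ j < N, ∃ v ∈ S, v.getD j false = true} {I : Finset (Fin S.length)}
    (hI : (listInstance N S h).IsCover I) (hd : (listInstance N S h).IsDisjoint I) :
    exactCover (N, S) (List.ofFn fun i => decide (i ∈ I)) = true := by
  have e : S.zip (List.ofFn fun i => decide (i ∈ I)) =
      (List.finRange S.length).map fun i => (S[i], decide (i ∈ I)) := by
    refine List.ext_getElem (by simp) fun i h1 h2 => ?_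
    simp
  simp only [exactCover, List.all_eq_true, List.mem_range, decide_eq_true_eq, e]
  intro j hj
  rw [List.filter_map, List.length_map, length_filter_finRange, Finset.card_eq_one]
  obtain ⟨i, hi, hji⟩ := hI (⟨j, hj⟩ : Fin N)
  refine ⟨i, Finset.eq_singleton_iff_unique_mem.2 ⟨?_, fun i' hi' => ?_⟩⟩
  · replace hji := mem_sets_listInstance.1 hji
    simp only [Finset.mem_filter, Finset.mem_univ, true_and, Function.comp, Bool.and_eq_true,
      decide_eq_true_eq]
    exact ⟨hi, hji⟩
  · simp only [Finset.mem_filter, Finset.mem_univ, true_and, Function.comp, Bool.and_eq_true,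
      decide_eq_true_eq] at hi'
    by_contra hne
    exact Finset.disjoint_left.1 (hd i' hi'.1 i hi hne)
      (mem_sets_listInstance (h := h) (j := ⟨j, hj⟩) |>.2 hi'.2) hji

/-- Any overlap would make the union strictly smaller than the sum of the sizes. -/
theorem disjoint_of_sum_card_le {ι α : Type} [DecidableEq ι] [DecidableEq α] {I : Finset ι}
    {A : ι → Finset α} (h : ∑ i ∈ I, (A i).card ≤ (I.biUnion A).card) :
    ∀ i ∈ I, ∀ j ∈ I, i ≠ j → Disjoint (A i) (A j) := by
  intro i hi j hj hij
  have h1 : (I.biUnion A) = A i ∪ (I.erase i).biUnion A := by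
    rw [← Finset.biUnion_insert, Finset.insert_erase hi]
  have h2 := Finset.card_union_add_card_inter (A i) ((I.erase i).biUnion A)
  have h3 := Finset.card_biUnion_le (s := I.erase i) (t := A)
  have h4 := Finset.add_sum_erase I (fun i => (A i).card) hi
  rw [h1] at h
  have h5 : A i ∩ (I.erase i).biUnion A = ∅ := Finset.card_eq_zero.1 (by omega)
  refine (Finset.disjoint_iff_inter_eq_empty.2 h5).mono_right ?_
  exact Finset.subset_biUnion_of_mem A (Finset.mem_erase.2 ⟨hij.symm, hj⟩)

theorem getD_charVec_cases {n k j : ℕ} {im : List ℕ} {i : ℕ} (hj : j < n + k)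
    (h : (charVec n k im i).getD j false = true) : j ∈ im ∨ j = n + i := by
  rcases Nat.lt_or_ge j n with h1 | h1
  · exact Or.inl ((getD_charVec_left h1).1 h)
  · obtain ⟨d, rfl⟩ := Nat.exists_eq_add_of_le h1
    rw [getD_charVec_right (by omega)] at h
    exact Or.inr (by rw [h])

theorem valid_of_graph {n : ℕ} {G T : Digraph (Fin n)} {φ : Fin n → Fin n}
    (hφ : ∀ u v, T.Adj u v → G.Adj (φ u) (φ v)) {A : List (ℕ × ℕ)}
    (hA : ∀ p ∈ A, ∃ u : Fin n, p = ((u : ℕ), (φ u : ℕ))) :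
    valid (matrixOf G) (matrixOf T) A = true := by
  rw [valid_iff]
  intro p hp q hq
  obtain ⟨u, rfl⟩ := hA p hp
  obtain ⟨v, rfl⟩ := hA q hq
  refine ⟨fun e => ?_, fun h => ?_⟩
  · rw [Fin.ext e]
  · obtain ⟨_, _, h1⟩ := (entry_matrixOf _ _ _).1 h
    exact (entry_matrixOf _ _ _).2 ⟨(φ u).2, (φ v).2, hφ _ _ h1⟩

/-- For small `n` the guess lists an embedding of the whole tree, and no Set Cover instance is
needed. -/
theorem exists_guess_small (x : TreeInstance) (hx : x.IsYes) :
    ∃ g ∈ tuples (pairs x.n) x.n, isEmbedding (inputOf x) g = true := by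
  obtain ⟨φ, hφ⟩ := hx
  refine ⟨List.ofFn fun u : Fin x.n => ((u : ℕ), (φ u : ℕ)), mem_tuples.2 ⟨by simp, ?_⟩, ?_⟩
  · intro p hp
    obtain ⟨u, rfl⟩ := List.mem_ofFn.1 hp
    exact mem_pairs.2 ⟨u.2, (φ u).2⟩
  · simp only [isEmbedding, inputOf, Bool.and_eq_true, List.all_eq_true, List.mem_range, mem_iff,
      List.mem_map, List.mem_ofFn]
    refine ⟨valid_of_graph hφ fun p hp => ?_, fun u hu => ⟨⟨_, ⟨⟨u, hu⟩, rfl⟩, rfl⟩, ?_⟩⟩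
    · obtain ⟨u, rfl⟩ := List.mem_ofFn.1 hp
      exact ⟨u, rfl⟩
    · obtain ⟨v, hv⟩ := (Finite.injective_iff_surjective.1 φ.injective) ⟨u, hu⟩
      exact ⟨_, ⟨v, rfl⟩, by rw [hv]⟩

theorem zip_map_append {α β : Type} (f : α → β) (P : List α) (l : List β) :
    P.zip (P.map f ++ l) = P.map fun u => (u, f u) := by
  induction P with
  | nil => simp
  | cons a P ih => simp [ih]

theorem sum_length_getD {α : Type} (l : List (List α)) :
    ∑ i ∈ Finset.range l.length, (l.getD i []).length = l.flatten.length := by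
  induction l with
  | nil => simp
  | cons a l ih =>
    rw [List.length_cons, Finset.sum_range_succ', List.flatten_cons, List.length_append, ← ih,
      add_comm]
    simp

/-- In a yes-instance, some guess leads to a Set Cover instance whose optimal solutions are exact
covers by few sets. -/
theorem exists_guess (x : TreeInstance) (hx : x.IsYes) {s b : ℕ} (hs : 0 < s)
    (hb : x.n < b * (s + 1)) :
    ∃ g ∈ tuples (pairs x.n) b, ∃ (X : SetCoverInstance) (k : ℕ),
      X.encode = enc (coverInstance s (inputOf x) (tuples (List.range x.n) (2 * s)) g) ∧
      X.n = x.n + k ∧ s * (k - 1) ≤ x.n ∧ (∀ a, (X.sets a).card ≤ 2 * s + 1) ∧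
      X.m = (coverInstance s (inputOf x) (tuples (List.range x.n) (2 * s)) g).2.length ∧
      ∀ I, X.IsOptimal I → I.card ≤ k ∧ X.IsDisjoint I ∧
        exactCover (coverInstance s (inputOf x) (tuples (List.range x.n) (2 * s)) g)
          (List.ofFn fun a => decide (a ∈ I)) = true := by
  classical
  obtain ⟨φ, hφ⟩ := hx
  obtain ⟨B, L, hB, hL, hc⟩ := exists_separator x.isTree s
  rw [Fintype.card_fin] at hB
  obtain ⟨r⟩ := x.isTree.connected.nonempty
  have hBb : B.card < b := lt_of_mul_lt_mul_right (hB.trans_lt hb) (Nat.zero_le _)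
  -- Guesses are lists of length exactly `b`, so shorter ones are padded with the node `r`. Adding
  -- `r` to the separator makes the padding harmless, and the strict bound on `B.card` leaves room
  -- for it.
  set B' := insert r B with hB'
  have hB'b : B'.card ≤ b := (Finset.card_insert_le r B).trans hBb
  set g : List (ℕ × ℕ) := (B'.toList ++ List.replicate (b - B'.card) r).map
    fun u : Fin x.n => ((u : ℕ), (φ u : ℕ)) with hg
  set D := g.map fun p => p.1 with hD
  have hmemg : ∀ p ∈ g, ∃ u : Fin x.n, p = ((u : ℕ), (φ u : ℕ)) := fun p hp => by
    obtain ⟨u, -, rfl⟩ := List.mem_map.1 hp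
    exact ⟨u, rfl⟩
  have hDB : ∀ u : Fin x.n, (u : ℕ) ∈ D ↔ u ∈ B' := by
    intro u
    simp only [hD, hg, List.map_map, List.mem_map, List.mem_append, Finset.mem_toList,
      List.mem_replicate, Function.comp]
    constructor
    · rintro ⟨w, h1 | ⟨-, rfl⟩, h2⟩
      · rwa [← Fin.ext h2]
      · rw [← Fin.ext h2]; exact Finset.mem_insert_self _ _
    · exact fun h => ⟨u, Or.inl h, rfl⟩
  have hc' : ∀ l, {u : Fin x.n | u ∉ B' ∧ L u = l}.ncard ≤ s := fun l => by
    refine (Set.ncard_le_ncard (fun u hu => ?_) (Set.toFinite _)).trans (hc l)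
    exact ⟨fun h' => hu.1 (Finset.mem_insert_of_mem h'), hu.2⟩
  have hcomp : ∀ v < x.n, (component x.n (matrixOf x.T) D v).length ≤ s := fun v hv =>
    length_component_le x.oriented hs
      (fun u w h hu hw => hL u w h (fun h' => hu (Finset.mem_insert_of_mem h'))
        fun h' => hw (Finset.mem_insert_of_mem h'))
      hc'
      hDB hv
  set maps := tuples (List.range x.n) (2 * s) with hmaps
  set Ps := guessPieces s (inputOf x) g with hPs
  have hPs' : Ps = pieces s x.n (matrixOf x.T) D := rfl
  set k := Ps.length with hk
  set S := (coverInstance s (inputOf x) maps g).2 with hS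
  have hI : coverInstance s (inputOf x) maps g = (x.n + k, S) := rfl
  have hflat : ∀ u, u ∈ Ps.flatten ↔ u < x.n := fun u => by
    rw [hPs', (pieces_flatten_perm _ _ _ _).mem_iff, List.mem_range]
  have hPlen : ∀ P ∈ Ps, P.length ≤ 2 * s := fun P hP => length_le_of_mem_pieces hs hcomp (hPs' ▸ hP)
  let ψ : ℕ → ℕ := fun u => if h : u < x.n then φ ⟨u, h⟩ else 0
  have hψ : ∀ u (h : u < x.n), ψ u = φ ⟨u, h⟩ := fun u h => dif_pos h
  have hPlt : ∀ P ∈ Ps, ∀ u ∈ P, u < x.n := fun P hP u hu =>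
    (hflat u).1 (List.mem_flatten.2 ⟨P, hP, hu⟩)
  have hvec : ∀ i P, Ps[i]? = some P → charVec x.n k (P.map ψ) i ∈ S := by
    intro i P hi
    have hP := List.mem_of_getElem? hi
    -- All lists in `maps` have length `2 * s`. The images of the nodes of `P` are padded to this
    -- length; `zip` ignores the padding.
    refine mem_coverInstance.2 ⟨i, P, P.map ψ ++ List.replicate (2 * s - P.length) (r : ℕ), hi,
      mem_tuples.2 ⟨?_, ?_⟩, by simp, ?_, ?_⟩
    · have := hPlen P hP
      simp only [List.length_append, List.length_map, List.length_replicate]; omega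
    · intro y hy
      rw [List.mem_range]
      rcases List.mem_append.1 hy with hy | hy
      · obtain ⟨u, hu, rfl⟩ := List.mem_map.1 hy
        rw [hψ u (hPlt P hP u hu)]
        exact (φ _).2
      · rw [List.eq_of_mem_replicate hy]; exact r.2
    · refine valid_of_graph hφ fun p hp => ?_
      rw [extend, zip_map_append] at hp
      rcases List.mem_append.1 hp with hp | hp
      · obtain ⟨u, hu, rfl⟩ := List.mem_map.1 hp
        exact ⟨⟨u, hPlt P hP u hu⟩, by rw [hψ u (hPlt P hP u hu)]⟩
      · exact hmemg p hp
    · rw [zip_map_append, List.map_map]; rfl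
  have hcov' : ∀ j < x.n + k, ∃ i P, Ps[i]? = some P ∧
      (charVec x.n k (P.map ψ) i).getD j false = true := by
    intro j hj
    rcases Nat.lt_or_ge j x.n with h | h
    · obtain ⟨u, hu⟩ := (Finite.injective_iff_surjective.1 φ.injective) ⟨j, h⟩
      obtain ⟨P, hP, huP⟩ := List.mem_flatten.1 ((hflat u).2 u.2)
      obtain ⟨i, hi⟩ := List.mem_iff_getElem?.1 hP
      refine ⟨i, P, hi, (getD_charVec_left h).2 (List.mem_map.2 ⟨u, huP, ?_⟩)⟩
      rw [hψ u u.2, Fin.eta]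
      exact congrArg Fin.val hu
    · obtain ⟨i, rfl⟩ := Nat.exists_eq_add_of_le h
      exact ⟨i, Ps[i], List.getElem?_eq_getElem (by omega),
        (getD_charVec_right (by omega)).2 rfl⟩
  have hcov : ∀ j < x.n + k, ∃ v ∈ S, v.getD j false = true := fun j hj => by
    obtain ⟨i, P, h1, h2⟩ := hcov' j hj
    exact ⟨_, hvec i P h1, h2⟩
  have hform : ∀ a : Fin S.length, ∃ (i : ℕ) (im : List ℕ), i < k ∧
      im.length ≤ (Ps.getD i []).length ∧ S[a] = charVec x.n k im i := by
    intro a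
    obtain ⟨i, P, f, h1, -, -, -, h5⟩ := mem_coverInstance.1 (List.getElem_mem a.2)
    exact ⟨i, _, (List.getElem?_eq_some_iff.1 h1).1, by
      rw [List.getD_eq_getElem?_getD, h1]; simp, h5⟩
  choose ι im hι him hSa using hform
  have hcard : ∀ a : Fin S.length, ((listInstance (x.n + k) S hcov).sets a).card ≤
      (Ps.getD (ι a) []).length + 1 := by
    intro a
    have hsub : ((listInstance (x.n + k) S hcov).sets a).map Fin.valEmbedding ⊆
        insert (x.n + ι a) (im a).toFinset := by
      intro j hj
      obtain ⟨j', h1, rfl⟩ := Finset.mem_map.1 hj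
      replace h1 := mem_sets_listInstance.1 h1
      rw [hSa] at h1
      rw [Finset.mem_insert, List.mem_toFinset]
      exact (getD_charVec_cases j'.2 h1).symm
    have h1 := Finset.card_le_card hsub
    rw [Finset.card_map] at h1
    have h2 := Finset.card_insert_le (x.n + ι a) (im a).toFinset
    have h3 := List.toFinset_card_le (im a)
    have h4 := him a
    omega
  refine ⟨g, mem_tuples.2 ⟨?_, fun p hp => ?_⟩, listInstance (x.n + k) S hcov, k, ?_, rfl, ?_,
    fun a => ?_, rfl, fun I hIopt => ?_⟩
  · simp only [hg, List.length_map, List.length_append, Finset.length_toList, List.length_replicate]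
    omega
  · obtain ⟨u, rfl⟩ := hmemg p hp
    exact mem_pairs.2 ⟨u.2, (φ u).2⟩
  · rw [hI]
    refine encode_listInstance hcov fun v hv => ?_
    obtain ⟨i, P, f, -, -, -, -, rfl⟩ := mem_coverInstance.1 hv
    exact length_charVec _ _ _ _
  · exact length_pieces_le hs hcomp
  · refine (hcard a).trans (Nat.add_le_add_right ?_ 1)
    rw [List.getD_eq_getElem _ _ (hι a)]
    exact hPlen _ (List.getElem_mem _)
  · have hidx : ∀ i : Fin k, ∃ a : Fin S.length, S[a] = charVec x.n k (Ps[i].map ψ) i := by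
      intro i
      obtain ⟨a, ha, e⟩ := List.mem_iff_getElem.1 (hvec i Ps[i] (List.getElem?_eq_getElem i.2))
      exact ⟨⟨a, ha⟩, e⟩
    choose idx hidx using hidx
    -- The `k` sets given by the embedding form a cover, so an optimal solution has at most `k`
    -- sets.
    have hIk : I.card ≤ k := by
      refine (hIopt.2 (Finset.univ.image idx) fun j => ?_).trans
        (Finset.card_image_le.trans (by simp))
      obtain ⟨i, P, h1, h2⟩ := hcov' j j.2
      obtain ⟨h3, rfl⟩ := List.getElem?_eq_some_iff.1 h1
      refine ⟨idx ⟨i, h3⟩, Finset.mem_image_of_mem _ (Finset.mem_univ _),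
        mem_sets_listInstance.2 ?_⟩
      rw [hidx]
      exact h2
    -- Every marker must be covered, and only sets for its own piece contain it. Together with the
    -- bound `k`, this leaves exactly one set per piece.
    have hrange : Finset.range k ⊆ I.image ι := by
      intro i hi
      rw [Finset.mem_range] at hi
      obtain ⟨a, h1, h2⟩ := hIopt.1 (⟨x.n + i, by omega⟩ : Fin (x.n + k))
      replace h2 := mem_sets_listInstance.1 h2
      rw [hSa, getD_charVec_right hi] at h2
      exact Finset.mem_image.2 ⟨a, h1, h2.symm⟩
    have himage : I.image ι = Finset.range k := by
      refine (Finset.Subset.antisymm hrange fun i hi => ?_).symm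
      obtain ⟨a, -, rfl⟩ := Finset.mem_image.1 hi
      exact Finset.mem_range.2 (hι a)
    have hinj : Set.InjOn ι (I : Set (Fin S.length)) := by
      refine Finset.card_image_iff.1 (le_antisymm Finset.card_image_le ?_)
      rw [himage, Finset.card_range]
      exact hIk
    -- One set per piece: the pieces have `n` nodes in total, and each set has one marker. A cover
    -- of `n + k` elements within this total size is disjoint.
    have hsum : ∑ a ∈ I, ((listInstance (x.n + k) S hcov).sets a).card ≤ x.n + k := by
      calc ∑ a ∈ I, ((listInstance (x.n + k) S hcov).sets a).card
          ≤ ∑ a ∈ I, ((Ps.getD (ι a) []).length + 1) := Finset.sum_le_sum fun a _ => hcard a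
        _ = ∑ i ∈ I.image ι, ((Ps.getD i []).length + 1) :=
            (Finset.sum_image (f := fun i => (Ps.getD i []).length + 1) hinj).symm
        _ = x.n + k := by
            rw [himage, Finset.sum_add_distrib, sum_length_getD, hPs',
              (pieces_flatten_perm _ _ _ _).length_eq, List.length_range]
            simp
    have hdisj : (listInstance (x.n + k) S hcov).IsDisjoint I := by
      refine disjoint_of_sum_card_le (hsum.trans ?_)
      have : I.biUnion (listInstance (x.n + k) S hcov).sets = Finset.univ := by
        refine Finset.eq_univ_of_forall fun j => Finset.mem_biUnion.2 ?_
        obtain ⟨i, h1, h2⟩ := hIopt.1 j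
        exact ⟨i, h1, h2⟩
      rw [this, Finset.card_univ, Fintype.card_fin]
    refine ⟨hIk, hdisj, ?_⟩
    rw [hI]
    exact exactCover_of_isCover hIopt.1 hdisj

/-! ### The reduction as a program -/

/-- The coins `c` of the given run are continued by zeros. The run that `Halts` provides for this
sequence is the given one by uniqueness, so guarantees for some run hold for every run. -/
theorem Halts.of_exec_coins {p : Prog} {s s' : State} {c : List Bool} {t : ℕ}
    {R : State → ℕ → Prop} (h : Halts p s R) (he : Exec p s c s' t) : R s' t := by
  obtain ⟨k, s'', t', h1, h2⟩ := h fun i => c.getD i false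
  have hc : (List.range c.length).map (fun i => c.getD i false) = c := by
    refine List.ext_getElem (by simp) fun i h3 h4 => ?_
    simp [h4]
  have e1 := map_range_add (fun i => c.getD i false) c.length k
  have e2 := map_range_add (fun i => c.getD i false) k c.length
  rw [hc, add_comm, e2] at e1
  obtain ⟨-, rfl, rfl⟩ := h1.unique he e1
  exact h2

theorem prob_mono {p : Prog} {s : State} {Q Q' : State → Prop} (h : ∀ s', Q s' → Q' s') :
    prob p s Q ≤ prob p s Q' :=
  weight_mono fun _ ⟨s', t, h1, h2⟩ => ⟨s', t, h1, h s' h2⟩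

theorem Halts.prob_le {p : Prog} {s : State} {R : State → ℕ → Prop} {Q : State → Prop}
    (h : Halts p s R) : prob p s Q ≤ prob p s fun s' => Q s' ∧ ∃ t, R s' t :=
  weight_mono fun _ ⟨s', t, h1, h2⟩ => ⟨s', t, h1, h2, t, h.of_exec_coins h1⟩

theorem Exec.one_le_prob {p : Prog} {s s' : State} {t : ℕ} (h : Exec p s [] s' t)
    {Q : State → Prop} (hQ : Q s') : 1 ≤ prob p s Q :=
  Halts.one_le_prob (T := t) (R := fun s'' t' => s'' = s' ∧ t' = t) (.of_exec h ⟨rfl, rfl⟩)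
    (by rintro _ _ ⟨rfl, rfl⟩; exact ⟨le_rfl, hQ⟩)

theorem prob_le_seq_of_exec {p q : Prog} {s s' : State} {t : ℕ} (h : Exec p s [] s' t)
    {Q : State → Prop} : prob q s' Q ≤ prob (.seq p q) s Q := by
  have h1 := prob_mul_le_seq (p := p) (q := q) (s := s) (R := fun s'' => s'' = s') (Q := Q)
    (β := prob q s' Q) (by rintro _ rfl; exact le_rfl)
  refine le_trans ?_ h1
  have := mul_le_mul_left (h.one_le_prob (Q := fun s'' => s'' = s') rfl) (prob q s' Q)
  rwa [one_mul] at this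

/-- Sets the variables `M, …, M + V` to `nil`. -/
def resetVars (M : ℕ) : ℕ → Prog
  | 0 => .assign M .nil
  | V + 1 => .seq (resetVars M V) (.assign (M + (V + 1)) .nil)

theorem resetVars_deterministic (M : ℕ) : ∀ V, (resetVars M V).Deterministic
  | 0 => trivial
  | V + 1 => ⟨resetVars_deterministic M V, trivial⟩

theorem exec_resetVars (M V : ℕ) (s : State) : ∃ s', Exec (resetVars M V) s [] s' (2 * (V + 1)) ∧
    (∀ v ≤ V, s' (M + v) = Data.nil) ∧ ∀ v < M, s' v = s v := by
  induction V with
  | zero =>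
    refine ⟨_, .assign _ _ _, fun v hv => ?_, fun v hv => ?_⟩
    · obtain rfl : v = 0 := by omega
      simp [Expr.eval]
    · rw [Function.update_of_ne (by omega)]
  | succ V ih =>
    obtain ⟨s', h1, h2, h3⟩ := ih
    refine ⟨_, h1.seq_nil (.assign _ _ _), fun v hv => ?_, fun v hv => ?_⟩
    · by_cases h : v = V + 1
      · subst h; simp [Expr.eval]
      · rw [Function.update_of_ne (by omega), h2 v (by omega)]
    · rw [Function.update_of_ne (by omega), h3 v hv]

/-- The check that ends the treatment of a guess. -/
def accepts (c : (Input × List (List ℕ) × List (ℕ × ℕ)) × (ℕ × List (List Bool)) × List Bool) :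
    Bool :=
  exactCover c.2.1 c.2.2 || isEmbedding c.1.1 c.1.2.2

theorem PT_accepts : PT accepts := by unfold accepts; fun_prop

/-- The preparation of a call of the Set Cover algorithm. -/
def prepare (inst : Prog) (V : ℕ) : Prog :=
  -- Variables: `0` input, `1` list of maps, `2` time for the clock, `3` remaining guesses, `4` Set
  -- Cover instance, `5` clock and `6` its flag, `7` answer, `8` current guess, `9` to `11`
  -- arguments and results of the subroutines. From `12` on there is scratch space, which the Set
  -- Cover algorithm uses as its own memory.
  .seq (.assign 8 (.hd (.var 3))) (.seq (.assign 3 (.tl (.var 3)))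
    (.seq (.assign 9 (.cons (.var 0) (.cons (.var 1) (.var 8))))
      -- The reset comes after `inst`, whose scratch space overlaps the memory of the Set Cover
      -- algorithm.
      (.seq inst (.seq (resetVars 12 V) (.seq (.assign 12 (.var 4)) (.assign 5 (.var 2)))))))

/-- The check of the result of a call of the Set Cover algorithm. -/
def conclude (sel ok : Prog) : Prog :=
  .seq (.assign 10 (.cons (.tl (.var 4)) (.var 12))) (.seq sel
    (.seq (.assign 10 (.cons (.var 9) (.cons (.var 4) (.var 10)))) (.seq ok
      (.ite (.var 11) (.assign 7 (.cons .nil .nil)) (.assign 7 (.var 7))))))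

/-- A program that computes `f` from variable `i` to variable `o`, with scratch space from `b` on. -/
def ComputesAt {α β : Type} [Enc α] [Enc β] (p : Prog) (i o b : ℕ) (f : α → β) (T : α → ℕ) :
    Prop :=
  ∀ (s : State) (a : α), s i = enc a →
    ∃ (s' : State) (t : ℕ), Exec p s [] s' t ∧ t ≤ T a ∧ s' o = enc (f a) ∧
      ∀ v < b, v ≠ o → s' v = s v

theorem exec_prepare {inst : Prog} {s : ℕ → ℕ} {Ti : Input × List (List ℕ) × List (ℕ × ℕ) → ℕ}
    (hinst : ComputesAt inst 9 4 12 (fun c : Input × List (List ℕ) × List (ℕ × ℕ) =>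
      coverInstance (s c.1.1) c.1 c.2.1 c.2.2) Ti) (V : ℕ)
    {x : Input} {maps : List (List ℕ)} {g : List (ℕ × ℕ)} {gs : List (List (ℕ × ℕ))} {L : ℕ}
    {σ : State} (h0 : σ 0 = enc x) (h1 : σ 1 = enc maps) (h2 : σ 2 = enc L)
    (h3 : σ 3 = enc (g :: gs)) :
    ∃ σ' t, Exec (prepare inst V) σ [] σ' t ∧ t ≤ Ti (x, maps, g) + 2 * V + 20 ∧ σ' 0 = enc x ∧
      σ' 1 = enc maps ∧ σ' 2 = enc L ∧ σ' 3 = enc gs ∧ σ' 7 = σ 7 ∧ σ' 9 = enc (x, maps, g) ∧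
      σ' 4 = enc (coverInstance (s x.1) x maps g) ∧ σ' 5 = enc L ∧
      ∀ v < V, σ' (v + 12) = start (enc (coverInstance (s x.1) x maps g)) v := by
  have e1 := Exec.assign 8 (.hd (.var 3)) σ
  set σ₁ := Function.update σ 8 ((Expr.hd (.var 3)).eval σ) with hσ1
  have e2 := Exec.assign 3 (.tl (.var 3)) σ₁
  set σ₂ := Function.update σ₁ 3 ((Expr.tl (.var 3)).eval σ₁) with hσ2
  have e3 := Exec.assign 9 (.cons (.var 0) (.cons (.var 1) (.var 8))) σ₂
  set σ₃ := Function.update σ₂ 9 ((Expr.cons (.var 0) (.cons (.var 1) (.var 8))).eval σ₂) with hσ3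
  have h9 : σ₃ 9 = enc (x, maps, g) := by
    simp [hσ3, hσ2, hσ1, Expr.eval, h0, h1, h3, enc_pair, enc_cons, Data.hd]
  have h33 : σ₃ 3 = enc gs := by
    simp [hσ3, hσ2, hσ1, Expr.eval, h3, enc_cons, Data.tl]
  have hfr : ∀ v, v ≠ 8 → v ≠ 3 → v ≠ 9 → σ₃ v = σ v := fun v a b c => by
    simp [hσ3, hσ2, hσ1, a, b, c]
  obtain ⟨σ₄, t₄, e4, ht4, k1, k2⟩ := hinst σ₃ _ h9
  obtain ⟨σ₅, e5, l1, l2⟩ := exec_resetVars 12 V σ₄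
  have e6 := Exec.assign 12 (.var 4) σ₅
  set σ₆ := Function.update σ₅ 12 ((Expr.var 4).eval σ₅) with hσ6
  have e7 := Exec.assign 5 (.var 2) σ₆
  have h4' : σ₅ 4 = enc (coverInstance (s x.1) x maps g) := by rw [l2 4 (by omega), k1]
  have hfr' : ∀ v < 12, v ≠ 4 → v ≠ 5 → v ≠ 8 → v ≠ 3 → v ≠ 9 →
      Function.update σ₆ 5 ((Expr.var 2).eval σ₆) v = σ v := fun v a b c d e f => by
    rw [Function.update_of_ne c, hσ6, Function.update_of_ne (by omega), l2 v a, k2 v a b, hfr v d e f]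
  refine ⟨_, _, e1.seq_nil (e2.seq_nil (e3.seq_nil (e4.seq_nil (e5.seq_nil (e6.seq_nil e7))))),
    ?_, ?_, ?_, ?_, ?_, ?_, ?_, ?_, ?_, ?_⟩
  · simp only [Expr.cost]; omega
  · rw [hfr' 0 (by omega) (by omega) (by omega) (by omega) (by omega) (by omega), h0]
  · rw [hfr' 1 (by omega) (by omega) (by omega) (by omega) (by omega) (by omega), h1]
  · rw [hfr' 2 (by omega) (by omega) (by omega) (by omega) (by omega) (by omega), h2]
  · rw [Function.update_of_ne (by omega), hσ6, Function.update_of_ne (by omega), l2 3 (by omega),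
      k2 3 (by omega) (by omega), h33]
  · rw [hfr' 7 (by omega) (by omega) (by omega) (by omega) (by omega) (by omega)]
  · rw [Function.update_of_ne (by omega), hσ6, Function.update_of_ne (by omega), l2 9 (by omega),
      k2 9 (by omega) (by omega), h9]
  · rw [Function.update_of_ne (by omega), hσ6, Function.update_of_ne (by omega), h4']
  · rw [Function.update_self, Expr.eval, hσ6, Function.update_of_ne (by omega), l2 2 (by omega),
      k2 2 (by omega) (by omega), hfr 2 (by omega) (by omega) (by omega), h2]
  · intro v hv
    rw [Function.update_of_ne (by omega), hσ6]
    rcases Nat.eq_zero_or_pos v with rfl | hpos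
    · simp [start, Expr.eval, h4']
    · rw [Function.update_of_ne (by omega), add_comm, l1 v (by omega), start,
        Function.update_of_ne (by omega)]

theorem exec_conclude {sel ok : Prog} {Ts : List (List Bool) × Data → ℕ}
    {To : (Input × List (List ℕ) × List (ℕ × ℕ)) × (ℕ × List (List Bool)) × List Bool → ℕ}
    (hsel : ComputesAt sel 10 10 12 (fun c : List (List Bool) × Data => readBits c.1 c.2) Ts)
    (hok : ComputesAt ok 10 11 12 accepts To)
    {c : Input × List (List ℕ) × List (ℕ × ℕ)} {I : ℕ × List (List Bool)} {f : Bool} {σ : State}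
    (h4 : σ 4 = enc I) (h7 : σ 7 = enc f) (h9 : σ 9 = enc c) :
    ∃ σ' t, Exec (conclude sel ok) σ [] σ' t ∧
      t ≤ Ts (I.2, σ 12) + To (c, I, readBits I.2 (σ 12)) + 30 ∧
      σ' 7 = enc (f || accepts (c, I, readBits I.2 (σ 12))) ∧ ∀ v < 4, σ' v = σ v := by
  have e1 := Exec.assign 10 (.cons (.tl (.var 4)) (.var 12)) σ
  set σ₁ := Function.update σ 10 ((Expr.cons (.tl (.var 4)) (.var 12)).eval σ) with hσ1
  have h10 : σ₁ 10 = enc (I.2, σ 12) := by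
    obtain ⟨I1, I2⟩ := I
    simp [hσ1, Expr.eval, h4, enc_pair, Data.tl]; rfl
  obtain ⟨σ₂, t₂, e2, ht2, k1, k2⟩ := hsel σ₁ _ h10
  have e3 := Exec.assign 10 (.cons (.var 9) (.cons (.var 4) (.var 10))) σ₂
  set σ₃ := Function.update σ₂ 10 ((Expr.cons (.var 9) (.cons (.var 4) (.var 10))).eval σ₂)
    with hσ3
  have hfr : ∀ v < 12, v ≠ 10 → σ₃ v = σ v := fun v a b => by
    rw [hσ3, Function.update_of_ne b, k2 v a b, hσ1, Function.update_of_ne b]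
  have hfr2 : ∀ v < 12, v ≠ 10 → σ₂ v = σ v := fun v a b => by
    rw [k2 v a b, hσ1, Function.update_of_ne b]
  have h10' : σ₃ 10 = enc (c, I, readBits I.2 (σ 12)) := by
    rw [hσ3, Function.update_self]
    simp only [Expr.eval]
    rw [hfr2 9 (by omega) (by omega), hfr2 4 (by omega) (by omega), k1, h9, h4]
    rfl
  obtain ⟨σ₄, t₄, e4, ht4, l1, l2⟩ := hok σ₃ _ h10'
  have h7' : σ₄ 7 = enc f := by
    rw [l2 7 (by omega) (by omega), hfr 7 (by omega) (by omega), h7]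
  have hlow : ∀ v < 4, σ₄ v = σ v := fun v hv => by
    rw [l2 v (by omega) (by omega), hfr v (by omega) (by omega)]
  cases ha : accepts (c, I, readBits I.2 (σ 12)) with
  | true =>
    rw [ha] at l1
    have e5 : Exec (.ite (.var 11) (.assign 7 (.cons .nil .nil)) (.assign 7 (.var 7))) σ₄ [] _ _ :=
      .ite_true (by simp [Expr.eval, l1, enc_true]) (.assign _ _ _)
    refine ⟨_, _, e1.seq_nil (e2.seq_nil (e3.seq_nil (e4.seq_nil e5))), ?_, ?_, fun v hv => ?_⟩
    · simp only [Expr.cost]; omega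
    · simp [Expr.eval, enc_true]
    · rw [Function.update_of_ne (by omega), hlow v hv]
  | false =>
    rw [ha] at l1
    have e5 : Exec (.ite (.var 11) (.assign 7 (.cons .nil .nil)) (.assign 7 (.var 7))) σ₄ [] _ _ :=
      .ite_false (by simp [Expr.eval, l1, enc_false]) (.assign _ _ _)
    refine ⟨_, _, e1.seq_nil (e2.seq_nil (e3.seq_nil (e4.seq_nil e5))), ?_, ?_, fun v hv => ?_⟩
    · simp only [Expr.cost]; omega
    · simp [Expr.eval, h7']
    · rw [Function.update_of_ne (by omega), hlow v hv]

/-! ### The search over all guesses -/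

/-- The treatment of one guess. -/
def search (inst sel ok p : Prog) (V : ℕ) : Prog :=
  .seq (prepare inst V) (.seq (clocked 12 5 6 p) (conclude sel ok))

/-- The state of the search when the guesses `gs` are left. -/
structure Ready (x : Input) (maps : List (List ℕ)) (L : ℕ) (gs : List (List (ℕ × ℕ))) (f : Bool)
    (σ : State) : Prop where
  input : σ 0 = enc x
  maps : σ 1 = enc maps
  clock : σ 2 = enc L
  guesses : σ 3 = enc gs
  found : σ 7 = enc f

/-- The components of the search do what they should. -/
structure Components (inst sel ok p : Prog) (V κ : ℕ) (s : ℕ → ℕ)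
    (Ti : Input × List (List ℕ) × List (ℕ × ℕ) → ℕ) (Ts : List (List Bool) × Data → ℕ)
    (To : (Input × List (List ℕ) × List (ℕ × ℕ)) × (ℕ × List (List Bool)) × List Bool → ℕ) :
    Prop where
  inst : ComputesAt inst 9 4 12 (fun c : Input × List (List ℕ) × List (ℕ × ℕ) =>
    coverInstance (s c.1.1) c.1 c.2.1 c.2.2) Ti
  sel : ComputesAt sel 10 10 12 (fun c : List (List Bool) × Data => readBits c.1 c.2) Ts
  ok : ComputesAt ok 10 11 12 accepts To
  pos : 0 < V
  clocked : ∀ (σ : State) (L : ℕ), σ 5 = enc L → Halts (clocked 12 5 6 p) σ fun σ' t =>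
    t ≤ κ * (L + 1) ∧ ∀ v < 12, v ≠ 5 → v ≠ 6 → σ' v = σ v

section

variable {inst sel ok p : Prog} {V κ : ℕ} {s : ℕ → ℕ}
  {Ti : Input × List (List ℕ) × List (ℕ × ℕ) → ℕ} {Ts : List (List Bool) × Data → ℕ}
  {To : (Input × List (List ℕ) × List (ℕ × ℕ)) × (ℕ × List (List Bool)) × List Bool → ℕ}
  {x : Input} {maps : List (List ℕ)} {L : ℕ}

/-- `W` bounds the time for the deterministic steps in the treatment of the guess `g`. -/
def Within (s : ℕ → ℕ) (Ti : Input × List (List ℕ) × List (ℕ × ℕ) → ℕ)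
    (Ts : List (List Bool) × Data → ℕ)
    (To : (Input × List (List ℕ) × List (ℕ × ℕ)) × (ℕ × List (List Bool)) × List Bool → ℕ)
    (x : Input) (maps : List (List ℕ)) (W : ℕ) (g : List (ℕ × ℕ)) : Prop :=
  ∀ y : Data, Ti (x, maps, g) + Ts ((coverInstance (s x.1) x maps g).2, y) +
    To ((x, maps, g), coverInstance (s x.1) x maps g,
      readBits (coverInstance (s x.1) x maps g).2 y) ≤ W

/-- The selection `l` of sets shows that the guess `g` is correct. -/
def Shows (s : ℕ → ℕ) (x : Input) (maps : List (List ℕ)) (g : List (ℕ × ℕ)) (l : List Bool) :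
    Prop :=
  accepts ((x, maps, g), coverInstance (s x.1) x maps g, l) = true

theorem Components.halts_search (H : Components inst sel ok p V κ s Ti Ts To) {W : ℕ}
    {g : List (ℕ × ℕ)} (hW : Within s Ti Ts To x maps W g) {gs : List (List (ℕ × ℕ))} {f : Bool}
    {σ : State} (h : Ready x maps L (g :: gs) f σ) :
    Halts (search inst sel ok p V) σ fun σ' t => t ≤ W + κ * (L + 1) + 2 * V + 50 ∧
      ∃ f', Ready x maps L gs f' σ' ∧ (f = true → f' = true) ∧
        (f' = true → f = true ∨ ∃ l, Shows s x maps g l) := by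
  obtain ⟨σ₁, t₁, e1, ht1, a0, a1, a2, a3, a7, a9, a4, a5, -⟩ :=
    exec_prepare H.inst V h.input h.maps h.clock h.guesses
  refine Halts.seq (.of_exec e1 (R := fun s' t => s' = σ₁ ∧ t = t₁) ⟨rfl, rfl⟩) ?_
  rintro _ _ ⟨rfl, rfl⟩
  refine (H.clocked _ _ a5).seq ?_
  rintro σ₂ t₂ ⟨ht2, b⟩
  have b4 := (b 4 (by omega) (by omega) (by omega)).trans a4
  have b7 := (b 7 (by omega) (by omega) (by omega)).trans (a7.trans h.found)
  have b9 := (b 9 (by omega) (by omega) (by omega)).trans a9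
  obtain ⟨σ₃, t₃, e3, ht3, c7, c⟩ := exec_conclude H.sel H.ok b4 b7 b9
  refine .of_exec e3 ⟨?_, _, ⟨?_, ?_, ?_, ?_, c7⟩, fun hf => by simp [hf], fun hf => ?_⟩
  · have := hW (σ₂ 12)
    omega
  · rw [c 0 (by omega), b 0 (by omega) (by omega) (by omega), a0]
  · rw [c 1 (by omega), b 1 (by omega) (by omega) (by omega), a1]
  · rw [c 2 (by omega), b 2 (by omega) (by omega) (by omega), a2]
  · rw [c 3 (by omega), b 3 (by omega) (by omega) (by omega), a3]
  · rw [Bool.or_eq_true] at hf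
    exact hf.imp_right fun hf => ⟨_, hf⟩

theorem Components.halts_loop (H : Components inst sel ok p V κ s Ti Ts To) {W : ℕ} :
    ∀ {gs : List (List (ℕ × ℕ))}, (∀ g ∈ gs, Within s Ti Ts To x maps W g) → ∀ {f : Bool}
      {σ : State}, Ready x maps L gs f σ →
      Halts (.loop (.var 3) (search inst sel ok p V)) σ fun σ' t =>
        t ≤ gs.length * (W + κ * (L + 1) + 2 * V + 52) + 2 ∧
        ∃ f', σ' 7 = enc f' ∧ (f = true → f' = true) ∧
          (f' = true → f = true ∨ ∃ g ∈ gs, ∃ l, Shows s x maps g l)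
  | [], _, f, σ, h => .of_exec (.loop_false h.guesses)
      ⟨by simp [Expr.cost], f, h.found, fun hf => hf, .inl⟩
  | g :: gs, hW, f, σ, h => by
    refine Halts.loop (by simp [Expr.eval, h.guesses, enc_cons])
      (H.halts_search (hW g (by simp)) h) ?_
    rintro σ₁ t₁ ⟨ht1, f₁, h1, m1, n1⟩
    refine (H.halts_loop (fun g hg => hW g (by simp [hg])) h1).mono ?_
    rintro σ₂ t₂ ⟨ht2, f₂, h2, m2, n2⟩
    refine ⟨?_, f₂, h2, fun hf => m2 (m1 hf), fun hf => ?_⟩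
    · rw [List.length_cons, add_mul]
      simp only [Expr.cost]
      omega
    · rcases n2 hf with hf | ⟨g', hg', l, hl⟩
      · rcases n1 hf with hf | ⟨l, hl⟩
        · exact .inl hf
        · exact .inr ⟨g, by simp, l, hl⟩
      · exact .inr ⟨g', by simp [hg'], l, hl⟩

/-- With the guess `g`, the clocked Set Cover algorithm is likely to succeed. -/
def Good (p : Prog) (V : ℕ) (s : ℕ → ℕ) (x : Input) (maps : List (List ℕ)) (L : ℕ)
    (g : List (ℕ × ℕ)) : Prop :=
  ∀ σ : State, σ 5 = enc L → (∀ v < V, σ (v + 12) = start (enc (coverInstance (s x.1) x maps g)) v) →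
    2 / 3 ≤ prob (clocked 12 5 6 p) σ fun σ' =>
      Shows s x maps g (readBits (coverInstance (s x.1) x maps g).2 (σ' 12))

theorem Components.prob_search (H : Components inst sel ok p V κ s Ti Ts To)
    {g : List (ℕ × ℕ)} (hg : Good p V s x maps L g) {gs : List (List (ℕ × ℕ))} {f : Bool}
    {σ : State} (h : Ready x maps L (g :: gs) f σ) :
    2 / 3 ≤ prob (search inst sel ok p V) σ (Ready x maps L gs true) := by
  obtain ⟨σ₁, t₁, e1, ht1, a0, a1, a2, a3, a7, a9, a4, a5, a12⟩ :=
    exec_prepare H.inst V h.input h.maps h.clock h.guesses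
  refine le_trans ?_ (prob_le_seq_of_exec e1)
  refine (((hg σ₁ a5 a12).trans (H.clocked _ _ a5).prob_le).trans (mul_one _).ge).trans
    (prob_mul_le_seq ?_)
  rintro σ₂ ⟨hs, t₂, ht2, b⟩
  have b4 := (b 4 (by omega) (by omega) (by omega)).trans a4
  have b7 := (b 7 (by omega) (by omega) (by omega)).trans (a7.trans h.found)
  have b9 := (b 9 (by omega) (by omega) (by omega)).trans a9
  obtain ⟨σ₃, t₃, e3, ht3, c7, c⟩ := exec_conclude H.sel H.ok b4 b7 b9
  refine e3.one_le_prob ⟨?_, ?_, ?_, ?_, ?_⟩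
  · rw [c 0 (by omega), b 0 (by omega) (by omega) (by omega), a0]
  · rw [c 1 (by omega), b 1 (by omega) (by omega) (by omega), a1]
  · rw [c 2 (by omega), b 2 (by omega) (by omega) (by omega), a2]
  · rw [c 3 (by omega), b 3 (by omega) (by omega) (by omega), a3]
  · rw [Shows] at hs
    rw [c7, hs, Bool.or_true]

/-- The rounds before the first good guess halt for all coins, the round of that guess sets the flag
with probability at least `2/3`, and later rounds never clear it. As false positives are impossible,
no amplification is needed. -/
theorem Components.prob_loop (H : Components inst sel ok p V κ s Ti Ts To) {W : ℕ} :
    ∀ {gs : List (List (ℕ × ℕ))}, (∀ g ∈ gs, Within s Ti Ts To x maps W g) →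
      (∃ g ∈ gs, Good p V s x maps L g) → ∀ {f : Bool} {σ : State}, Ready x maps L gs f σ →
      2 / 3 ≤ prob (.loop (.var 3) (search inst sel ok p V)) σ fun σ' => σ' 7 = enc true
  | [], _, hg, f, σ, h => by simp at hg
  | g :: gs, hW, hg, f, σ, h => by
    have he : (Expr.var 3).eval σ ≠ Data.nil := by simp [Expr.eval, h.guesses, enc_cons]
    have hW' : ∀ g ∈ gs, Within s Ti Ts To x maps W g := fun g hg => hW g (by simp [hg])
    by_cases hgood : Good p V s x maps L g
    · refine ((H.prob_search hgood h).trans (mul_one _).ge).trans (prob_mul_le_loop he ?_)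
      intro σ₁ h1
      refine (H.halts_loop hW' h1).one_le_prob
        (T := gs.length * (W + κ * (L + 1) + 2 * V + 52) + 2) ?_
      rintro σ₂ t₂ ⟨ht2, f₂, h2, m2, -⟩
      exact ⟨ht2, by rw [h2, m2 rfl]⟩
    · have h1 : 1 ≤ prob (search inst sel ok p V) σ fun σ' => ∃ f', Ready x maps L gs f' σ' := by
        refine (H.halts_search (hW g (by simp)) h).one_le_prob
          (T := W + κ * (L + 1) + 2 * V + 50) ?_
        rintro σ₁ t₁ ⟨ht1, f₁, h1, -⟩
        exact ⟨ht1, f₁, h1⟩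
      have h2 := prob_mul_le_loop (R := fun σ' => ∃ f', Ready x maps L gs f' σ') (β := 2 / 3)
        (Q := fun σ' => σ' 7 = enc true) he (by
          rintro σ₁ ⟨f₁, h1⟩
          refine H.prob_loop hW' ?_ h1
          obtain ⟨g', hg', hgd⟩ := hg
          rcases List.mem_cons.1 hg' with rfl | hg'
          · exact absurd hgd hgood
          · exact ⟨g', hg', hgd⟩)
      refine le_trans ?_ h2
      have := mul_le_mul_left h1 (2 / 3 : ENNReal)
      rwa [one_mul] at this

/-- The whole search, after the initialisation `init`. -/
def decideBy (init inst sel ok p : Prog) (V : ℕ) : Prog :=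
  .seq init (.seq (.loop (.var 3) (search inst sel ok p V)) (.assign 0 (.var 7)))

theorem Components.halts_decideBy (H : Components inst sel ok p V κ s Ti Ts To) {init : Prog}
    {W t₀ : ℕ} {gs : List (List (ℕ × ℕ))} (hW : ∀ g ∈ gs, Within s Ti Ts To x maps W g)
    {σ₀ σ : State} (h₀ : Exec init σ₀ [] σ t₀) (h : Ready x maps L gs false σ) :
    Halts (decideBy init inst sel ok p V) σ₀ fun σ' t =>
      t ≤ t₀ + gs.length * (W + κ * (L + 1) + 2 * V + 52) + 4 ∧
      ∃ f', σ' 0 = enc f' ∧ (f' = true → ∃ g ∈ gs, ∃ l, Shows s x maps g l) := by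
  refine Halts.seq (.of_exec h₀ (R := fun s' t => s' = σ ∧ t = t₀) ⟨rfl, rfl⟩) ?_
  rintro _ _ ⟨rfl, rfl⟩
  refine (H.halts_loop hW h).seq ?_
  rintro σ₁ t₁ ⟨ht1, f', h1, -, n1⟩
  refine .of_exec (.assign _ _ _) ⟨?_, f', by simp [Expr.eval, h1], fun hf => ?_⟩
  · simp only [Expr.cost]; omega
  · simpa using n1 hf

theorem Components.prob_decideBy (H : Components inst sel ok p V κ s Ti Ts To) {init : Prog}
    {W t₀ : ℕ} {gs : List (List (ℕ × ℕ))} (hW : ∀ g ∈ gs, Within s Ti Ts To x maps W g)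
    {σ₀ σ : State} (h₀ : Exec init σ₀ [] σ t₀) (h : Ready x maps L gs false σ)
    (hg : ∃ g ∈ gs, Good p V s x maps L g) :
    2 / 3 ≤ prob (decideBy init inst sel ok p V) σ₀ fun σ' => σ' 0 = enc true := by
  refine le_trans ?_ (prob_le_seq_of_exec h₀)
  refine ((H.prob_loop hW hg h).trans (mul_one _).ge).trans (prob_mul_le_seq ?_)
  intro σ₁ h1
  exact (Exec.assign 0 (.var 7) σ₁).one_le_prob (by simp [Expr.eval, h1])

end

/-! ### Deterministic and randomized algorithms in common terms -/

/-- The algorithm `p` solves `P` in time `A * |x| ^ k * 2 ^ (a * n)`. -/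
def Problem.SolvedBy (P : Problem) (p : Prog) (a : ℝ) (A k : ℕ) : Prop :=
  ∀ x : P.Inst, HaltsWithin p (P.encode x) (P.timeBound a A k x) ∧
    2 / 3 ≤ outputProb p (P.encode x) (P.IsAnswer x)

theorem two_thirds_le_one : (2 / 3 : ENNReal) ≤ 1 := by
  rw [ENNReal.div_le_iff (by norm_num) (by norm_num)]; norm_num

theorem Problem.SolvableInTime.exists_solvedBy {P : Problem} {a : ℝ} (h : P.SolvableInTime a) :
    ∃ p : Prog, p.Deterministic ∧ ∃ A k, P.SolvedBy p a A k := by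
  obtain ⟨p, hp, A, k, h⟩ := h
  refine ⟨p, hp, A, k, fun x => ?_⟩
  obtain ⟨s', t, h1, h2, h3⟩ := h x
  refine ⟨fun ω => ⟨0, s', t, h1, h2⟩, ?_⟩
  rw [outputProb_eq_prob]
  exact two_thirds_le_one.trans (h1.one_le_prob h3)

/-- Without coins there is only one run, so an incorrect output would make the success probability
`0`. -/
theorem Problem.SolvedBy.solvableInTime {P : Problem} {a : ℝ} {p : Prog} {A k : ℕ}
    (h : P.SolvedBy p a A k) (hp : p.Deterministic) : P.SolvableInTime a := by
  refine ⟨p, hp, A, k, fun x => ?_⟩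
  obtain ⟨h1, h2⟩ := h x
  obtain ⟨k, s', t, h3, h4⟩ := h1 fun _ => false
  rw [h3.coins_eq_nil hp] at h3
  refine ⟨s', t, h3, h4, ?_⟩
  by_contra hne
  rw [outputProb_eq_prob] at h2
  have h5 : haltingCoins p (start (P.encode x)) (fun s => P.IsAnswer x (s 0)) ⊆ ∅ := by
    rintro c ⟨s'', t', h6, h7⟩
    obtain ⟨-, rfl, -⟩ := h3.unique (x := c) (y := []) h6 (by simp)
    exact hne h7
  have h6 : prob p (start (P.encode x)) (fun s => P.IsAnswer x (s 0)) = 0 := by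
    rw [prob, Set.subset_empty_iff.1 h5, weight, tsum_empty]
  rw [h6] at h2
  simp at h2

theorem Problem.SolvedBy.randSolvableInTime {P : Problem} {a : ℝ} {p : Prog} {A k : ℕ}
    (h : P.SolvedBy p a A k) : P.RandSolvableInTime a := ⟨p, A, k, h⟩

/-! ### Good guesses -/

/-- Such a guess is accepted regardless of what the Set Cover algorithm returns; the clock ensures
that it returns. -/
theorem good_of_isEmbedding {inst sel ok p : Prog} {V κ : ℕ} {s : ℕ → ℕ}
    {Ti : Input × List (List ℕ) × List (ℕ × ℕ) → ℕ} {Ts : List (List Bool) × Data → ℕ}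
    {To : (Input × List (List ℕ) × List (ℕ × ℕ)) × (ℕ × List (List Bool)) × List Bool → ℕ}
    (H : Components inst sel ok p V κ s Ti Ts To) {x : Input} {maps : List (List ℕ)} {L : ℕ}
    {g : List (ℕ × ℕ)} (hg : isEmbedding x g = true) : Good p V s x maps L g := by
  intro σ h5 _
  refine two_thirds_le_one.trans ((H.clocked σ L h5).one_le_prob (T := κ * (L + 1)) ?_)
  rintro σ' t ⟨ht, -⟩
  refine ⟨ht, ?_⟩
  unfold Shows accepts
  rw [Bool.or_eq_true]
  exact .inr hg

/-- All runs stay within the clock, so each successful coin string of `p` is also one of the clocked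
program, with the same output. Every optimal solution passes the check. -/
theorem good_of_solvedBy {p : Prog} {V : ℕ} (hV : 0 < V) (hp : p.Below V) {s : ℕ → ℕ} {x : Input}
    {maps : List (List ℕ)} {L : ℕ} {g : List (ℕ × ℕ)} {X : SetCoverInstance}
    (hX : X.encode = enc (coverInstance (s x.1) x maps g))
    (hm : X.m = (coverInstance (s x.1) x maps g).2.length)
    (hopt : ∀ I, X.IsOptimal I → exactCover (coverInstance (s x.1) x maps g)
      (List.ofFn fun a => decide (a ∈ I)) = true)
    (htime : HaltsWithin p X.encode L)
    (hprob : 2 / 3 ≤ outputProb p X.encode (setCover.IsAnswer X)) : Good p V s x maps L g := by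
  intro σ h5 h12
  rw [outputProb_eq_prob] at hprob
  refine hprob.trans (weight_mono ?_)
  rintro c ⟨s', t, h1, I, hI, h0⟩
  have ht : t ≤ L := by
    have : Halts p (start X.encode) fun _ t => (t : ℝ) ≤ L := htime
    exact_mod_cast this.of_exec_coins h1
  rw [hX] at h1
  obtain ⟨σ', t', L', h2, h3, -⟩ := h1.clocked (M := 12) (K := 5) (F := 6) (by omega) (by omega)
    (by omega) hp σ L h12 h5 ht
  refine ⟨σ', t', h2, ?_⟩
  have h4 : σ' 12 = _ := (h3 0 hV).trans h0
  unfold Shows accepts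
  dsimp only
  rw [Bool.or_eq_true]
  left
  rw [h4, readBits_ofBits _ _ (by rw [List.length_ofFn, hm])]
  exact hopt I hI

/-! ### The programs of the reduction -/

/-- The size of the pieces. -/
def pieceSize (q n : ℕ) : ℕ := q * bitLen n

/-- The size of the guessed separators; small instances are solved by brute force. -/
def guessSize (q n₀ n : ℕ) : ℕ := if decide (n < n₀) then n else quot n (pieceSize q n) + 1

@[fun_prop]
theorem PT.pieceSize {α : Type} [Enc α] (q : ℕ) {n : α → ℕ} (hn : PT n) :
    PT fun a => pieceSize q (n a) := by
  unfold LogSetCover.pieceSize; fun_prop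

@[fun_prop]
theorem PT.guessSize {α : Type} [Enc α] (q n₀ : ℕ) {n : α → ℕ} (hn : PT n) :
    PT fun a => guessSize q n₀ (n a) := by
  unfold LogSetCover.guessSize; fun_prop

/-- The subroutines and their time bounds depend on `q` only; the number of variables and the
constant of the clock depend on the Set Cover algorithm as well. -/
theorem exists_components (q : ℕ) : ∃ inst sel ok : Prog,
    inst.Deterministic ∧ sel.Deterministic ∧ ok.Deterministic ∧
    ∃ (Ti : Input × List (List ℕ) × List (ℕ × ℕ) → ℕ) (Ts : List (List Bool) × Data → ℕ)
      (To : (Input × List (List ℕ) × List (ℕ × ℕ)) × (ℕ × List (List Bool)) × List Bool → ℕ),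
      PolyBdd Ti ∧ (∃ k, ∀ c, Ts c ≤ (sz c.1 + 2) ^ k) ∧ PolyBdd To ∧
      ∀ p : Prog, ∃ V κ, p.Below V ∧ Components inst sel ok p V κ (pieceSize q) Ti Ts To := by
  obtain ⟨-, Ti, hTi, ci⟩ := show PT fun c : Input × List (List ℕ) × List (ℕ × ℕ) =>
    coverInstance (pieceSize q c.1.1) c.1 c.2.1 c.2.2 by fun_prop
  obtain ⟨-, To, hTo, co⟩ := PT_accepts
  obtain ⟨k, cs⟩ := exists_computes_readBits (α := List Bool)
  obtain ⟨inst, di, hi⟩ := ci 9 4 12 (by omega) (by omega)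
  obtain ⟨sel, ds, hs⟩ := cs 10 10 12 (by omega) (by omega)
  obtain ⟨ok, dk, hk⟩ := co 10 11 12 (by omega) (by omega)
  refine ⟨inst, sel, ok, di, ds, dk, Ti, _, To, hTi, ⟨k, fun c => le_rfl⟩, hTo, fun p => ?_⟩
  obtain ⟨V, hV⟩ := p.exists_below
  obtain ⟨κ, hκ⟩ := exists_halts_clocked 12 5 6 (by omega) (by omega) p
  refine ⟨V + 1, κ, hV.mono (by omega), hi, hs, hk, by omega, fun σ L hL => (hκ σ L hL).mono ?_⟩
  rintro σ' t ⟨L', -, -, h2, h3⟩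
  exact ⟨by omega, h3⟩

/-- The exponent `κ` on the number of guesses is fixed before `q`, because `q` will be chosen as a
multiple of it. The other terms are quasipolynomial, or a polynomial times the time on the clock, so
their exponent `k` may depend on all parameters. -/
theorem exists_init : ∃ κ : ℕ, ∀ q n₀ Q : ℕ, ∃ (init : Prog) (k : ℕ), init.Deterministic ∧
    ∀ x : Input, ∃ (σ : State) (t : ℕ), Exec init (start (enc x)) [] σ t ∧
      Ready x (tuples (List.range x.1) (2 * pieceSize q x.1)) (2 ^ (x.1 - quot x.1 Q))
        (tuples (pairs x.1) (guessSize q n₀ x.1)) false σ ∧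
      t ≤ (sz x + 2) ^ k + ((sz x + 2) ^ k + tuplesBound (List.range x.1) (2 * pieceSize q x.1)) ^ k +
        ((sz x + 2) ^ k + tuplesBound (pairs x.1) (guessSize q n₀ x.1)) ^ κ +
        (sz x + 2) ^ k * 2 ^ (x.1 - quot x.1 Q) := by
  obtain ⟨κ, hκ⟩ := exists_computes_tuples (α := ℕ × ℕ)
  obtain ⟨κ₁, hκ₁⟩ := exists_computes_tuples (α := ℕ)
  obtain ⟨κ₂, hκ₂⟩ := exists_computes_two_pow
  refine ⟨κ, fun q n₀ Q => ?_⟩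
  obtain ⟨s1, T1, b1, c1⟩ := show PT fun x : Input => (List.range x.1, 2 * pieceSize q x.1) by
    fun_prop
  obtain ⟨s2, T2, b2, c2⟩ := show PT fun x : Input => (pairs x.1, guessSize q n₀ x.1) by
    fun_prop
  obtain ⟨s3, T3, b3, c3⟩ := show PT fun x : Input => x.1 - quot x.1 Q by fun_prop
  obtain ⟨p1, d1, e1⟩ := hκ₁.comp c1 0 1 12 (by omega) (by omega)
  obtain ⟨p2, d2, e2⟩ := hκ.comp c2 0 3 12 (by omega) (by omega)
  obtain ⟨p3, d3, e3⟩ := hκ₂.comp c3 0 2 12 (by omega) (by omega)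
  obtain ⟨ka, ha⟩ := (b1.add b2).add b3
  obtain ⟨kb, hb⟩ := s1.add (.const 2)
  obtain ⟨kc, hc⟩ := s2.add (.const 2)
  obtain ⟨kd, hd⟩ := (s3.add (.const 2)).pow κ₂
  refine ⟨.seq p1 (.seq p2 p3), ka + kb + kc + kd + κ₁, ⟨d1, d2, d3⟩, fun x => ?_⟩
  obtain ⟨σ₁, t₁, x1, ht1, o1, f1⟩ := e1 (start (enc x)) x (by simp [start])
  have i1 : σ₁ 0 = enc x := by rw [f1 0 (by omega) (by omega)]; simp [start]
  obtain ⟨σ₂, t₂, x2, ht2, o2, f2⟩ := e2 σ₁ x i1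
  have i2 : σ₂ 0 = enc x := by rw [f2 0 (by omega) (by omega), i1]
  obtain ⟨σ₃, t₃, x3, ht3, o3, f3⟩ := e3 σ₂ x i2
  refine ⟨σ₃, _, x1.seq_nil (x2.seq_nil x3), ⟨?_, ?_, o3, ?_, ?_⟩, ?_⟩
  · rw [f3 0 (by omega) (by omega), i2]
  · rw [f3 1 (by omega) (by omega), f2 1 (by omega) (by omega), o1]
  · rw [f3 3 (by omega) (by omega), o2]
  · rw [f3 7 (by omega) (by omega), f2 7 (by omega) (by omega), f1 7 (by omega) (by omega)]
    simp [start, enc_false]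
  · set k := ka + kb + kc + kd + κ₁ with hk
    have hA : ∀ j ≤ k, (sz x + 2) ^ j ≤ (sz x + 2) ^ k := fun j hj =>
      Nat.pow_le_pow_right (by omega) hj
    have ha' := (ha x).trans (hA ka (by omega))
    have hb' := (hb x).trans (hA kb (by omega))
    have hc' := (hc x).trans (hA kc (by omega))
    have hd' := (hd x).trans (hA kd (by omega))
    dsimp only at ha' hb' hc' hd' ht1 ht2 ht3
    have h1 : (sz (List.range x.1, 2 * pieceSize q x.1) +
        tuplesBound (List.range x.1) (2 * pieceSize q x.1) + 2) ^ κ₁ ≤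
        ((sz x + 2) ^ k + tuplesBound (List.range x.1) (2 * pieceSize q x.1)) ^ k :=
      (Nat.pow_le_pow_left (by omega) _).trans
        (Nat.pow_le_pow_right (by have := Nat.one_le_pow k (sz x + 2) (by omega); omega) (by omega))
    have h2 : (sz (pairs x.1, guessSize q n₀ x.1) +
        tuplesBound (pairs x.1) (guessSize q n₀ x.1) + 2) ^ κ ≤
        ((sz x + 2) ^ k + tuplesBound (pairs x.1) (guessSize q n₀ x.1)) ^ κ :=
      Nat.pow_le_pow_left (by omega) _
    have h3 : (x.1 - quot x.1 Q + 2) ^ κ₂ * 2 ^ (x.1 - quot x.1 Q) ≤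
        (sz x + 2) ^ k * 2 ^ (x.1 - quot x.1 Q) := by
      refine Nat.mul_le_mul_right _ (le_trans (Nat.pow_le_pow_left ?_ _) hd')
      rw [sz_nat]; omega
    omega

/-! ### Quasipolynomial bounds -/

/-- `f` is bounded quasipolynomially. -/
def Quasi (f : ℕ → ℕ) : Prop := ∃ c, ∀ n, f n ≤ 2 ^ (c * (bitLen n + 1) ^ 2)

theorem Quasi.mono {f g : ℕ → ℕ} (hg : Quasi g) (h : ∀ n, f n ≤ g n) : Quasi f := by
  obtain ⟨c, hc⟩ := hg
  exact ⟨c, fun n => (h n).trans (hc n)⟩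

theorem Quasi.const (a : ℕ) : Quasi fun _ => a := by
  refine ⟨a, fun n => Nat.lt_two_pow_self.le.trans (Nat.pow_le_pow_right (by omega) ?_)⟩
  exact Nat.le_mul_of_pos_right _ (by positivity)

theorem Quasi.mul {f g : ℕ → ℕ} (hf : Quasi f) (hg : Quasi g) : Quasi fun n => f n * g n := by
  obtain ⟨c, hc⟩ := hf
  obtain ⟨d, hd⟩ := hg
  refine ⟨c + d, fun n => ?_⟩
  rw [add_mul, pow_add]
  exact Nat.mul_le_mul (hc n) (hd n)

theorem Quasi.add_one {f : ℕ → ℕ} (hf : Quasi f) : Quasi fun n => f n + 1 := by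
  obtain ⟨c, hc⟩ := hf
  refine ⟨c + 1, fun n => ?_⟩
  have h1 : 2 ^ (c * (bitLen n + 1) ^ 2) + 1 ≤ 2 ^ (c * (bitLen n + 1) ^ 2 + 1) := by
    have := Nat.one_le_two_pow (n := c * (bitLen n + 1) ^ 2)
    rw [pow_succ _ (c * (bitLen n + 1) ^ 2)]
    omega
  refine (Nat.add_le_add_right (hc n) 1).trans (h1.trans (Nat.pow_le_pow_right (by omega) ?_))
  rw [add_mul]
  have : 0 < (bitLen n + 1) ^ 2 := by positivity
  omega

theorem Quasi.add {f g : ℕ → ℕ} (hf : Quasi f) (hg : Quasi g) : Quasi fun n => f n + g n := by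
  refine (hf.add_one.mul hg.add_one).mono fun n => ?_
  nlinarith [Nat.zero_le (f n * g n)]

theorem Quasi.pow {f : ℕ → ℕ} (hf : Quasi f) (k : ℕ) : Quasi fun n => f n ^ k := by
  induction k with
  | zero => simpa using Quasi.const 1
  | succ k ih => simpa [pow_succ] using ih.mul hf

theorem Quasi.id : Quasi fun n => n := by
  refine ⟨1, fun n => (bitLen_spec n).1.le.trans (Nat.pow_le_pow_right (by omega) ?_)⟩
  nlinarith [Nat.zero_le (bitLen n)]

theorem bitLen_le (n : ℕ) : bitLen n ≤ n := by
  rcases (bitLen_spec n).2 with h | h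
  · omega
  · have := Nat.lt_two_pow_self (n := bitLen n - 1)
    omega

theorem Quasi.pieceSize (q : ℕ) : Quasi (pieceSize q) :=
  ((Quasi.const q).mul .id).mono fun n => Nat.mul_le_mul_left _ (bitLen_le n)

/-- This bounds the number of maps on a piece: pieces have `O(log n)` nodes, so there are `n ^ O(log
n)` maps. -/
theorem Quasi.pow_pieceSize (q : ℕ) : Quasi fun n => max n 1 ^ (2 * LogSetCover.pieceSize q n) := by
  refine ⟨2 * q, fun n => ?_⟩
  have h1 : max n 1 ≤ 2 ^ bitLen n := max_le (bitLen_spec n).1.le Nat.one_le_two_pow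
  refine (Nat.pow_le_pow_left h1 _).trans ?_
  rw [← pow_mul]
  refine Nat.pow_le_pow_right (by omega) ?_
  unfold LogSetCover.pieceSize
  have h : bitLen n * bitLen n ≤ (bitLen n + 1) ^ 2 := by nlinarith [Nat.zero_le (bitLen n)]
  calc bitLen n * (2 * (q * bitLen n)) = 2 * q * (bitLen n * bitLen n) := by ring
    _ ≤ _ := Nat.mul_le_mul_left _ h

/-- Since `log ^ 2` grows more slowly than `n`, quasipolynomial factors are `2 ^ o(n)`. -/
theorem exists_forall_mul_le (c : ℕ) : ∃ N, ∀ n ≥ N, c * (bitLen n + 1) ^ 2 ≤ n := by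
  have h : Filter.Tendsto (fun l : ℕ => ((l : ℝ) + 1 + 1) ^ 2 / (2 : ℝ) ^ l) Filter.atTop
      (nhds 0) := by
    have h0 := tendsto_pow_const_div_const_pow_of_one_lt 2 (r := (2 : ℝ)) (by norm_num)
    have h1 := ((Filter.tendsto_add_atTop_iff_nat 2).2 h0).mul_const 4
    rw [zero_mul] at h1
    refine h1.congr fun l => ?_
    push_cast
    rw [pow_add]
    field_simp
    ring
  obtain ⟨l₀, hl⟩ := Filter.eventually_atTop.1
    (h.eventually (gt_mem_nhds (show (0 : ℝ) < 1 / (c + 1) by positivity)))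
  refine ⟨2 ^ (l₀ + 1), fun n hn => ?_⟩
  have h1 : l₀ + 1 < bitLen n := (Nat.pow_lt_pow_iff_right (by omega)).1
    (hn.trans_lt (bitLen_spec n).1)
  have h2 := hl (bitLen n - 1) (by omega)
  rw [div_lt_div_iff₀ (by positivity) (by positivity)] at h2
  have h3 : 2 ^ (bitLen n - 1) ≤ n := (bitLen_spec n).2.resolve_left (by omega)
  have h4 : ((bitLen n - 1 : ℕ) : ℝ) + 1 = bitLen n := by
    rw [Nat.cast_sub (by omega)]; simp
  rw [h4] at h2
  have h5 : (bitLen n + 1) ^ 2 * (c + 1) < 1 * 2 ^ (bitLen n - 1) := by exact_mod_cast h2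
  nlinarith [Nat.zero_le ((bitLen n + 1) ^ 2)]

/-! ### Sizes in the reduction -/

theorem sz_pairs_mem {n : ℕ} {e : ℕ × ℕ} (h : e ∈ pairs n) : sz e ≤ 4 * n + 3 := by
  obtain ⟨u, v⟩ := e
  rw [mem_pairs] at h
  rw [sz_pair, sz_nat, sz_nat]
  simp only at h
  omega

theorem sz_pairs_le (n : ℕ) : sz (pairs n) ≤ (pairs n).length * (4 * n + 4) + 1 :=
  sz_le_of_forall fun _ h => sz_pairs_mem h

theorem sz_tuple_pairs_le {n b : ℕ} {g : List (ℕ × ℕ)} (h : g ∈ tuples (pairs n) b) :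
    sz g ≤ b * (4 * n + 4) + 1 := by
  obtain ⟨rfl, h2⟩ := mem_tuples.1 h
  exact sz_le_of_forall fun e he => sz_pairs_mem (h2 e he)

theorem sz_range_le (n : ℕ) : sz (List.range n) ≤ n * (2 * n + 2) + 1 := by
  have := sz_le_of_forall (l := List.range n) (B := 2 * n + 1) fun a ha => by
    rw [sz_nat]; rw [List.mem_range] at ha; omega
  simpa using this

theorem length_pairs (n : ℕ) : (pairs n).length = n * n := by
  simp [pairs]

theorem sz_matrixOf_le {n : ℕ} (G : Digraph (Fin n)) : sz (matrixOf G) ≤ n * (4 * n + 2) + 1 := by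
  refine (sz_le_of_forall (B := n * 4 + 1) fun r hr => ?_).trans (by simp [matrixOf]; ring_nf; rfl)
  obtain ⟨u, rfl⟩ := (List.mem_ofFn' _ _).1 hr
  refine (sz_le_of_forall (B := 3) fun b _ => sz_bool b).trans (by simp)

theorem sz_inputOf_le (x : TreeInstance) : sz (inputOf x) ≤ 20 * (x.n + 1) ^ 2 := by
  have h1 := sz_matrixOf_le x.G
  have h2 := sz_matrixOf_le x.T
  rw [inputOf, sz_pair, sz_pair, sz_nat]
  nlinarith

theorem Quasi.tuplesBound_range (q : ℕ) :
    Quasi fun n => tuplesBound (List.range n) (2 * LogSetCover.pieceSize q n) := by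
  have hp := Quasi.pieceSize q
  refine ((((Quasi.pow_pieceSize q).mul ((((Quasi.const 2).mul hp).mul (((Quasi.id.mul
    (((Quasi.const 2).mul .id).add (.const 2))).add (.const 1)).add (.const 1))).add
    (.const 2))).add (.const 1))).mono fun n => ?_
  unfold tuplesBound
  rw [List.length_range]
  have := sz_range_le n
  gcongr

/-- Bounds for the input of the treatment of a guess. -/
theorem exists_sz_le (q : ℕ) : ∃ S, Quasi S ∧ ∀ (x : TreeInstance), ∀ b ≤ x.n + 1,
    ∀ g ∈ tuples (pairs x.n) b,
      sz (inputOf x, tuples (List.range x.n) (2 * pieceSize q x.n), g) ≤ S x.n := by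
  refine ⟨_, ((((Quasi.const 20).mul ((Quasi.id.add (.const 1)).pow 2)).add
    (Quasi.tuplesBound_range q)).add (((Quasi.id.add (.const 1)).mul (((Quasi.const 4).mul .id).add
      (.const 4))).add (.const 3))), fun x b hb g hg => ?_⟩
  have h1 := sz_inputOf_le x
  have h2 := sz_tuple_pairs_le hg
  have h3 : sz (tuples (List.range x.n) (2 * pieceSize q x.n)) ≤
    tuplesBound (List.range x.n) (2 * pieceSize q x.n) := sz_tuples_le_of_le _ le_rfl
  have h4 : b * (4 * x.n + 4) ≤ (x.n + 1) * (4 * x.n + 4) := Nat.mul_le_mul_right _ hb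
  rw [sz_pair (inputOf x), sz_pair _ g]
  omega

theorem PolyBdd.quasi {α : Type} [Enc α] {f : α → ℕ} (hf : PolyBdd f) {S : ℕ → ℕ}
    (hS : Quasi S) : ∃ U, Quasi U ∧ ∀ n a, sz a ≤ S n → f a ≤ U n := by
  obtain ⟨k, hk⟩ := hf
  exact ⟨_, (hS.add (.const 2)).pow k, fun n a h => (hk a).trans
    (Nat.pow_le_pow_left (Nat.add_le_add_right h 2) k)⟩

theorem exists_sz_coverInstance_le (q : ℕ) : ∃ S, Quasi S ∧ ∀ (x : TreeInstance), ∀ b ≤ x.n + 1,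
    ∀ g ∈ tuples (pairs x.n) b, sz (coverInstance (pieceSize q x.n) (inputOf x)
      (tuples (List.range x.n) (2 * pieceSize q x.n)) g) ≤ S x.n := by
  obtain ⟨S, hS, h⟩ := exists_sz_le q
  obtain ⟨U, hU, hU'⟩ := (show PT fun c : Input × List (List ℕ) × List (ℕ × ℕ) =>
    coverInstance (pieceSize q c.1.1) c.1 c.2.1 c.2.2 by fun_prop).polyBdd.quasi hS
  exact ⟨U, hU, fun x b hb g hg => hU' x.n (inputOf x, _, g) (h x b hb g hg)⟩

/-- The output `y` of the Set Cover algorithm is arbitrary, but the selection read off from it has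
one bit per set, so the check takes quasipolynomial time in any case. -/
theorem exists_within (q : ℕ) {Ti : Input × List (List ℕ) × List (ℕ × ℕ) → ℕ}
    {Ts : List (List Bool) × Data → ℕ}
    {To : (Input × List (List ℕ) × List (ℕ × ℕ)) × (ℕ × List (List Bool)) × List Bool → ℕ}
    (hi : PolyBdd Ti) (hs : ∃ k, ∀ c, Ts c ≤ (sz c.1 + 2) ^ k) (ho : PolyBdd To) :
    ∃ W, Quasi W ∧ ∀ (x : TreeInstance), ∀ b ≤ x.n + 1, ∀ g ∈ tuples (pairs x.n) b,
      Within (pieceSize q) Ti Ts To (inputOf x) (tuples (List.range x.n) (2 * pieceSize q x.n))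
        (W x.n) g := by
  obtain ⟨S, hS, hS'⟩ := exists_sz_le q
  obtain ⟨Z, hZ, hZ'⟩ := exists_sz_coverInstance_le q
  obtain ⟨U, hU, hU'⟩ := hi.quasi hS
  obtain ⟨k, hk⟩ := hs
  obtain ⟨Y, hY, hY'⟩ := ho.quasi ((hS.add (hZ.add ((hZ.mul (.const 4)).add (.const 1)))).add
    (.const 2))
  refine ⟨_, (hU.add ((hZ.add (.const 2)).pow k)).add hY, fun x b hb g hg y => ?_⟩
  have h1 := hS' x b hb g hg
  have h2 := hZ' x b hb g hg
  unfold inputOf at h1 h2 ⊢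
  dsimp only
  generalize coverInstance (pieceSize q x.n) (x.n, matrixOf x.G, matrixOf x.T)
    (tuples (List.range x.n) (2 * pieceSize q x.n)) g = I at h2 ⊢
  have h3 : sz I.2 ≤ Z x.n := by
    have : sz I = _ := sz_pair I.1 I.2
    omega
  refine Nat.add_le_add (Nat.add_le_add (hU' _ _ h1) ((hk _).trans
    (Nat.pow_le_pow_left (Nat.add_le_add_right h3 2) k))) (hY' _ _ ?_)
  have h4 : sz (readBits I.2 y) ≤ Z x.n * 4 + 1 := by
    refine (sz_le_of_forall (B := 3) fun b _ => sz_bool b).trans ?_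
    rw [length_readBits]
    have := length_le_sz I.2
    omega
  rw [sz_pair _ (I, readBits I.2 y), sz_pair I]
  omega

/-! ### The parameters of the reduction -/

theorem log_le_mul_bitLen {n j : ℕ} (h : j ≤ 2 ^ (bitLen n + 1)) : Real.log j ≤ bitLen n + 1 := by
  rcases Nat.eq_zero_or_pos j with rfl | hj
  · simp; positivity
  · have h1 : Real.log j ≤ Real.log ((2 : ℝ) ^ (bitLen n + 1)) :=
      Real.log_le_log (by exact_mod_cast hj) (by exact_mod_cast h)
    rw [Real.log_pow] at h1
    have h2 := Real.log_two_lt_d9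
    push_cast at h1
    nlinarith [(Nat.cast_nonneg (bitLen n) : (0 : ℝ) ≤ bitLen n)]

theorem bitLen_le_mul_log {n : ℕ} (h : 2 ≤ n) : (bitLen n : ℝ) ≤ 4 * Real.log n := by
  have h1 : 1 < bitLen n := (Nat.pow_lt_pow_iff_right (a := 2) (by omega)).1
    (lt_of_le_of_lt (by omega) (bitLen_spec n).1)
  have h2 : 2 ^ (bitLen n - 1) ≤ n := (bitLen_spec n).2.resolve_left (by omega)
  have h3 : Real.log ((2 : ℝ) ^ (bitLen n - 1)) ≤ Real.log n :=
    Real.log_le_log (by positivity) (by exact_mod_cast h2)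
  rw [Real.log_pow, Nat.cast_sub (by omega)] at h3
  have h4 := Real.log_two_gt_d9
  have h5 : (2 : ℝ) ≤ bitLen n := by exact_mod_cast h1
  push_cast at h3
  nlinarith

theorem bitLen_pos {n : ℕ} (h : 0 < n) : 0 < bitLen n := by
  have := (bitLen_spec n).1
  rcases Nat.eq_zero_or_pos (bitLen n) with h0 | h0
  · rw [h0] at this; omega
  · exact h0

/-- The instances of Set Cover in the reduction have small sets and small optimal solutions. -/
theorem exists_forall_promise {κ Q : ℕ} (hκ : 0 < κ) {ε : ℝ} (hε : 0 < ε) (hQ : 2 / ε ≤ Q)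
    (hQ' : (Q : ℝ) ≤ 3 / ε) : ∃ N, ∀ n ≥ N, ∀ k, pieceSize (8 * κ * Q) n * (k - 1) ≤ n →
      ((2 * pieceSize (8 * κ * Q) n + 1 : ℕ) : ℝ) ≤ 288 * κ / ε * Real.log (n + k : ℕ) ∧
      (k : ℝ) * Real.log (n + k : ℕ) ≤ ε * (n + k : ℕ) := by
  obtain ⟨N, hN⟩ := exists_forall_mul_le (8 * κ * Q)
  refine ⟨N + 2, fun n hn k hk => ?_⟩
  have hQ0 : 0 < (Q : ℝ) := lt_of_lt_of_le (by positivity) hQ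
  have hQ1 : 0 < Q := by exact_mod_cast hQ0
  have hl := bitLen_pos (show 0 < n by omega)
  have hns : pieceSize (8 * κ * Q) n ≤ n := by
    refine le_trans ?_ (hN n (by omega))
    exact Nat.mul_le_mul_left _ (by nlinarith)
  have hs : 0 < pieceSize (8 * κ * Q) n := by unfold pieceSize; positivity
  have hk1 : k - 1 ≤ n := le_trans (Nat.le_mul_of_pos_left _ hs) hk
  have hlog1 : (bitLen n : ℝ) ≤ 4 * Real.log (n + k : ℕ) :=
    (bitLen_le_mul_log (by omega)).trans (mul_le_mul_of_nonneg_left (Real.log_le_log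
      (by exact_mod_cast (by omega : 0 < n)) (by exact_mod_cast (by omega : n ≤ n + k))) (by norm_num))
  have hlog2 : Real.log (n + k : ℕ) ≤ bitLen n + 1 := by
    refine log_le_mul_bitLen ?_
    have := (bitLen_spec n).1
    rw [pow_succ]; omega
  have hQe : (Q : ℝ) * ε ≤ 3 := by rwa [le_div_iff₀ hε] at hQ'
  have hQe' : 2 ≤ (Q : ℝ) * ε := by rwa [div_le_iff₀ hε] at hQ
  have hl1 : (1 : ℝ) ≤ bitLen n := by exact_mod_cast hl
  constructor
  · have h1 : ((2 * pieceSize (8 * κ * Q) n + 1 : ℕ) : ℝ) ≤ 24 * κ * Q * bitLen n := by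
      have : 2 * pieceSize (8 * κ * Q) n + 1 ≤ 3 * pieceSize (8 * κ * Q) n := by omega
      calc ((2 * pieceSize (8 * κ * Q) n + 1 : ℕ) : ℝ) ≤ ((3 * pieceSize (8 * κ * Q) n : ℕ) : ℝ) :=
            by exact_mod_cast this
        _ = _ := by unfold pieceSize; push_cast; ring
    refine h1.trans ?_
    rw [div_mul_eq_mul_div, le_div_iff₀ hε]
    have hκ0 : (0 : ℝ) ≤ κ := Nat.cast_nonneg _
    -- The constant `288 = 24 * 4 * 3` comes from `bitLen n ≤ 4 log` and `Q ε ≤ 3`.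
    calc 24 * (κ : ℝ) * Q * bitLen n * ε = 24 * κ * bitLen n * (Q * ε) := by ring
      _ ≤ 24 * κ * (4 * Real.log (n + k : ℕ)) * 3 := by gcongr
      _ = _ := by ring
  · have h1 : pieceSize (8 * κ * Q) n * k ≤ 2 * n := by
      rcases k with _ | k
      · simp
      · rw [Nat.add_sub_cancel] at hk
        rw [mul_add]; omega
    have h2 : 8 * κ * Q * bitLen n * k ≤ 2 * n := h1
    have h3 : 8 * Q * bitLen n * k ≤ 2 * n := by
      refine le_trans ?_ h2
      gcongr
      nlinarith
    have h4 : (8 * Q * bitLen n * k : ℝ) ≤ 2 * n := by exact_mod_cast h3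
    have h5 : (k : ℝ) * Real.log (n + k : ℕ) ≤ k * (2 * bitLen n) :=
      mul_le_mul_of_nonneg_left (by linarith) (Nat.cast_nonneg _)
    have h6 : (k : ℝ) * (2 * bitLen n) * 2 ≤ n * ε := by
      have : (4 * (k * (2 * bitLen n)) : ℝ) * 2 ≤ 4 * (k * (2 * bitLen n)) * (Q * ε) :=
        mul_le_mul_of_nonneg_left hQe' (by positivity)
      nlinarith
    have h7 : (0 : ℝ) ≤ (k : ℝ) * (2 * bitLen n) := by positivity
    push_cast at h5 ⊢
    nlinarith [mul_nonneg hε.le (Nat.cast_nonneg k : (0 : ℝ) ≤ k)]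

/-- The time on the clock suffices for the Set Cover algorithm. -/
theorem exists_forall_timeBound_le {κ Q : ℕ} (hκ : 0 < κ) {ε : ℝ} (hε : 0 < ε)
    (hQ : 2 / ε ≤ Q) {Z : ℕ → ℕ} (hZ : Quasi Z) (A k : ℕ) :
    ∃ N, ∀ n ≥ N, ∀ z j, z ≤ Z n → pieceSize (8 * κ * Q) n * (j - 1) ≤ n →
      (A : ℝ) * (z : ℝ) ^ k * (2 : ℝ) ^ ((1 - ε) * ((n + j : ℕ) : ℝ)) ≤ ((2 ^ (n - n / Q) : ℕ) : ℝ) := by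
  obtain ⟨c, hc⟩ := (Quasi.const A).mul (hZ.pow k)
  dsimp only at hc
  obtain ⟨N, hN⟩ := exists_forall_mul_le (8 * Q * (c + 1))
  refine ⟨N + 1, fun n hn z j hz hj => ?_⟩
  have hQ0 : 0 < (Q : ℝ) := lt_of_lt_of_le (by positivity) hQ
  have hQ1 : 0 < Q := by exact_mod_cast hQ0
  have hQe' : 2 ≤ (Q : ℝ) * ε := by rwa [div_le_iff₀ hε] at hQ
  have hl := bitLen_pos (show 0 < n by omega)
  set E := c * (bitLen n + 1) ^ 2 with hE
  have h1 : (A : ℝ) * (z : ℝ) ^ k ≤ (2 : ℝ) ^ (E : ℝ) := by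
    rw [Real.rpow_natCast]
    have : A * z ^ k ≤ 2 ^ E := le_trans (Nat.mul_le_mul_left _ (Nat.pow_le_pow_left hz _)) (hc n)
    exact_mod_cast this
  have h2 : 8 * Q * (j - 1) ≤ n := by
    refine le_trans (Nat.mul_le_mul_right _ ?_) hj
    unfold pieceSize
    calc 8 * Q = 8 * 1 * Q * 1 := by ring
      _ ≤ _ := by gcongr <;> omega
  have h3 : 8 * (Q : ℝ) * j ≤ n + 8 * Q := by
    have : 8 * Q * j ≤ n + 8 * Q := by
      rcases j with _ | j
      · simp
      · rw [Nat.add_sub_cancel] at h2; rw [mul_add]; omega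
    exact_mod_cast this
  have h4 : 8 * (Q : ℝ) * E + 8 * Q ≤ n := by
    have h := hN n (by omega)
    have : 8 * Q * E + 8 * Q ≤ n := by
      refine le_trans ?_ h
      rw [hE]
      have : 1 ≤ (bitLen n + 1) ^ 2 := Nat.one_le_pow _ _ (by omega)
      nlinarith
    exact_mod_cast this
  have h5 : ((n - n / Q : ℕ) : ℝ) * Q ≥ n * Q - n := by
    have h := Nat.div_mul_le_self n Q
    rw [Nat.cast_sub (Nat.div_le_self _ _), sub_mul]
    have : ((n / Q : ℕ) : ℝ) * Q ≤ n := by exact_mod_cast h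
    linarith
  calc (A : ℝ) * (z : ℝ) ^ k * (2 : ℝ) ^ ((1 - ε) * ((n + j : ℕ) : ℝ)) ≤
      (2 : ℝ) ^ (E : ℝ) * (2 : ℝ) ^ ((1 - ε) * ((n + j : ℕ) : ℝ)) := by gcongr
    _ = (2 : ℝ) ^ ((E : ℝ) + (1 - ε) * ((n + j : ℕ) : ℝ)) := by
      rw [Real.rpow_add (by norm_num)]
    _ ≤ (2 : ℝ) ^ ((n - n / Q : ℕ) : ℝ) := by
      -- As `Q ε ≥ 2`, the saving `ε n` is at least `2 n / Q`. One half is given up in the clock;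
      -- the other half pays for the quasipolynomial factor `2 ^ E` and for the `j` markers, each of
      -- which costs only about `n / (8 Q)`.
      refine Real.rpow_le_rpow_of_exponent_le (by norm_num) ?_
      refine le_of_mul_le_mul_right ?_ hQ0
      refine le_trans ?_ h5
      push_cast
      have h6 : (0 : ℝ) ≤ n := Nat.cast_nonneg n
      have h7 : (0 : ℝ) ≤ j * ε * Q := by positivity
      have h8 : (n : ℝ) * 2 ≤ n * (Q * ε) := mul_le_mul_of_nonneg_left hQe' h6
      nlinarith
    _ = _ := by rw [Real.rpow_natCast]; push_cast; rfl

/-- The total time is small. -/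
theorem exists_forall_total_le {κ Q : ℕ} (hQ : 0 < Q) {U : ℕ → ℕ} (hU : Quasi U) :
    ∃ N, ∀ n ≥ N, ((U n * (max (n * n) 1 ^ (n / pieceSize (8 * κ * Q) n + 1)) ^ κ *
      2 ^ (n - n / Q) : ℕ) : ℝ) ≤ (2 : ℝ) ^ ((1 - 1 / (2 * Q : ℝ)) * n) := by
  obtain ⟨c, hc⟩ := hU
  obtain ⟨N, hN⟩ := exists_forall_mul_le (4 * Q * c + 8 * κ * Q + 4 * Q)
  refine ⟨N + 1, fun n hn => ?_⟩
  have hl := bitLen_pos (show 0 < n by omega)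
  have hN' := hN n (by omega)
  set s := pieceSize (8 * κ * Q) n with hs
  have h1 : max (n * n) 1 ≤ 2 ^ (2 * bitLen n) := by
    refine max_le ?_ Nat.one_le_two_pow
    rw [two_mul, pow_add]
    exact Nat.mul_le_mul (bitLen_spec n).1.le (bitLen_spec n).1.le
  set e := 2 * bitLen n * (n / s + 1) * κ with he
  have h2 : (max (n * n) 1 ^ (n / s + 1)) ^ κ ≤ 2 ^ e := by
    rw [he, pow_mul, pow_mul]
    exact Nat.pow_le_pow_left (Nat.pow_le_pow_left h1 _) _
  -- This is where the factor `8 κ Q` in the size of the pieces is used: it makes `4 Q e` equal to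
  -- `s (n / s + 1)`.
  have h3 : 4 * Q * e ≤ n + s := by
    have := Nat.mul_div_le n s
    calc 4 * Q * e = s * (n / s + 1) := by rw [he, hs, pieceSize]; ring
      _ ≤ _ := by rw [mul_add]; omega
  set E := c * (bitLen n + 1) ^ 2 with hE
  have h4 : 4 * Q * E + s + 4 * Q ≤ n := by
    refine le_trans ?_ hN'
    have h5 : 1 ≤ (bitLen n + 1) ^ 2 := Nat.one_le_pow _ _ (by omega)
    have h6 : bitLen n ≤ (bitLen n + 1) ^ 2 := by nlinarith
    calc 4 * Q * E + s + 4 * Q = 4 * Q * (c * (bitLen n + 1) ^ 2) + 8 * κ * Q * bitLen n + 4 * Q * 1 := by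
          rw [hE, hs, pieceSize]; ring
      _ ≤ 4 * Q * (c * (bitLen n + 1) ^ 2) + 8 * κ * Q * (bitLen n + 1) ^ 2 +
          4 * Q * (bitLen n + 1) ^ 2 := by gcongr
      _ = _ := by ring
  have h5 : n < Q * (n / Q) + Q := by
    have := Nat.div_add_mod n Q
    have := Nat.mod_lt n hQ
    omega
  have h6 : U n * (max (n * n) 1 ^ (n / s + 1)) ^ κ * 2 ^ (n - n / Q) ≤
      2 ^ (E + e + (n - n / Q)) := by
    rw [pow_add 2 (E + e), pow_add 2 E]
    exact Nat.mul_le_mul_right _ (Nat.mul_le_mul (hc n) h2)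
  calc ((U n * (max (n * n) 1 ^ (n / s + 1)) ^ κ * 2 ^ (n - n / Q) : ℕ) : ℝ) ≤
      ((2 ^ (E + e + (n - n / Q)) : ℕ) : ℝ) := by exact_mod_cast h6
    _ = (2 : ℝ) ^ ((E + e + (n - n / Q) : ℕ) : ℝ) := by rw [Real.rpow_natCast]; push_cast; rfl
    _ ≤ _ := by
      refine Real.rpow_le_rpow_of_exponent_le (by norm_num) ?_
      have hQ0 : (0 : ℝ) < Q := by exact_mod_cast hQ
      -- In multiples of `1 / (4 Q)`, the clock saves more than `4 n - 4 Q`, while the guesses cost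
      -- at most `n + s` and the remaining factor at most `n - s - 4 Q`; a saving of `2 n` is left.
      refine le_of_mul_le_mul_left ?_ (show (0 : ℝ) < 4 * Q by positivity)
      have h7 : 4 * (Q : ℝ) * ((1 - 1 / (2 * Q)) * n) = 4 * Q * n - 2 * n := by
        field_simp; ring
      rw [h7]
      push_cast [Nat.cast_sub (Nat.div_le_self n Q)]
      have h3' : 4 * (Q : ℝ) * e ≤ n + s := by exact_mod_cast h3
      have h4' : 4 * (Q : ℝ) * E + s + 4 * Q ≤ n := by exact_mod_cast h4
      have h5' : (n : ℝ) < Q * (n / Q : ℕ) + Q := by exact_mod_cast h5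
      nlinarith

/-! ### The reduction for `ε ≤ 1` -/

theorem TreeInstance.pos (x : TreeInstance) : 0 < x.n := by
  obtain ⟨v⟩ := x.isTree.connected.nonempty
  exact v.pos

theorem guessSize_le (q n₀ n : ℕ) (hs : 0 < pieceSize q n) : guessSize q n₀ n ≤ n + 1 := by
  unfold guessSize
  split
  · omega
  · rw [quot_eq hs]
    exact Nat.add_le_add_right (Nat.div_le_self _ _) 1

theorem guessSize_of_lt {q n₀ n : ℕ} (h : n < n₀) : guessSize q n₀ n = n := by
  unfold guessSize; simp [h]

theorem guessSize_of_le {q n₀ n : ℕ} (hs : 0 < pieceSize q n) (h : n₀ ≤ n) :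
    guessSize q n₀ n = n / pieceSize q n + 1 := by
  unfold guessSize; rw [quot_eq hs]; simp [h]

theorem tuplesBound_pairs_le {n b : ℕ} (hb : b ≤ n + 1) : tuplesBound (pairs n) b ≤
    max (n * n) 1 ^ b * ((n + 1) * (n * n * (4 * n + 4) + 2) + 3) := by
  unfold tuplesBound
  have h1 := sz_pairs_le n
  rw [length_pairs] at h1 ⊢
  have h2 : b * (sz (pairs n) + 1) ≤ (n + 1) * (n * n * (4 * n + 4) + 2) :=
    Nat.mul_le_mul hb (by omega)
  have h3 : 1 ≤ max (n * n) 1 ^ b := Nat.one_le_pow _ _ (by omega)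
  calc max (n * n) 1 ^ b * (b * (sz (pairs n) + 1) + 2) + 1 ≤
      max (n * n) 1 ^ b * ((n + 1) * (n * n * (4 * n + 4) + 2) + 2) + max (n * n) 1 ^ b * 1 := by
        gcongr; omega
    _ = _ := by ring

/-- Here `M` bounds the number of guesses and `R` is the time on the clock. The enumeration costs `M
^ κ`, and the search costs `M * R`, each up to quasipolynomial factors. -/
theorem total_le_aux {a b c d e κ M R G y P : ℕ} (hM : 1 ≤ M) (hR : 1 ≤ R) (hG : G ≤ M) :
    a + (M * y) ^ κ + P * R + G * (b + c * (R + 1) + d) + e ≤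
      (a + y ^ κ + P + (b + 2 * c + d) + e) * M ^ (κ + 1) * R := by
  have h1 : 1 ≤ M ^ κ := Nat.one_le_pow _ _ hM
  have hX : 1 ≤ M ^ (κ + 1) * R := Nat.mul_pos (Nat.pow_pos hM) hR
  have e1 : a ≤ a * (M ^ (κ + 1) * R) := Nat.le_mul_of_pos_right _ hX
  have e5 : e ≤ e * (M ^ (κ + 1) * R) := Nat.le_mul_of_pos_right _ hX
  have e2 : (M * y) ^ κ ≤ y ^ κ * (M ^ (κ + 1) * R) := by
    rw [mul_pow, mul_comm]
    refine Nat.mul_le_mul_left _ ?_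
    calc M ^ κ = M ^ κ * 1 * 1 := by ring
      _ ≤ M ^ κ * M * R := by gcongr
      _ = _ := by rw [pow_succ]
  have e3 : P * R ≤ P * (M ^ (κ + 1) * R) :=
    Nat.mul_le_mul_left _ (Nat.le_mul_of_pos_left _ (Nat.pow_pos hM))
  have e4 : G * (b + c * (R + 1) + d) ≤ (b + 2 * c + d) * (M ^ (κ + 1) * R) := by
    have h2 : b + c * (R + 1) + d ≤ (b + 2 * c + d) * R := by nlinarith
    calc G * (b + c * (R + 1) + d) ≤ M * ((b + 2 * c + d) * R) := Nat.mul_le_mul hG h2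
      _ = (b + 2 * c + d) * (1 * M * R) := by ring
      _ ≤ (b + 2 * c + d) * (M ^ κ * M * R) := by gcongr
      _ = _ := by rw [pow_succ]
  calc _ ≤ a * (M ^ (κ + 1) * R) + y ^ κ * (M ^ (κ + 1) * R) + P * (M ^ (κ + 1) * R) +
        (b + 2 * c + d) * (M ^ (κ + 1) * R) + e * (M ^ (κ + 1) * R) := by gcongr
    _ = _ := by ring

theorem exists_forall_le_of_eventually {f : ℕ → ℕ} {a : ℝ} (ha : 0 ≤ a)
    (h : ∃ N, ∀ n ≥ N, (f n : ℝ) ≤ (2 : ℝ) ^ (a * n)) :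
    ∃ A : ℕ, ∀ n : ℕ, (f n : ℝ) ≤ A * (2 : ℝ) ^ (a * n) := by
  obtain ⟨N, hN⟩ := h
  refine ⟨∑ n ∈ Finset.range N, f n + 1, fun n => ?_⟩
  by_cases hn : N ≤ n
  · refine (hN n hn).trans (le_mul_of_one_le_left (by positivity) ?_)
    push_cast
    have : (0 : ℝ) ≤ ∑ n ∈ Finset.range N, (f n : ℝ) := Finset.sum_nonneg fun _ _ => by positivity
    linarith
  · have h1 : f n ≤ ∑ n ∈ Finset.range N, f n + 1 :=
      (Finset.single_le_sum (f := f) (fun _ _ => Nat.zero_le _)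
        (Finset.mem_range.2 (by omega))).trans (Nat.le_succ _)
    have h2 : (1 : ℝ) ≤ (2 : ℝ) ^ (a * n) :=
      Real.one_le_rpow (by norm_num) (by positivity)
    calc (f n : ℝ) ≤ ((∑ n ∈ Finset.range N, f n + 1 : ℕ) : ℝ) := by exact_mod_cast h1
      _ ≤ _ := le_mul_of_one_le_right (by positivity) h2

/-- The promise and the time bound of the Set Cover algorithm are used for one guess only, the one
that comes from an embedding. -/
theorem exists_good_guess {inst sel ok p : Prog} {V κ' κ Q n₀ L A k : ℕ} {Z : ℕ → ℕ} {ε : ℝ}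
    {Ti : Input × List (List ℕ) × List (ℕ × ℕ) → ℕ} {Ts : List (List Bool) × Data → ℕ}
    {To : (Input × List (List ℕ) × List (ℕ × ℕ)) × (ℕ × List (List Bool)) × List Bool → ℕ}
    (H : Components inst sel ok p V κ' (pieceSize (8 * κ * Q)) Ti Ts To) (hp : p.Below V)
    (hsol : (deltaSetCover (fun n : ℕ => 288 * κ / ε * Real.log n) (1 * ε)).SolvedBy p (1 - ε) A k)
    {x : TreeInstance} (hx : x.IsYes) (hs : 0 < pieceSize (8 * κ * Q) x.n)
    (hn1 : n₀ ≤ x.n → ∀ j, pieceSize (8 * κ * Q) x.n * (j - 1) ≤ x.n →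
      ((2 * pieceSize (8 * κ * Q) x.n + 1 : ℕ) : ℝ) ≤ 288 * κ / ε * Real.log (x.n + j : ℕ) ∧
      (j : ℝ) * Real.log (x.n + j : ℕ) ≤ ε * (x.n + j : ℕ))
    (hn2 : n₀ ≤ x.n → ∀ z j, z ≤ Z x.n → pieceSize (8 * κ * Q) x.n * (j - 1) ≤ x.n →
      (A : ℝ) * (z : ℝ) ^ k * (2 : ℝ) ^ ((1 - ε) * ((x.n + j : ℕ) : ℝ)) ≤ (L : ℝ))
    (hZ : ∀ b ≤ x.n + 1, ∀ g ∈ tuples (pairs x.n) b,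
      sz (coverInstance (pieceSize (8 * κ * Q) x.n) (inputOf x)
        (tuples (List.range x.n) (2 * pieceSize (8 * κ * Q) x.n)) g) ≤ Z x.n) :
    ∃ g ∈ tuples (pairs x.n) (guessSize (8 * κ * Q) n₀ x.n),
      Good p V (pieceSize (8 * κ * Q)) (inputOf x)
        (tuples (List.range x.n) (2 * pieceSize (8 * κ * Q) x.n)) L g := by
  rcases Nat.lt_or_ge x.n n₀ with hlt | hge
  · obtain ⟨g, hg, h⟩ := exists_guess_small x hx
    exact ⟨g, by rwa [guessSize_of_lt hlt], good_of_isEmbedding H h⟩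
  · have hb : x.n < guessSize (8 * κ * Q) n₀ x.n * (pieceSize (8 * κ * Q) x.n + 1) := by
      rw [guessSize_of_le hs hge, mul_add]
      have := Nat.lt_div_mul_add (a := x.n) hs
      rw [add_mul]
      omega
    obtain ⟨g, hg, X, j, henc, hXn, hj, hcard, hm, hopt⟩ := exists_guess x hx hs hb
    refine ⟨g, hg, ?_⟩
    have hP := hn1 hge j hj
    rw [← hXn] at hP
    have hX : (∀ i, ((X.sets i).card : ℝ) ≤ 288 * κ / ε * Real.log X.n) ∧
        ∀ I, X.IsOptimal I → (I.card : ℝ) * Real.log X.n ≤ 1 * ε * X.n ∧ X.IsDisjoint I := by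
      refine ⟨fun i => le_trans (by exact_mod_cast hcard i) hP.1, fun I hI => ⟨?_, (hopt I hI).2.1⟩⟩
      have h1 : (I.card : ℝ) ≤ j := by exact_mod_cast (hopt I hI).1
      have h2 : 0 ≤ Real.log X.n := Real.log_natCast_nonneg _
      rw [one_mul]
      exact (mul_le_mul_of_nonneg_right h1 h2).trans hP.2
    obtain ⟨h1, h2⟩ := hsol ⟨X, hX⟩
    refine good_of_solvedBy H.pos hp henc hm (fun I hI => (hopt I hI).2.2) (fun ω => ?_) h2
    obtain ⟨c, s', t, h3, h4⟩ := h1 ω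
    refine ⟨c, s', t, h3, h4.trans ?_⟩
    have h5 := hn2 hge (X.encode.size) j (by
      rw [henc]
      exact hZ _ (guessSize_le _ _ _ hs) g hg) hj
    rw [← hXn] at h5
    exact h5

/-- The reduction for `ε ≤ 1`. The order of the choices matters: `κ`, then `Q` and `δ = 1 / (2 Q)`
from `ε`, and only then the Set Cover algorithm, on which the threshold `n₀` and the constants in
the running time may depend. -/
theorem exists_solvedBy_directedNTree : ∃ κ : ℕ, 0 < κ ∧ ∀ ε : ℝ, 0 < ε → ε ≤ 1 →
    ∃ δ : ℝ, 0 < δ ∧ ∀ (p : Prog) (A k : ℕ),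
      (deltaSetCover (fun n : ℕ => 288 * κ / ε * Real.log n) (1 * ε)).SolvedBy p (1 - ε) A k →
      ∃ p' : Prog, (p.Deterministic → p'.Deterministic) ∧ ∃ A' k',
        directedNTree.SolvedBy p' (1 - δ) A' k' := by
  obtain ⟨κ₀, hinit⟩ := exists_init
  refine ⟨κ₀ + 1, by omega, fun ε hε hε1 => ?_⟩
  set κ := κ₀ + 1 with hκ
  obtain ⟨Q, hQ1, hQ2⟩ : ∃ Q : ℕ, 2 / ε ≤ Q ∧ (Q : ℝ) ≤ 3 / ε := by
    refine ⟨⌈2 / ε⌉₊, Nat.le_ceil _, ?_⟩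
    have h1 := (Nat.ceil_lt_add_one (show 0 ≤ 2 / ε by positivity)).le
    -- The assumption `ε ≤ 1` leaves room to round `2 / ε` up to an integer below `3 / ε`.
    have h2 : 1 ≤ 1 / ε := by rwa [one_le_div hε]
    have h3 : 3 / ε = 2 / ε + 1 / ε := by ring
    linarith
  have hQr : 0 < (Q : ℝ) := lt_of_lt_of_le (by positivity) hQ1
  have hQ : 0 < Q := by exact_mod_cast hQr
  refine ⟨1 / (2 * Q), by positivity, fun p A k hsol => ?_⟩
  set q := 8 * κ * Q with hq
  have hspos : ∀ x : TreeInstance, 0 < pieceSize q x.n := fun x => by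
    have := bitLen_pos x.pos
    unfold pieceSize
    positivity
  obtain ⟨inst, sel, ok, di, ds, dk, Ti, Ts, To, bi, bs, bo, hcomp⟩ := exists_components q
  obtain ⟨V, κ', hV, H⟩ := hcomp p
  obtain ⟨Z, qZ, hZ⟩ := exists_sz_coverInstance_le q
  obtain ⟨W, qW, hW⟩ := exists_within q bi bs bo
  obtain ⟨N₁, hN₁⟩ := exists_forall_promise (show 0 < κ by omega) hε hQ1 hQ2
  obtain ⟨N₂, hN₂⟩ := exists_forall_timeBound_le (show 0 < κ by omega) hε hQ1 qZ A k
  set n₀ := max N₁ N₂ with hn₀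
  obtain ⟨init, m, dinit, hI⟩ := hinit q n₀ Q
  set P : ℕ → ℕ := fun n => (20 * (n + 1) ^ 2 + 2) ^ m with hP
  set Y : ℕ → ℕ := fun n => (n + 1) * (n * n * (4 * n + 4) + 2) + 3 + P n with hY
  set B : ℕ → ℕ := fun n => tuplesBound (List.range n) (2 * pieceSize q n) with hB
  set U : ℕ → ℕ := fun n => (P n + (P n + B n) ^ m) + Y n ^ κ₀ + P n +
    (W n + 2 * κ' + (2 * V + 52)) + 4 with hU
  have qP : Quasi P := (((Quasi.const 20).mul ((Quasi.id.add (.const 1)).pow 2)).add (.const 2)).pow m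
  have qY : Quasi Y := ((((Quasi.id.add (.const 1)).mul (((Quasi.id.mul .id).mul
    (((Quasi.const 4).mul .id).add (.const 4))).add (.const 2))).add (.const 3))).add qP
  have qU : Quasi U := ((((qP.add ((qP.add (Quasi.tuplesBound_range q)).pow m)).add
    (qY.pow κ₀)).add qP).add ((qW.add (.const (2 * κ'))).add (.const (2 * V + 52)))).add (.const 4)
  set F : ℕ → ℕ := fun n => U n * (max (n * n) 1 ^ guessSize q n₀ n) ^ κ * 2 ^ (n - n / Q) with hF
  obtain ⟨A', hA'⟩ : ∃ A' : ℕ, ∀ n : ℕ, (F n : ℝ) ≤ A' * (2 : ℝ) ^ ((1 - 1 / (2 * Q : ℝ)) * n) := by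
    refine exists_forall_le_of_eventually ?_ ?_
    · have : (1 : ℝ) ≤ Q := by exact_mod_cast hQ
      have : 1 / (2 * Q : ℝ) ≤ 1 := by rw [div_le_one (by positivity)]; linarith
      linarith
    · obtain ⟨N₃, hN₃⟩ := exists_forall_total_le (κ := κ) hQ qU
      refine ⟨max n₀ N₃ + 1, fun n hn => ?_⟩
      have hs : 0 < pieceSize q n := by
        have := bitLen_pos (show 0 < n by omega)
        unfold pieceSize
        positivity
      have h := hN₃ n (by omega)
      rwa [← guessSize_of_le hs (n₀ := n₀) (by omega)] at h
  have main : ∀ x : TreeInstance, ∃ gs : List (List (ℕ × ℕ)), (∀ g ∈ gs, ∀ e ∈ g, e ∈ pairs x.n) ∧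
      Halts (decideBy init inst sel ok p V) (start x.encode) (fun σ' t => t ≤ F x.n ∧
        ∃ f', σ' 0 = enc f' ∧ (f' = true → ∃ g ∈ gs, ∃ l, Shows (pieceSize q) (inputOf x)
          (tuples (List.range x.n) (2 * pieceSize q x.n)) g l)) ∧
      (x.IsYes → 2 / 3 ≤ prob (decideBy init inst sel ok p V) (start x.encode)
        fun σ' => σ' 0 = enc true) := by
    intro x
    have hb := guessSize_le q n₀ x.n (hspos x)
    obtain ⟨σ, t₀, h₀, hr, ht₀⟩ := hI (inputOf x)
    rw [enc_inputOf] at h₀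
    have hx1 : (inputOf x).1 = x.n := rfl
    rw [hx1] at hr ht₀
    rw [quot_eq hQ] at hr ht₀
    have hWx := fun g hg => hW x _ hb g hg
    refine ⟨tuples (pairs x.n) (guessSize q n₀ x.n), fun g hg => (mem_tuples.1 hg).2, ?_, fun hx => ?_⟩
    · refine (H.halts_decideBy hWx h₀ hr).mono ?_
      rintro σ' t ⟨ht, hf⟩
      refine ⟨ht.trans ?_, hf⟩
      rw [length_tuples, length_pairs]
      have hM : 1 ≤ max (x.n * x.n) 1 ^ guessSize q n₀ x.n := Nat.one_le_pow _ _ (by omega)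
      have hG : (x.n * x.n) ^ guessSize q n₀ x.n ≤ max (x.n * x.n) 1 ^ guessSize q n₀ x.n :=
        Nat.pow_le_pow_left (le_max_left _ _) _
      refine le_trans ?_ (total_le_aux (a := P x.n + (P x.n + B x.n) ^ m) (b := W x.n) (c := κ')
        (d := 2 * V + 52) (e := 4) (κ := κ₀) (y := Y x.n) (P := P x.n) hM
        (Nat.one_le_two_pow (n := x.n - x.n / Q)) hG)
      have hsz : (sz (inputOf x) + 2) ^ m ≤ P x.n :=
        Nat.pow_le_pow_left (Nat.add_le_add_right (sz_inputOf_le x) 2) m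
      have h1 : ((sz (inputOf x) + 2) ^ m + B x.n) ^ m ≤ (P x.n + B x.n) ^ m :=
        Nat.pow_le_pow_left (Nat.add_le_add_right hsz _) m
      have h2 : ((sz (inputOf x) + 2) ^ m + tuplesBound (pairs x.n) (guessSize q n₀ x.n)) ^ κ₀ ≤
          (max (x.n * x.n) 1 ^ guessSize q n₀ x.n * Y x.n) ^ κ₀ := by
        refine Nat.pow_le_pow_left ?_ _
        have h3 := tuplesBound_pairs_le hb
        have h4 : P x.n ≤ max (x.n * x.n) 1 ^ guessSize q n₀ x.n * P x.n :=
          Nat.le_mul_of_pos_left _ hM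
        rw [hY]
        dsimp only
        rw [mul_add _ _ (P x.n)]
        omega
      have h3 : (sz (inputOf x) + 2) ^ m * 2 ^ (x.n - x.n / Q) ≤ P x.n * 2 ^ (x.n - x.n / Q) :=
        Nat.mul_le_mul_right _ hsz
      have h4 : W x.n + κ' * (2 ^ (x.n - x.n / Q) + 1) + 2 * V + 52 =
          W x.n + κ' * (2 ^ (x.n - x.n / Q) + 1) + (2 * V + 52) := by ring
      rw [h4]
      refine Nat.add_le_add_right (Nat.add_le_add_right ?_ _) _
      refine ht₀.trans (Nat.add_le_add (Nat.add_le_add (Nat.add_le_add hsz h1) h2) h3)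
    · refine H.prob_decideBy hWx h₀ hr ?_
      exact exists_good_guess (κ := κ) (Q := Q) H hV hsol hx (hspos x)
        (fun h j hj => hN₁ x.n (by omega) j hj) (fun h z j hz hj => hN₂ x.n (by omega) z j hz hj)
        (hZ x)
  -- The bound `F` depends on `n` alone, so no polynomial factor in the instance size is needed.
  refine ⟨decideBy init inst sel ok p V, fun hp => ⟨dinit, ⟨?_, trivial⟩⟩, A', 0, fun x => ?_⟩
  · exact ⟨⟨trivial, trivial, trivial, di, resetVars_deterministic _ _, trivial, trivial⟩,
      clocked_deterministic hp, trivial, ds, trivial, dk, trivial, trivial⟩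
  · obtain ⟨gs, hgs, h1, h2⟩ := main x
    refine ⟨fun ω => ?_, ?_⟩
    · obtain ⟨c, s', t, h3, h4, -⟩ := h1 ω
      refine ⟨c, s', t, h3, ?_⟩
      have h5 : (t : ℝ) ≤ F x.n := by exact_mod_cast h4
      refine h5.trans ((hA' x.n).trans (le_of_eq ?_))
      simp [Problem.timeBound, directedNTree]
    · classical
      rw [outputProb_eq_prob]
      by_cases hx : x.IsYes
      · refine (h2 hx).trans (prob_mono fun s' h => ?_)
        change s' 0 = Data.ofBool (decide x.IsYes)
        rw [h, decide_eq_true hx]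
        rfl
      -- On a no-instance the answer is correct for all coins, by soundness.
      · refine two_thirds_le_one.trans (h1.one_le_prob (T := F x.n) ?_)
        rintro s' t ⟨ht, f, hf, hsound⟩
        refine ⟨ht, ?_⟩
        change s' 0 = Data.ofBool (decide x.IsYes)
        rw [hf, decide_eq_false hx]
        cases f with
        | false => rfl
        | true =>
          obtain ⟨g, hg, l, hl⟩ := hsound rfl
          refine absurd ?_ hx
          unfold Shows accepts at hl
          dsimp only at hl
          rw [Bool.or_eq_true] at hl
          rcases hl with hl | hl
          · refine isYes_of_exactCover x (fun f hf y hy => ?_) hl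
            exact List.mem_range.1 ((mem_tuples.1 hf).2 y hy)
          · exact isYes_of_isEmbedding x (hgs g hg) hl

/-! ### The case `ε > 1` -/

/-- The Set Cover instance that consists of disjoint intervals of length `d`. -/
def intervals (n d : ℕ) : SetCoverInstance where
  n := n
  m := (n - 1) / d + 1
  sets a := Finset.univ.filter fun j : Fin n => (j : ℕ) / d = a
  covers j := ⟨⟨j / d, Nat.lt_succ_of_le (Nat.div_le_div_right (by omega))⟩, by simp⟩

theorem mem_sets_intervals {n d : ℕ} {a : Fin (intervals n d).m} {j : Fin (intervals n d).n} :
    j ∈ (intervals n d).sets a ↔ (j : ℕ) / d = a :=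
  (Finset.mem_filter (p := fun j : Fin n => (j : ℕ) / d = a)).trans
    (and_iff_right (Finset.mem_univ _))

theorem card_sets_intervals {n d : ℕ} (hd : 0 < d) (a : Fin (intervals n d).m) :
    ((intervals n d).sets a).card ≤ d := by
  have h : (((intervals n d).sets a).image fun j => j.val) ⊆
      Finset.Ico (a * d) (a * d + d) := by
    intro i hi
    obtain ⟨j, hj, rfl⟩ := Finset.mem_image.1 hi
    have hj' := mem_sets_intervals.1 hj
    rw [Finset.mem_Ico, ← hj']
    exact ⟨Nat.div_mul_le_self _ _, Nat.lt_div_mul_add hd⟩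
  have h1 := Finset.card_le_card h
  rw [Finset.card_image_of_injective _ fun _ _ => Fin.ext, Nat.card_Ico] at h1
  omega

theorem card_le_intervals {n d : ℕ} (I : Finset (Fin (intervals n d).m)) :
    I.card ≤ (n - 1) / d + 1 := by
  exact (Finset.card_le_univ I).trans (Fintype.card_fin _).le

theorem isDisjoint_intervals {n d : ℕ} (I : Finset (Fin (intervals n d).m)) :
    (intervals n d).IsDisjoint I := by
  intro a _ b _ hab
  rw [Finset.disjoint_left]
  intro j h1 h2
  exact hab (Fin.ext ((mem_sets_intervals.1 h1).symm.trans (mem_sets_intervals.1 h2)))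

theorem size_encode_intervals_le {n d : ℕ} (hn : 0 < n) :
    (intervals n d).encode.size ≤ 40 * n ^ 2 := by
  have h : (intervals n d).encode = enc (n, List.ofFn fun i : Fin (intervals n d).m =>
      List.ofFn fun j : Fin (intervals n d).n => decide (j ∈ (intervals n d).sets i)) := by
    rw [enc_pair]
    simp only [enc, List.map_ofFn, SetCoverInstance.encode]
    rfl
  rw [h]
  change sz _ ≤ _
  rw [sz_pair, sz_nat]
  have h1 := sz_le_of_forall (l := List.ofFn fun i : Fin (intervals n d).m =>
      List.ofFn fun j : Fin (intervals n d).n => decide (j ∈ (intervals n d).sets i))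
    (B := n * 4 + 1) fun r hr => by
      obtain ⟨u, rfl⟩ := (List.mem_ofFn' _ _).1 hr
      refine (sz_le_of_forall (B := 3) fun b _ => sz_bool b).trans (by simp [intervals])
  rw [List.length_ofFn] at h1
  have h2 : (intervals n d).m ≤ n := by
    have := Nat.div_le_self (n - 1) d
    change (n - 1) / d + 1 ≤ n
    omega
  have h3 : (intervals n d).m * (n * 4 + 1 + 1) ≤ n * (n * 4 + 1 + 1) := Nat.mul_le_mul_right _ h2
  nlinarith

/-- For `ε > 1` the time bound tends to `0` along instances of polynomial size, while every run
takes a step. The promise is met for large `n` by splitting the ground set into intervals of length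
about `(C / ε) log n`. -/
theorem not_solvedBy_of_one_lt {C ε : ℝ} (hC : 4 ≤ C) (hε : 1 < ε) (p : Prog) (A k : ℕ) :
    ¬ (deltaSetCover (fun n : ℕ => C / ε * Real.log n) (1 * ε)).SolvedBy p (1 - ε) A k := by
  intro h
  have hε0 : 0 < ε := by linarith
  have hr : (2 : ℝ) ^ (1 - ε) < 1 := Real.rpow_lt_one_of_one_lt_of_neg (by norm_num) (by linarith)
  have t1 : Filter.Tendsto (fun n : ℕ => (A : ℝ) * 40 ^ k * ((n : ℝ) ^ (2 * k) *
      ((2 : ℝ) ^ (1 - ε)) ^ n)) Filter.atTop (nhds 0) := by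
    have := (tendsto_pow_const_mul_const_pow_of_abs_lt_one (2 * k) (r := (2 : ℝ) ^ (1 - ε))
      (by rwa [abs_of_nonneg (by positivity)])).const_mul ((A : ℝ) * 40 ^ k)
    rwa [mul_zero] at this
  have t2 : Filter.Tendsto (fun n : ℕ => Real.log n) Filter.atTop Filter.atTop :=
    Real.tendsto_log_atTop.comp tendsto_natCast_atTop_atTop
  have t3 : ∀ᶠ n : ℕ in Filter.atTop, ‖Real.log (n : ℝ)‖ ≤ 1 / 4 * ‖(n : ℝ)‖ :=
    tendsto_natCast_atTop_atTop.eventually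
      (Real.isLittleO_log_id_atTop.bound (by norm_num : (0 : ℝ) < 1 / 4))
  obtain ⟨n, ⟨⟨h1, h2⟩, h3⟩, hn⟩ := (((t1.eventually (gt_mem_nhds one_pos)).and
    (t2.eventually_ge_atTop (ε / C))).and t3 |>.and (Filter.eventually_gt_atTop 0)).exists
  have hlog : 0 ≤ Real.log n := Real.log_natCast_nonneg n
  rw [Real.norm_of_nonneg hlog, Real.norm_of_nonneg (Nat.cast_nonneg n)] at h3
  set d := ⌊C / ε * Real.log n⌋₊ with hd
  have hone : 1 ≤ C / ε * Real.log n := by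
    rw [div_le_iff₀ (by linarith)] at h2
    rw [div_mul_eq_mul_div, le_div_iff₀ hε0]
    linarith
  have hdle : (d : ℝ) ≤ C / ε * Real.log n := Nat.floor_le (by linarith)
  have hdlt : C / ε * Real.log n < d + 1 := Nat.lt_floor_add_one _
  have hd1 : 1 ≤ d := Nat.le_floor (by exact_mod_cast hone)
  have hd1' : (1 : ℝ) ≤ d := by exact_mod_cast hd1
  have hmn : ((n - 1) / d + 1) * d ≤ n + d := by
    have := Nat.div_mul_le_self (n - 1) d
    rw [add_mul]; omega
  have hm : (((n - 1) / d + 1 : ℕ) : ℝ) * Real.log n ≤ ε * n := by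
    have e1 : (((n - 1) / d + 1 : ℕ) : ℝ) * d ≤ n + d := by exact_mod_cast hmn
    set M : ℝ := (((n - 1) / d + 1 : ℕ) : ℝ) with hM
    have hM0 : 0 ≤ M := Nat.cast_nonneg _
    rw [div_mul_eq_mul_div, div_lt_iff₀ hε0] at hdlt
    rw [div_mul_eq_mul_div, le_div_iff₀ hε0] at hdle
    -- Rounding down to `d ≥ 1` loses at most a factor of two. With `C ≥ 4` and `log n ≤ n / 4`,
    -- both resulting terms are at most half of `C ε n`.
    have e2 : C * Real.log n ≤ 2 * d * ε := by nlinarith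
    have e3 : M * (C * Real.log n) ≤ 2 * ε * (n + d) := by
      calc M * (C * Real.log n) ≤ M * (2 * d * ε) := mul_le_mul_of_nonneg_left e2 hM0
        _ = 2 * ε * (M * d) := by ring
        _ ≤ _ := mul_le_mul_of_nonneg_left e1 (by positivity)
    have hn0 : (0 : ℝ) ≤ n := Nat.cast_nonneg n
    have e4 : C * (M * Real.log n) ≤ C * (ε * n) := by
      have e5 : 2 * ε * n ≤ C * (ε * n) / 2 := by
        nlinarith [mul_le_mul_of_nonneg_right hC (mul_nonneg hε0.le hn0)]
      have e6 : C * Real.log n * 2 ≤ C * (ε * n) / 2 := by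
        have : Real.log n * 4 ≤ ε * n := by nlinarith
        nlinarith
      nlinarith
    exact le_of_mul_le_mul_left e4 (by linarith)
  have hX : (∀ i, (((intervals n d).sets i).card : ℝ) ≤ C / ε * Real.log (intervals n d).n) ∧
      ∀ I, (intervals n d).IsOptimal I → (I.card : ℝ) * Real.log (intervals n d).n ≤
        1 * ε * (intervals n d).n ∧ (intervals n d).IsDisjoint I := by
    refine ⟨fun i => le_trans ?_ hdle, fun I _ => ⟨?_, isDisjoint_intervals I⟩⟩
    · exact_mod_cast card_sets_intervals hd1 i
    · rw [one_mul]
      refine le_trans (mul_le_mul_of_nonneg_right ?_ hlog) hm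
      exact_mod_cast card_le_intervals I
  obtain ⟨c, s', t, g1, g2⟩ := (h ⟨intervals n d, hX⟩).1 fun _ => false
  have g3 : (1 : ℝ) ≤ t := by exact_mod_cast g1.length_add_one_le.2
  have g4 : (((intervals n d).encode.size : ℕ) : ℝ) ≤ 40 * (n : ℝ) ^ 2 := by
    exact_mod_cast size_encode_intervals_le (d := d) hn
  have g5 : (t : ℝ) ≤ (A : ℝ) * (((intervals n d).encode.size : ℕ) : ℝ) ^ k *
      (2 : ℝ) ^ ((1 - ε) * (n : ℝ)) := g2
  have g6 : (A : ℝ) * (((intervals n d).encode.size : ℕ) : ℝ) ^ k *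
      (2 : ℝ) ^ ((1 - ε) * (n : ℝ)) ≤ A * (40 * (n : ℝ) ^ 2) ^ k * ((2 : ℝ) ^ (1 - ε)) ^ n := by
    rw [Real.rpow_mul (by norm_num), Real.rpow_natCast]
    gcongr
  rw [mul_pow, ← pow_mul] at g6
  linarith

end LogSetCover

/-! ### The theorem -/

theorem theorem1 :
    ∃ C : ℝ, 0 < C ∧ ∃ K : ℝ, 0 < K ∧ ∀ ε : ℝ, 0 < ε → ∃ δ : ℝ, 0 < δ ∧
      ((LogSetCover.deltaSetCover (fun n : ℕ => C / ε * Real.log n) (K * ε)).SolvableInTime (1 - ε) →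
        LogSetCover.directedNTree.SolvableInTime (1 - δ)) ∧
      ((LogSetCover.deltaSetCover (fun n : ℕ => C / ε * Real.log n) (K * ε)).RandSolvableInTime
          (1 - ε) →
        LogSetCover.directedNTree.RandSolvableInTime (1 - δ)) := by
  obtain ⟨κ, hκ, h⟩ := LogSetCover.exists_solvedBy_directedNTree
  have hκ1 : (1 : ℝ) ≤ κ := by exact_mod_cast hκ
  refine ⟨288 * κ, by positivity, 1, one_pos, fun ε hε => ?_⟩
  -- For `ε > 1` any `δ` will do, because the hypothesis fails.
  rcases le_or_gt ε 1 with hε1 | hε1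
  · obtain ⟨δ, hδ, h⟩ := h ε hε hε1
    refine ⟨δ, hδ, fun hs => ?_, fun ⟨p, A, k, hs⟩ => ?_⟩
    · obtain ⟨p, hp, A, k, hs⟩ := hs.exists_solvedBy
      obtain ⟨p', hp', A', k', hs'⟩ := h p A k hs
      exact hs'.solvableInTime (hp' hp)
    · obtain ⟨p', -, A', k', hs'⟩ := h p A k hs
      exact hs'.randSolvableInTime
  · have hC : (4 : ℝ) ≤ 288 * κ := by linarith
    refine ⟨1, one_pos, fun hs => ?_, fun ⟨p, A, k, hs⟩ => ?_⟩
    · obtain ⟨p, -, A, k, hs⟩ := hs.exists_solvedBy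
      exact absurd hs (LogSetCover.not_solvedBy_of_one_lt hC hε1 p A k)
    · exact absurd hs (LogSetCover.not_solvedBy_of_one_lt hC hε1 p A k)
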